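/- Let $G$ be a compact connected semi-simple Lie group with Lie algebra $\mathfrak g=T_eG$, let $\langle\cdot,\cdot\rangle$ be an $\mathrm{Ad}(G)$-invariant inner product on $\mathfrak g$ and $g_G$ the bi-invariant Riemannian metric of $G$ that it defines. Let $H^0([0,1],\mathfrak g)$ be the Hilbert space of square-integrable maps $[0,1]\to\mathfrak g$ with the inner product $\langle u,v\rangle_0=\int_0^1\langle u(t),v(t)\rangle\,dt$. For each $u\in H^0([0,1],\mathfrak g)$ there is exactly one $H^1$-path $\mathbf g_u:[0,1]\to G$ with $\mathbf g_u(0)=e$ and $(R_{\mathbf g_u(t)})_*^{-1}(\mathbf g_u'(t))=u(t)$ for almost every $t$, where $R_g$ denotes right translation by $g$; the parallel transport map is $\phi:H^0([0,1],\mathfrak g)\to G$, $\phi(u)=\mathbf g_u(1)$. **Proposition.** The map $\phi:(H^0([0,1],\mathfrak g),\langle\cdot,\cdot\rangle_0)\to(G,g_G)$ is a Riemannian submersion onto $G$ (smooth, surjective, with surjective differentials that are isometric on the orthogonal complements of their kernels), and each of its fibres is a minimal regularizable submanifold. Here a submanifold $M$ of finite codimension of a Hilbert space $V$ is called *proper Fredholm*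 if its normal exponential map $(p,\xi)\mapsto p+\xi$, from the normal bundle to $V$, is a Fredholm map (its differential at each point is a Fredholm operator) and is proper on the closed ball normal bundle of each radius. A self-adjoint compact operator $A$ with eigenvalues $-\lambda_1^-\le-\lambda_2^-\le\cdots\le0\le\cdots\le\lambda_2^+\le\lambda_1^+$ (listed with multiplicities, each of the two sequences continued by zeros if it is finite) is called *regularizable* if $\sum_i\big((\lambda_i^+)^2+(\lambda_i^-)^2\big)<\infty$ and the series $\sum_{i=1}^\infty(\lambda_i^+-\lambda_i^-)$ converges; its sum is the *regularized trace* of $A$. A *minimal regularizable submanifold* is a proper Fredholm submanifold such that for every point $p$ and every normal vector $\xi$ at $p$ the shape operator $A_\xi$ is a regularizable self-adjoint compact operator with regularized trace $0$. -/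

import Mathlib

open scoped Manifold ContDiff Topology
open MeasureTheory Set Filter Bundle

/-! ### Submanifolds of a Hilbert space -/

section HilbertSubmanifolds

/-- The tangent space at `p` of a subset `S` (in practice a submanifold) of a normed space:
the space of velocities at `p` of smooth curves running in `S`.  For a submanifold the set of these
velocities is already a linear subspace, so that taking the span changes nothing. -/
def curveTangentSpace {W : Type*} [NormedAddCommGroup W] [NormedSpace ℝ W]
    (S : Set W) (p : W) : Submodule ℝ W :=
  Submodule.span ℝ {v : W | ∃ γ : ℝ → W, ContDiffAt ℝ ∞ γ 0 ∧ γ 0 = p ∧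
    (∀ᶠ t in 𝓝 (0 : ℝ), γ t ∈ S) ∧ HasDerivAt γ v 0}

variable {V : Type*} [NormedAddCommGroup V] [InnerProductSpace ℝ V]

/-- The normal space at `p` of a subset `M` of a Hilbert space. -/
noncomputable def normalSpaceAt (M : Set V) (p : V) : Submodule ℝ V :=
  (curveTangentSpace M p)ᗮ

/-- `M` is an (embedded, smooth) submanifold of finite codimension: near each of its points it is
the zero set of a smooth submersion to `ℝᵏ`. -/
def IsFiniteCodimSubmanifold (M : Set V) : Prop :=
  ∃ k : ℕ, ∀ p ∈ M, ∃ (U : Set V) (F : V → EuclideanSpace ℝ (Fin k)),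
    IsOpen U ∧ p ∈ U ∧ ContDiffOn ℝ ∞ F U ∧
    (∀ q ∈ U, Function.Surjective (fderiv ℝ F q)) ∧
    M ∩ U = {q ∈ U | F q = 0}

/-- The normal bundle of `M`, as a subset of `V × V` (pairs of a base point and a normal vector). -/
def normalBundleSet (M : Set V) : Set (V × V) :=
  {x | x.1 ∈ M ∧ x.2 ∈ normalSpaceAt M x.1}

/-- A proper Fredholm submanifold: a submanifold of finite codimension whose normal exponential map
`(p, ξ) ↦ p + ξ` is a Fredholm map (its differential, i.e. the restriction of
`(X, Y) ↦ X + Y` to the tangent space of the normal bundle, is a Fredholm operator everywhere)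
and is proper on the closed ball normal bundle of each radius. -/
structure IsProperFredholmSubmanifold (M : Set V) : Prop where
  submanifold : IsFiniteCodimSubmanifold M
  fredholm : ∀ x ∈ normalBundleSet M,
    ((ContinuousLinearMap.fst ℝ V V + ContinuousLinearMap.snd ℝ V V).comp
      (curveTangentSpace (normalBundleSet M) x).subtypeL).IsFredholm
  proper : ∀ r : ℝ, IsProperMap
    (fun x : {x : V × V // x ∈ normalBundleSet M ∧ ‖x.2‖ ≤ r} => x.1.1 + x.1.2)

/-- `A` is the shape operator of `M` at `p` for the normal vector `ξ`: for a smooth normal field `N`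
of `M` near `p` with `N p = ξ`, the vector `A X` is the tangential part of `-D_X N`
(by the Weingarten formula this does not depend on the choice of `N`). -/
def IsShapeOperator (M : Set V) (p ξ : V)
    (A : curveTangentSpace M p →L[ℝ] curveTangentSpace M p) : Prop :=
  ∃ N : V → V, ContDiffAt ℝ ∞ N p ∧ N p = ξ ∧
    (∀ᶠ q in 𝓝[M] p, N q ∈ normalSpaceAt M q) ∧
    ∀ X Y : curveTangentSpace M p,
      inner ℝ (A X : V) (Y : V) = - inner ℝ (fderiv ℝ N p (X : V)) (Y : V)

end HilbertSubmanifolds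

/-! ### Regularized traces -/

section RegularizedTrace

variable {T : Type*} [NormedAddCommGroup T] [InnerProductSpace ℝ T]

/-- `lam 0 ≥ lam 1 ≥ ⋯ ≥ 0` lists the positive eigenvalues of the self-adjoint compact operator `A`
in decreasing order and with multiplicities, continued by zeros if there are only finitely many
of them. -/
def IsPosEigenvalueSeq (A : T →L[ℝ] T) (lam : ℕ → ℝ) : Prop :=
  Antitone lam ∧ (∀ i, 0 ≤ lam i) ∧
  ∀ μ : ℝ, 0 < μ → {i : ℕ | lam i = μ}.encard =
    (Module.finrank ℝ (Module.End.eigenspace (A : T →ₗ[ℝ] T) μ) : ℕ∞)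

/-- The self-adjoint compact operator `A` is regularizable, with regularized trace `τ`: with
`lamP i` the positive eigenvalues and `-lamN i` the negative ones, the sum of the squares of all
eigenvalues (that is, the trace of `A²`) is finite and `∑ i, (lamP i - lamN i)` converges to `τ`. -/
def HasRegularizedTrace (A : T →L[ℝ] T) (τ : ℝ) : Prop :=
  (A : T →ₗ[ℝ] T).IsSymmetric ∧ IsCompactOperator A ∧
  ∃ lamP lamN : ℕ → ℝ, IsPosEigenvalueSeq A lamP ∧ IsPosEigenvalueSeq (-A) lamN ∧
    Summable (fun i => lamP i ^ 2) ∧ Summable (fun i => lamN i ^ 2) ∧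
    Tendsto (fun n => ∑ i ∈ Finset.range n, (lamP i - lamN i)) atTop (𝓝 τ)

variable {V : Type*} [NormedAddCommGroup V] [InnerProductSpace ℝ V]

/-- A minimal regularizable submanifold: a proper Fredholm submanifold all of whose shape operators
are regularizable with regularized trace zero. -/
structure IsMinimalRegularizableSubmanifold (M : Set V) : Prop where
  properFredholm : IsProperFredholmSubmanifold M
  regularizedTrace_eq_zero : ∀ p ∈ M, ∀ ξ ∈ normalSpaceAt M p,
    ∃ A : curveTangentSpace M p →L[ℝ] curveTangentSpace M p,
      IsShapeOperator M p ξ A ∧ HasRegularizedTrace A 0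

end RegularizedTrace

/-! ### Riemannian submersions from a Hilbert space -/

section RiemannianSubmersion

/-- A Riemannian submersion of a Hilbert space `V` onto a Riemannian manifold `N`: a smooth
surjective map with surjective differentials, which are isometric on the orthogonal complements
of their kernels. -/
structure IsRiemannianSubmersion {V : Type*} [NormedAddCommGroup V] [InnerProductSpace ℝ V]
    {E : Type*} [NormedAddCommGroup E] [NormedSpace ℝ E]
    {N : Type*} [TopologicalSpace N] [ChartedSpace E N]
    [RiemannianBundle (fun x : N => TangentSpace 𝓘(ℝ, E) x)] (φ : V → N) : Prop where
  contMDiff : ContMDiff 𝓘(ℝ, V) 𝓘(ℝ, E) ∞ φ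
  surjective : Function.Surjective φ
  mfderiv_surjective : ∀ u : V, Function.Surjective (mfderiv 𝓘(ℝ, V) 𝓘(ℝ, E) φ u)
  isometry : ∀ u X Y : V,
    (∀ Z : V, mfderiv 𝓘(ℝ, V) 𝓘(ℝ, E) φ u Z = 0 → inner ℝ X Z = 0) →
    (∀ Z : V, mfderiv 𝓘(ℝ, V) 𝓘(ℝ, E) φ u Z = 0 → inner ℝ Y Z = 0) →
    inner ℝ (mfderiv 𝓘(ℝ, V) 𝓘(ℝ, E) φ u X) (mfderiv 𝓘(ℝ, V) 𝓘(ℝ, E) φ u Y) = inner ℝ X Y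

end RiemannianSubmersion

/-! ### Lie groups and the parallel transport map -/

section LieGroups

variable (E : Type*) [NormedAddCommGroup E] [NormedSpace ℝ E]
  (G : Type*) [TopologicalSpace G] [ChartedSpace E G] [Group G]

/-- The Lie group `G` is semi-simple, i.e. its Lie algebra is. -/
def IsSemisimpleLieGroup [FiniteDimensional ℝ E] [LieGroup 𝓘(ℝ, E) ∞ G] : Prop :=
  haveI : CompleteSpace E := FiniteDimensional.complete ℝ E
  haveI : LieGroup 𝓘(ℝ, E) (minSmoothness ℝ 3) G :=
    LieGroup.of_le (n := ∞) (by rw [minSmoothness_of_isRCLikeNormedField]; exact ENat.LEInfty.out)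
  LieAlgebra.IsSemisimple ℝ (GroupLieAlgebra 𝓘(ℝ, E) G)

/-- The given Riemannian metric of `G` is bi-invariant.  Its value at the identity is then an
`Ad(G)`-invariant inner product of the Lie algebra, and every such inner product arises from
exactly one bi-invariant metric. -/
def IsBiinvariantMetric [RiemannianBundle (fun x : G => TangentSpace 𝓘(ℝ, E) x)] : Prop :=
  ∀ (g h : G) (v w : TangentSpace 𝓘(ℝ, E) h),
    inner ℝ (mfderiv 𝓘(ℝ, E) 𝓘(ℝ, E) (fun x : G => g * x) h v)
      (mfderiv 𝓘(ℝ, E) 𝓘(ℝ, E) (fun x : G => g * x) h w) = inner ℝ v w ∧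
    inner ℝ (mfderiv 𝓘(ℝ, E) 𝓘(ℝ, E) (fun x : G => x * g) h v)
      (mfderiv 𝓘(ℝ, E) 𝓘(ℝ, E) (fun x : G => x * g) h w) = inner ℝ v w

variable {E G}

/-- The image of `v ∈ 𝔤` under the differential of the right translation by `g`. -/
noncomputable def rightTranslate (g : G) (v : TangentSpace 𝓘(ℝ, E) (1 : G)) :
    TangentSpace 𝓘(ℝ, E) g :=
  mfderiv 𝓘(ℝ, E) 𝓘(ℝ, E) (fun x : G => x * g) (1 : G) v

variable (E) in
/-- `γ` is an `H¹`-path `[0,1] → G` (the values of `γ` outside `[0,1]` play no role): it is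
continuous and, for all smooth functions `f` (equivalently, for the coordinate functions of charts),
`f ∘ γ` is absolutely continuous with square-integrable derivative. -/
def IsH1Path (γ : ℝ → G) : Prop :=
  ContinuousOn γ (Icc 0 1) ∧ ∀ f : G → ℝ, ContMDiff 𝓘(ℝ, E) 𝓘(ℝ, ℝ) ∞ f →
    AbsolutelyContinuousOnInterval (f ∘ γ) 0 1 ∧
    MemLp (deriv (f ∘ γ)) 2 (volume.restrict (Icc (0 : ℝ) 1))

variable [RiemannianBundle (fun x : G => TangentSpace 𝓘(ℝ, E) x)]

variable (E G) in
/-- The Hilbert space `H⁰([0,1], 𝔤)` of square-integrable maps `[0,1] → 𝔤`, where `𝔤` is the tangent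
space of `G` at the identity with the inner product given by the metric of `G`. -/
abbrev H0 : Type _ :=
  Lp (TangentSpace 𝓘(ℝ, E) (1 : G)) 2 (volume.restrict (Icc (0 : ℝ) 1))

/-- `γ` is the `H¹`-path in `G` with `γ 0 = e` and `γ'(t) = (R_{γ(t)})_* u(t)` for almost all
`t ∈ [0,1]`. -/
def IsTransportPath (u : H0 E G) (γ : ℝ → G) : Prop :=
  IsH1Path E γ ∧ γ 0 = 1 ∧
  ∀ᵐ t ∂(volume.restrict (Icc (0 : ℝ) 1)),
    HasMFDerivAt 𝓘(ℝ, ℝ) 𝓘(ℝ, E) γ t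
      (ContinuousLinearMap.toSpanSingleton ℝ (rightTranslate (γ t) (u t)))

/-- The parallel transport map `u ↦ γ 1`, where `γ` is the path with initial value `e` determined
by `u`. -/
noncomputable def parallelTransportMap (u : H0 E G) : G :=
  Classical.epsilon (fun g : G => ∃ γ : ℝ → G, IsTransportPath u γ ∧ γ 1 = g)

end LieGroups

/-!
# The parallel transport map is a Riemannian submersion with minimal regularizable fibres

Write `γ_u` for the path in `G` that starts at the identity and has right logarithmic derivative `u`.
By the product rule, `γ_u γ_v` has the logarithmic derivative `u + Ad(γ_u) v`. For a bi-invariant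
metric `Ad` is isometric, so that `v ↦ u + Ad(γ_u) v` is an affine isometry of `L²` that sends the
origin to `u` and covers the left translation by `φ(u) = γ_u(1)` (`logPrimitive_add`). All local
statements about `φ` can thus be checked at the origin.

* **Small `u`.** In a chart at the identity, the equation for `γ_u` reads `x = ∫ F(x) u` with a smooth
  field of operators `F`. The implicit function theorem in the space of continuous functions solves it,
  smoothly in `u` (`exists_localFlow`, `exists_local_logPrimitive`). Finitely many steps along the
  segment from `0` to `u` then give the path for every `u` (`exists_isLogPrimitive`). It is unique, as
  the quotient `γ⁻¹ δ` of two solutions is an `H¹`-path with derivative zero (`IsLogPrimitive.eqOn`).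

* **Submersion.** At the origin the differential of `φ` is the integral over `[0,1]`, whose adjoint is
  the inclusion of the constant functions. At `u` it is therefore `dL ∘ N(u)†`, where `L` is the left
  translation by `φ(u)` and `N(u) ζ = Ad(γ_u) ζ` is an isometric embedding of the Lie algebra in `L²`
  (`normalFrame`, `hasMFDerivAt_transportEnd`). The image of `φ` is an open subgroup, hence everything.

* **Fibres.** The maps `N(u)` frame the normal spaces of the fibres globally
  (`isFramedSubmanifold_fibre`). Translated to the origin, the derivative of `u ↦ N(u) ζ` is the Volterra
  operator `X ↦ B(∫₀ᵗ X) ζ` with a bilinear map `B` (`exists_fderiv_normalFrame`). Such an operator is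
  compact and Hilbert–Schmidt and does not have the eigenvalue `-1`. This makes the normal exponential
  map Fredholm and the shape operators compact with square-summable eigenvalues. Properness follows from
  the fact that the fields `Ad(γ_u)`, with `u` in a bounded set, stay in a compact set of continuous
  functions, by the Arzelà–Ascoli theorem (`exists_isCompact_adjointField`).

* **Minimality.** On functions with integral zero, time reversal `X ↦ X(1 - t)` anticommutes with the
  primitive, and it fixes the constants. Translated to `u`, it is an isometry of the tangent space of
  the fibre that anticommutes with every shape operator. The spectrum is therefore symmetric, so that
  every partial sum `∑ (λᵢ⁺ - λᵢ⁻)` vanishes (`hasRegularizedTrace_zero_of_anticommute`,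
  `IsFramedSubmanifold.isMinimalRegularizableSubmanifold`).
-/

set_option linter.unusedSectionVars false

universe u

/-! ### Symmetric spectra and regularized traces -/

/-- A multiplicity function on the positive reals with finite second moment is listed, with
multiplicities, by a decreasing square-summable sequence, continued by zeros if it is finite. -/
theorem exists_antitone_seq_encard_fiber_eq (m : ℝ → ℕ) (C : ℝ)
    (hm : ∀ F : Finset ℝ, (∀ μ ∈ F, 0 < μ) → ∑ μ ∈ F, (m μ : ℝ) * μ ^ 2 ≤ C) :
    ∃ lam : ℕ → ℝ, Antitone lam ∧ (∀ i, 0 ≤ lam i) ∧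
      (∀ μ : ℝ, 0 < μ → {i : ℕ | lam i = μ}.encard = (m μ : ℕ∞)) ∧
      Summable (fun i => lam i ^ 2) := by
  classical
  -- only finitely many values with nonzero multiplicity lie above a positive level
  have hfin : ∀ c : ℝ, 0 < c → {μ : ℝ | c ≤ μ ∧ m μ ≠ 0}.Finite := by
    intro c hc
    by_contra hinf
    obtain ⟨n, hn⟩ := exists_nat_gt (C / c ^ 2)
    obtain ⟨F, hF, hcard⟩ := Set.Infinite.exists_subset_card_eq hinf n
    have h1 := hm F (fun μ hμ => hc.trans_le (hF hμ).1)
    have h2 : (n : ℝ) * c ^ 2 ≤ ∑ μ ∈ F, (m μ : ℝ) * μ ^ 2 := by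
      rw [← hcard, ← nsmul_eq_mul]
      refine Finset.card_nsmul_le_sum _ _ _ fun μ hμ => ?_
      have h3 := hF hμ
      have h4 : (1 : ℝ) ≤ m μ := by exact_mod_cast Nat.one_le_iff_ne_zero.mpr h3.2
      have h5 : c ^ 2 ≤ μ ^ 2 := by gcongr; exact h3.1
      nlinarith [sq_nonneg μ]
    rw [div_lt_iff₀ (by positivity)] at hn
    linarith
  -- the number of eigenvalues (with multiplicities) in `[c, ∞)`
  let N : ℝ → ℕ := fun c => ∑ᶠ μ ∈ {μ : ℝ | c ≤ μ}, m μ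
  have hfin' : ∀ c : ℝ, 0 < c → ({μ : ℝ | c ≤ μ} ∩ Function.support m).Finite := fun c hc => hfin c hc
  have hsplit : ∀ c d : ℝ, 0 < c → c ≤ d → N c = (∑ᶠ μ ∈ Ico c d, m μ) + N d := by
    intro c d hc hcd
    have : {μ : ℝ | c ≤ μ} = Ico c d ∪ {μ | d ≤ μ} := by
      ext x; simp only [mem_ofPred_eq, mem_union, mem_Ico]
      constructor
      · intro h
        rcases lt_or_ge x d with h1 | h1
        · exact Or.inl ⟨h, h1⟩
        · exact Or.inr h1
      · rintro (h | h)
        · exact h.1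
        · exact hcd.trans h
    simp only [N]
    rw [this, finsum_mem_union']
    · rw [Set.disjoint_left]
      intro x hx hx'
      exact absurd hx.2 (not_lt.mpr hx')
    · exact (hfin' c hc).subset (inter_subset_inter_left _ (fun x hx => hx.1))
    · exact hfin' d (hc.trans_le hcd)
  have hanti : ∀ c d : ℝ, 0 < c → c ≤ d → N d ≤ N c := fun c d hc hcd => by
    rw [hsplit c d hc hcd]; exact Nat.le_add_left _ _
  have hNpos : ∀ c, 0 < c → ∀ n, n < N c → c ≤ max 1 C := by
    intro c hc n hn
    have h0 : N c ≠ 0 := by omega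
    obtain ⟨μ, hμ, hmμ⟩ := exists_ne_zero_of_finsum_mem_ne_zero h0
    have h1 := hm {μ} (by simpa using hc.trans_le hμ)
    simp only [Finset.sum_singleton] at h1
    have h4 : (1 : ℝ) ≤ m μ := by exact_mod_cast Nat.one_le_iff_ne_zero.mpr hmμ
    have h5 : c ^ 2 ≤ μ ^ 2 := by gcongr; exact hμ
    by_contra hlt
    rw [not_le, max_lt_iff] at hlt
    nlinarith [sq_nonneg μ]
  let lam : ℕ → ℝ := fun n => sSup {c | 0 < c ∧ n < N c}
  have hbdd : ∀ n, BddAbove {c | 0 < c ∧ n < N c} :=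
    fun n => ⟨max 1 C, fun c hc => hNpos c hc.1 n hc.2⟩
  have hkey : ∀ n c, 0 < c → (c ≤ lam n ↔ n < N c) := by
    intro n c hc
    constructor
    · intro hcl
      by_contra hcon
      -- there is a gap to the left of `c`
      obtain ⟨d, hd0, hdc, hd⟩ : ∃ d, 0 < d ∧ d < c ∧ ∀ μ, d < μ → μ < c → m μ = 0 := by
        let A := (hfin (c / 2) (by positivity)).toFinset.filter (· < c)
        by_cases hA : A.Nonempty
        · refine ⟨A.max' hA, ?_, ?_, ?_⟩
          · have := Finset.max'_mem A hA
            simp only [A, Finset.mem_filter, Set.Finite.mem_toFinset, mem_ofPred_eq] at this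
            linarith [this.1.1]
          · have := Finset.max'_mem A hA
            simp only [A, Finset.mem_filter] at this
            exact this.2
          · intro μ h1 h2
            by_contra h3
            have h4 := Finset.max'_mem A hA
            simp only [A, Finset.mem_filter, Set.Finite.mem_toFinset, mem_ofPred_eq] at h4
            have h5 : μ ∈ A := by
              simp only [A, Finset.mem_filter, Set.Finite.mem_toFinset, mem_ofPred_eq]
              exact ⟨⟨h4.1.1.trans h1.le, h3⟩, h2⟩
            exact absurd (Finset.le_max' A μ h5) (not_le.mpr h1)
        · refine ⟨c / 2, by positivity, by linarith, ?_⟩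
          intro μ h1 h2
          by_contra h3
          refine hA ⟨μ, ?_⟩
          simp only [A, Finset.mem_filter, Set.Finite.mem_toFinset, mem_ofPred_eq]
          exact ⟨⟨h1.le, h3⟩, h2⟩
      have hle : lam n ≤ d := by
        refine Real.sSup_le ?_ hd0.le
        rintro e ⟨he0, hen⟩
        by_contra hlt
        rw [not_le] at hlt
        apply hcon
        rcases le_or_gt c e with h1 | h1
        · exact hen.trans_le (hanti c e hc h1)
        · have h2 : ∑ᶠ μ ∈ Ico e c, m μ = 0 := by
            refine finsum_mem_eq_zero_of_forall_eq_zero fun μ hμ => ?_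
            exact hd μ (hlt.trans_le hμ.1) hμ.2
          rw [hsplit e c he0 h1.le, h2, zero_add] at hen
          exact hen
      linarith
    · intro h
      exact le_csSup (hbdd n) ⟨hc, h⟩
  have hnonneg : ∀ i, 0 ≤ lam i := fun i => Real.sSup_nonneg (fun c hc => hc.1.le)
  have hcount : ∀ μ : ℝ, 0 < μ → {i : ℕ | lam i = μ}.encard = (m μ : ℕ∞) := by
    intro μ hμ
    obtain ⟨d, hμd, hd⟩ : ∃ d, μ < d ∧ ∀ ν, μ < ν → ν < d → m ν = 0 := by
      let A := (hfin μ hμ).toFinset.filter (μ < ·)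
      by_cases hA : A.Nonempty
      · refine ⟨A.min' hA, ?_, ?_⟩
        · have := Finset.min'_mem A hA
          simp only [A, Finset.mem_filter] at this
          exact this.2
        · intro ν h1 h2
          by_contra h3
          have h5 : ν ∈ A := by
            simp only [A, Finset.mem_filter, Set.Finite.mem_toFinset, mem_ofPred_eq]
            exact ⟨⟨h1.le, h3⟩, h1⟩
          exact absurd (Finset.min'_le A ν h5) (not_le.mpr h2)
      · refine ⟨μ + 1, by linarith, ?_⟩
        intro ν h1 h2
        by_contra h3
        refine hA ⟨ν, ?_⟩
        simp only [A, Finset.mem_filter, Set.Finite.mem_toFinset, mem_ofPred_eq]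
        exact ⟨⟨h1.le, h3⟩, h1⟩
    have hIco : ∀ e, μ < e → e ≤ d → N μ = m μ + N e := by
      intro e h1 h2
      rw [hsplit μ e hμ h1.le]
      congr 1
      have : ∑ᶠ ν ∈ Ico μ e, m ν = ∑ᶠ ν ∈ ({μ} : Set ℝ), m ν := by
        refine finsum_mem_inter_support_eq _ _ _ ?_
        ext ν
        simp only [mem_inter_iff, mem_Ico, Function.mem_support, mem_singleton_iff]
        constructor
        · rintro ⟨⟨h3, h4⟩, h5⟩
          refine ⟨?_, h5⟩
          by_contra h6
          exact h5 (hd ν (lt_of_le_of_ne h3 (Ne.symm h6)) (h4.trans_le h2))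
        · rintro ⟨rfl, h5⟩
          exact ⟨⟨le_rfl, h1⟩, h5⟩
      rw [this, finsum_mem_singleton]
    have hset : {i : ℕ | lam i = μ} = Finset.Ico (N d) (N μ) := by
      ext i
      simp only [mem_ofPred_eq, Finset.coe_Ico, mem_Ico]
      constructor
      · intro h
        refine ⟨?_, (hkey i μ hμ).1 h.ge⟩
        by_contra hlt
        rw [not_le] at hlt
        have := (hkey i d (hμ.trans hμd)).2 hlt
        linarith
      · rintro ⟨h1, h2⟩
        refine le_antisymm ?_ ((hkey i μ hμ).2 h2)
        by_contra hlt
        rw [not_le] at hlt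
        set e := min (lam i) d
        have he : μ < e := lt_min hlt hμd
        have h3 := (hkey i e (hμ.trans he)).1 (min_le_left _ _)
        have h4 := hIco e he (min_le_right _ _)
        have h5 := hIco d hμd le_rfl
        omega
    rw [hset, Set.encard_coe_eq_coe_finsetCard, Nat.card_Ico, hIco d hμd le_rfl]
    simp
  refine ⟨lam, ?_, hnonneg, hcount, ?_⟩
  · intro i j hij
    rcases (hnonneg j).eq_or_lt with h | h
    · rw [← h]; exact hnonneg i
    · exact (hkey i _ h).2 (lt_of_le_of_lt hij ((hkey j _ h).1 le_rfl))
  · refine summable_of_sum_range_le (c := C) (fun i => sq_nonneg _) fun k => ?_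
    let F := ((Finset.range k).image lam).filter (0 < ·)
    have h1 : ∑ i ∈ Finset.range k, lam i ^ 2 =
        ∑ i ∈ (Finset.range k).filter (fun i => 0 < lam i), lam i ^ 2 := by
      rw [Finset.sum_filter]
      refine Finset.sum_congr rfl fun i _ => ?_
      split_ifs with h
      · rfl
      · rw [le_antisymm (not_lt.mp h) (hnonneg i)]; simp
    rw [h1, ← Finset.sum_fiberwise_of_maps_to (t := F) (g := lam)]
    · refine (Finset.sum_le_sum fun μ hμ => ?_).trans (hm F fun μ hμ => (Finset.mem_filter.1 hμ).2)
      have hμ0 := (Finset.mem_filter.1 hμ).2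
      rw [Finset.sum_congr rfl (g := fun _ => μ ^ 2)
        (fun i hi => by rw [(Finset.mem_filter.1 hi).2]), Finset.sum_const, nsmul_eq_mul]
      gcongr
      have h2 : (((Finset.range k).filter (fun i => 0 < lam i)).filter (lam · = μ) : Set ℕ).encard
          ≤ {i : ℕ | lam i = μ}.encard := by
        refine Set.encard_le_encard fun i hi => ?_
        simp only [Finset.coe_filter, mem_ofPred_eq] at hi
        exact hi.2
      rw [hcount μ hμ0, Set.encard_coe_eq_coe_finsetCard] at h2
      exact_mod_cast h2
    · intro i hi
      simp only [Finset.mem_filter] at hi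
      simp only [F, Finset.mem_filter, Finset.mem_image]
      exact ⟨⟨i, hi.1, rfl⟩, hi.2⟩

/-- A symmetric Hilbert–Schmidt operator that anticommutes with an isometry has a symmetric spectrum.
One sequence then lists both the positive and the absolute values of the negative eigenvalues, so that
every partial sum of the regularized trace vanishes. -/
theorem hasRegularizedTrace_zero_of_anticommute {T : Type*} [NormedAddCommGroup T]
    [InnerProductSpace ℝ T] (A : T →L[ℝ] T) (hsymm : (A : T →ₗ[ℝ] T).IsSymmetric)
    (hcomp : IsCompactOperator A) (C : ℝ)
    (hHS : ∀ (ι : Type) [Fintype ι] (e : ι → T), Orthonormal ℝ e → ∑ i, ‖A (e i)‖ ^ 2 ≤ C)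
    (S : T ≃ₗ[ℝ] T) (hS : ∀ x, A (S x) = - S (A x)) :
    HasRegularizedTrace A 0 := by
  classical
  let m : ℝ → ℕ := fun μ => Module.finrank ℝ (Module.End.eigenspace (A : T →ₗ[ℝ] T) μ)
  have hm : ∀ F : Finset ℝ, (∀ μ ∈ F, 0 < μ) → ∑ μ ∈ F, (m μ : ℝ) * μ ^ 2 ≤ C := by
    intro F hF
    -- eigenvalues with an eigenspace of finite positive dimension
    let F' := F.filter (fun μ => m μ ≠ 0)
    have hsum : ∑ μ ∈ F, (m μ : ℝ) * μ ^ 2 = ∑ μ ∈ F', (m μ : ℝ) * μ ^ 2 := by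
      rw [Finset.sum_filter]
      refine Finset.sum_congr rfl fun μ _ => ?_
      split_ifs with h
      · rfl
      · rw [not_not] at h; rw [h]; simp
    rw [hsum]
    have hfd : ∀ μ : F', FiniteDimensional ℝ (Module.End.eigenspace (A : T →ₗ[ℝ] T) μ) :=
      fun μ => Module.finite_of_finrank_pos (Nat.pos_of_ne_zero (Finset.mem_filter.1 μ.2).2)
    let b : ∀ μ : F', OrthonormalBasis (Fin (m μ)) ℝ (Module.End.eigenspace (A : T →ₗ[ℝ] T) μ) :=
      fun μ => haveI := hfd μ; stdOrthonormalBasis ℝ _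
    have horth := hsymm.orthogonalFamily_eigenspaces.comp (γ := F') (f := Subtype.val)
      Subtype.val_injective
    have hon := horth.orthonormal_sigma_orthonormal (v_family := fun μ => b μ)
      (fun μ => (b μ).orthonormal)
    let ev : ((Σ μ : F', Fin (m μ)) → T) := fun a => (b a.1 a.2 : T)
    obtain ⟨n, ⟨en⟩⟩ := Finite.exists_equiv_fin (Σ μ : F', Fin (m μ))
    have h := hHS (Fin n) (fun i => ev (en.symm i)) (hon.comp _ en.symm.injective)
    rw [Equiv.sum_comp en.symm (fun a => ‖A (ev a)‖ ^ 2), Fintype.sum_sigma] at h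
    have hev : ∀ a, ‖A (ev a)‖ ^ 2 = (a.1 : ℝ) ^ 2 := by
      intro a
      have h1 : A (ev a) = (a.1 : ℝ) • ev a :=
        Module.End.mem_eigenspace_iff.1 (b a.1 a.2).2
      have h2 : ‖ev a‖ = 1 := hon.1 a
      rw [h1, norm_smul, h2, mul_one, Real.norm_eq_abs, sq_abs]
    simp only [hev, Finset.sum_const, Finset.card_univ, Fintype.card_fin, nsmul_eq_mul] at h
    rw [← Finset.sum_coe_sort F']
    exact h
  obtain ⟨lam, h1, h2, h3, h4⟩ := exists_antitone_seq_encard_fiber_eq m C hm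
  refine ⟨hsymm, hcomp, lam, lam, ⟨h1, h2, h3⟩, ⟨h1, h2, ?_⟩, h4, h4, by simp⟩
  intro μ hμ
  rw [h3 μ hμ]
  congr 1
  -- `S` exchanges the eigenspaces of `A` and of `-A`
  have hS' : ∀ x, A (S.symm x) = - S.symm (A x) := by
    intro x
    have := hS (S.symm x)
    rw [S.apply_symm_apply] at this
    rw [this]; simp
  refine LinearEquiv.finrank_eq (LinearEquiv.ofSubmodules S _ _ ?_)
  ext x
  simp only [Submodule.mem_map, Module.End.mem_eigenspace_iff]
  constructor
  · rintro ⟨y, hy, rfl⟩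
    have hy' : A y = μ • y := hy
    show (-A) (S y) = μ • S y
    rw [neg_apply, hS, hy', map_smul, neg_neg]
  · intro hx
    have hx' : -(A x) = μ • x := hx
    refine ⟨S.symm x, ?_, S.apply_symm_apply x⟩
    show A (S.symm x) = μ • S.symm x
    rw [hS', ← map_neg, hx', map_smul]

/-! ### Submanifolds with a framed normal bundle -/

/-- The inverse function theorem, with the smoothness and the derivative of the inverse. -/
theorem exists_contDiffAt_local_inverse {X Y : Type*} [NormedAddCommGroup X] [NormedSpace ℝ X]
    [CompleteSpace X] [NormedAddCommGroup Y] [NormedSpace ℝ Y] {f : X → Y} {a : X}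
    {f' : X ≃L[ℝ] Y} (hf : ContDiffAt ℝ ∞ f a) (hf' : HasFDerivAt f (f' : X →L[ℝ] Y) a) :
    ∃ g : Y → X, g (f a) = a ∧ ContDiffAt ℝ ∞ g (f a) ∧
      HasFDerivAt g (f'.symm : Y →L[ℝ] X) (f a) ∧ (∀ᶠ y in 𝓝 (f a), f (g y) = y) ∧
      (∀ᶠ x in 𝓝 a, g (f x) = x) := by
  have hs := hf.hasStrictFDerivAt' hf' (by simp)
  exact ⟨hf.localInverse hf' (by simp), hf.localInverse_apply_image hf' (by simp),
    hf.to_localInverse hf' (by simp), hs.to_localInverse.hasFDerivAt,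
    hs.eventually_right_inverse, hs.eventually_left_inverse⟩

section FramedSubmanifold

variable {V : Type*} [NormedAddCommGroup V] [InnerProductSpace ℝ V] [CompleteSpace V]
  {W : Type*} [NormedAddCommGroup W] [InnerProductSpace ℝ W] [CompleteSpace W]

variable (V W) in
/-- The passage to the adjoint, as a continuous real-linear map. -/
noncomputable def adjointL : (W →L[ℝ] V) →L[ℝ] (V →L[ℝ] W) where
  toFun A := ContinuousLinearMap.adjoint A
  map_add' A B := by simp
  map_smul' c A := by simp
  cont := ContinuousLinearMap.adjoint.continuous

theorem adjointL_inner_left (A : W →L[ℝ] V) (x : V) (ζ : W) :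
    inner ℝ (adjointL V W A x) ζ = inner ℝ x (A ζ) :=
  ContinuousLinearMap.adjoint_inner_left A ζ x

theorem adjointL_inner_right (A : W →L[ℝ] V) (x : V) (ζ : W) :
    inner ℝ ζ (adjointL V W A x) = inner ℝ (A ζ) x :=
  ContinuousLinearMap.adjoint_inner_right A ζ x

/-- `N` is a global smooth orthonormal framing of the normal spaces of `M`: `N p` is an isometric
embedding of the finite-dimensional space `W`, and near each of its points `M` is the zero set of a
`W`-valued submersion whose differentials have the kernels `(range (N q))ᗮ`, at all points `q`
of a neighbourhood and not only at those of `M`. -/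
structure IsFramedSubmanifold (N : V → W →L[ℝ] V) (M : Set V) : Prop where
  contDiff : ContDiff ℝ ∞ N
  inner_map : ∀ p ξ η, inner ℝ (N p ξ) (N p η) = inner ℝ ξ η
  exists_submersion : ∀ p ∈ M, ∃ (U : Set V) (F : V → W), IsOpen U ∧ p ∈ U ∧
    ContDiffOn ℝ ∞ F U ∧
    (∀ q ∈ U, ∃ S : W ≃L[ℝ] W, fderiv ℝ F q = (S : W →L[ℝ] W).comp (adjointL V W (N q))) ∧
    M ∩ U = {q ∈ U | F q = 0}

namespace IsFramedSubmanifold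

variable {N : V → W →L[ℝ] V} {M : Set V}

theorem adjointL_apply_self (h : IsFramedSubmanifold N M) (p : V) (ξ : W) :
    adjointL V W (N p) (N p ξ) = ξ := by
  refine ext_inner_right ℝ fun η => ?_
  rw [adjointL_inner_left, h.inner_map]

theorem hasFDerivAt (h : IsFramedSubmanifold N M) (p : V) : HasFDerivAt N (fderiv ℝ N p) p :=
  (h.contDiff.differentiable (by simp) p).hasFDerivAt

theorem isFiniteCodimSubmanifold [FiniteDimensional ℝ W] (h : IsFramedSubmanifold N M) :
    IsFiniteCodimSubmanifold M := by
  refine ⟨Module.finrank ℝ W, fun p hp => ?_⟩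
  obtain ⟨U, F, hU, hpU, hF, hF', hM⟩ := h.exists_submersion p hp
  let e : W ≃L[ℝ] EuclideanSpace ℝ (Fin (Module.finrank ℝ W)) :=
    (stdOrthonormalBasis ℝ W).repr.toContinuousLinearEquiv
  refine ⟨U, fun q => e (F q), hU, hpU, e.contDiff.comp_contDiffOn hF, ?_, ?_⟩
  · intro q hq
    obtain ⟨S, hS⟩ := hF' q hq
    have hd : DifferentiableAt ℝ F q :=
      (hF.contDiffAt (hU.mem_nhds hq)).differentiableAt (by simp)
    have : fderiv ℝ (fun q => e (F q)) q = (e : W →L[ℝ] _).comp (fderiv ℝ F q) :=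
      (e.hasFDerivAt.comp q hd.hasFDerivAt).fderiv
    rw [this, hS]
    intro y
    refine ⟨N q (S.symm (e.symm y)), ?_⟩
    simp [h.adjointL_apply_self]
  · rw [hM]; simp

/-- Every vector annihilated by the adjoint of the normal framing is the velocity of a curve
in `M`: the curve is the inverse image of a straight line under a local diffeomorphism that
straightens `M`. -/
theorem exists_curve (h : IsFramedSubmanifold N M) {p : V} (hp : p ∈ M) {v : V}
    (hv : adjointL V W (N p) v = 0) :
    ∃ γ : ℝ → V, ContDiffAt ℝ ∞ γ 0 ∧ γ 0 = p ∧ (∀ᶠ t in 𝓝 (0 : ℝ), γ t ∈ M) ∧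
      HasDerivAt γ v 0 := by
  obtain ⟨U, F, hU, hpU, hF, hF', hM⟩ := h.exists_submersion p hp
  obtain ⟨S, hS⟩ := hF' p hpU
  have hFp : F p = 0 := by
    have : p ∈ M ∩ U := ⟨hp, hpU⟩
    rw [hM] at this; exact this.2
  have hFc : ContDiffAt ℝ ∞ F p := hF.contDiffAt (hU.mem_nhds hpU)
  have hFd : HasFDerivAt F (fderiv ℝ F p) p := (hFc.differentiableAt (by simp)).hasFDerivAt
  set Na := adjointL V W (N p) with hNa
  have hNN : ∀ ξ, Na (N p ξ) = ξ := h.adjointL_apply_self p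
  let Ψ : V → V := fun q => (q - p) - N p (Na (q - p)) + N p (F q)
  let L : V →L[ℝ] V := ContinuousLinearMap.id ℝ V - (N p).comp Na +
    (N p).comp ((S : W →L[ℝ] W).comp Na)
  let L' : V →L[ℝ] V := ContinuousLinearMap.id ℝ V - (N p).comp Na +
    (N p).comp ((S.symm : W →L[ℝ] W).comp Na)
  let e : V ≃L[ℝ] V := ContinuousLinearEquiv.equivOfInverse L L'
    (fun x => by simp [L, L', hNN]) (fun x => by simp [L, L', hNN])
  have hid : HasFDerivAt (fun q : V => q - p) (ContinuousLinearMap.id ℝ V) p :=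
    (hasFDerivAt_id p).sub_const p
  have hΨ' : HasFDerivAt Ψ (e : V →L[ℝ] V) p := by
    have := (hid.sub ((N p).hasFDerivAt.comp p (Na.hasFDerivAt.comp p hid))).add
      ((N p).hasFDerivAt.comp p hFd)
    rw [hS] at this
    exact this
  have hΨ : ContDiffAt ℝ ∞ Ψ p := by
    have h1 : ContDiffAt ℝ ∞ (fun q : V => q - p) p := contDiffAt_id.sub contDiffAt_const
    exact (h1.sub ((N p).contDiff.contDiffAt.comp p (Na.contDiff.contDiffAt.comp p h1))).add
      ((N p).contDiff.contDiffAt.comp p hFc)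
  have hΨp : Ψ p = 0 := by simp [Ψ, hFp]
  obtain ⟨g, hg1, hg2, hg3, hg4, -⟩ := exists_contDiffAt_local_inverse hΨ hΨ'
  rw [hΨp] at hg1 hg2 hg3 hg4
  have hline : HasDerivAt (fun s : ℝ => s • v) v 0 := by
    simpa using (hasDerivAt_id (0 : ℝ)).smul_const v
  have hlinec : Continuous fun s : ℝ => s • v := by fun_prop
  have hl0 : Tendsto (fun s : ℝ => s • v) (𝓝 0) (𝓝 0) := by
    simpa using hlinec.tendsto 0
  refine ⟨fun s => g (s • v), ?_, ?_, ?_, ?_⟩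
  · refine ContDiffAt.comp (0 : ℝ) (g := g) (by simpa using hg2) ?_
    exact contDiffAt_id.smul contDiffAt_const
  · simp [hg1]
  · have h1 : ∀ᶠ s : ℝ in 𝓝 0, g (s • v) ∈ U := by
      have : ContinuousAt g 0 := hg2.continuousAt
      have h2 : Tendsto (fun s : ℝ => g (s • v)) (𝓝 0) (𝓝 p) := by
        have := this.tendsto.comp hl0
        rwa [hg1] at this
      exact h2.eventually (hU.mem_nhds hpU)
    filter_upwards [h1, hl0.eventually hg4] with s hs1 hs2
    have h3 := congrArg Na hs2
    simp only [Ψ, map_add, map_sub, hNN, sub_self, zero_add, map_smul, hv, smul_zero] at h3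
    have : g (s • v) ∈ M ∩ U := by rw [hM]; exact ⟨hs1, h3⟩
    exact this.1
  · have h1 : HasFDerivAt g (e.symm : V →L[ℝ] V) ((0 : ℝ) • v) := by simpa using hg3
    have h2 := h1.comp_hasDerivAt (0 : ℝ) hline
    have h3 : e.symm v = v := by
      rw [ContinuousLinearEquiv.symm_apply_eq]
      show v = L v
      simp [L, hv]
    have h4 : (e.symm : V →L[ℝ] V) v = v := h3
    rw [h4] at h2
    exact h2

/-- Velocities of curves in `M` are annihilated by the adjoint of the normal framing. -/
theorem adjointL_apply_eq_zero_of_curve (h : IsFramedSubmanifold N M) {p : V} (hp : p ∈ M) {v : V}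
    {γ : ℝ → V} (hγ0 : γ 0 = p) (hγM : ∀ᶠ t in 𝓝 (0 : ℝ), γ t ∈ M) (hγ : HasDerivAt γ v 0) :
    adjointL V W (N p) v = 0 := by
  obtain ⟨U, F, hU, hpU, hF, hF', hM⟩ := h.exists_submersion p hp
  obtain ⟨S, hS⟩ := hF' p hpU
  have hFc : ContDiffAt ℝ ∞ F p := hF.contDiffAt (hU.mem_nhds hpU)
  have hFd : HasFDerivAt F (fderiv ℝ F p) (γ 0) := by
    rw [hγ0]; exact (hFc.differentiableAt (by simp)).hasFDerivAt
  have h1 := hFd.comp_hasDerivAt (0 : ℝ) hγ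
  have h2 : ∀ᶠ t in 𝓝 (0 : ℝ), γ t ∈ U :=
    hγ.continuousAt.tendsto.eventually (by rw [hγ0]; exact hU.mem_nhds hpU)
  have h3 : (F ∘ γ) =ᶠ[𝓝 0] fun _ => 0 := by
    filter_upwards [hγM, h2] with t ht1 ht2
    have : γ t ∈ M ∩ U := ⟨ht1, ht2⟩
    rw [hM] at this
    exact this.2
  have h4 := (h1.congr_of_eventuallyEq h3.symm).unique (hasDerivAt_const (0 : ℝ) (0 : W))
  rw [hS] at h4
  simpa using h4

theorem mem_curveTangentSpace_iff (h : IsFramedSubmanifold N M) {p : V} (hp : p ∈ M) (v : V) :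
    v ∈ curveTangentSpace M p ↔ adjointL V W (N p) v = 0 := by
  constructor
  · intro hv
    have : curveTangentSpace M p ≤ LinearMap.ker (adjointL V W (N p) : V →ₗ[ℝ] W) := by
      refine Submodule.span_le.2 ?_
      rintro w ⟨γ, -, h2, h3, h4⟩
      exact h.adjointL_apply_eq_zero_of_curve hp h2 h3 h4
    exact this hv
  · intro hv
    exact Submodule.subset_span (h.exists_curve hp hv)

theorem mem_normalSpaceAt_iff (h : IsFramedSubmanifold N M) {p : V} (hp : p ∈ M) (ξ : V) :
    ξ ∈ normalSpaceAt M p ↔ N p (adjointL V W (N p) ξ) = ξ := by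
  rw [normalSpaceAt, Submodule.mem_orthogonal]
  constructor
  · intro hξ
    set w := ξ - N p (adjointL V W (N p) ξ) with hw
    have hwT : adjointL V W (N p) w = 0 := by
      rw [hw, map_sub, h.adjointL_apply_self, sub_self]
    have h1 := hξ w ((h.mem_curveTangentSpace_iff hp w).2 hwT)
    have h2 : inner ℝ w w = 0 := by
      conv_lhs => rw [hw, inner_sub_right, ← hw]
      rw [h1, ← adjointL_inner_left, hwT, inner_zero_left, sub_zero]
    rw [inner_self_eq_zero] at h2
    rw [hw, sub_eq_zero] at h2
    exact h2.symm
  · intro hξ u hu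
    rw [h.mem_curveTangentSpace_iff hp] at hu
    rw [← hξ, ← adjointL_inner_left, hu, inner_zero_left]

theorem apply_mem_normalSpaceAt (h : IsFramedSubmanifold N M) {p : V} (hp : p ∈ M) (ζ : W) :
    N p ζ ∈ normalSpaceAt M p := by
  rw [h.mem_normalSpaceAt_iff hp, h.adjointL_apply_self]

/-- The tangent space of the normal bundle at `(p, ξ)`, with `ξ = N p ζ`: it consists of the pairs
`(X, D_X (N ζ) + N p η)` with `X` tangent to `M`. -/
theorem mem_curveTangentSpace_normalBundleSet_iff (h : IsFramedSubmanifold N M) {x : V × V}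
    (hx : x ∈ normalBundleSet M) (v : V × V) :
    v ∈ curveTangentSpace (normalBundleSet M) x ↔
      adjointL V W (N x.1) v.1 = 0 ∧
      ∃ η : W, v.2 = fderiv ℝ N x.1 v.1 (adjointL V W (N x.1) x.2) + N x.1 η := by
  obtain ⟨p, ξ⟩ := x
  obtain ⟨hp, hξ⟩ : p ∈ M ∧ ξ ∈ normalSpaceAt M p := hx
  set ζ := adjointL V W (N p) ξ with hζ
  have hNζ : N p ζ = ξ := (h.mem_normalSpaceAt_iff hp ξ).1 hξ
  simp only
  constructor
  · intro hv
    let T' : Submodule ℝ (V × V) :=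
      { carrier := {v | adjointL V W (N p) v.1 = 0 ∧ ∃ η : W, v.2 = fderiv ℝ N p v.1 ζ + N p η}
        add_mem' := by
          rintro a b ⟨ha, η, hη⟩ ⟨hb, θ, hθ⟩
          refine ⟨by simp [ha, hb], η + θ, ?_⟩
          simp only [Prod.snd_add, Prod.fst_add, map_add, add_apply, hη, hθ]
          abel
        zero_mem' := ⟨by simp, 0, by simp⟩
        smul_mem' := by
          rintro c a ⟨ha, η, hη⟩
          refine ⟨by simp [ha], c • η, ?_⟩
          simp [hη] }
    have : curveTangentSpace (normalBundleSet M) (p, ξ) ≤ T' := by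
      refine Submodule.span_le.2 ?_
      rintro w ⟨c, -, hc0, hcM, hc'⟩
      have hq : HasDerivAt (fun t => (c t).1) w.1 0 := hc'.fst
      have hr : HasDerivAt (fun t => (c t).2) w.2 0 := hc'.snd
      have hq0 : (c 0).1 = p := by rw [hc0]
      have hr0 : (c 0).2 = ξ := by rw [hc0]
      refine ⟨h.adjointL_apply_eq_zero_of_curve hp hq0 (hcM.mono fun t ht => ht.1) hq, ?_⟩
      have hN : HasDerivAt (fun t => N (c t).1) (fderiv ℝ N p w.1) 0 := by
        have h1 : HasFDerivAt N (fderiv ℝ N p) (c 0).1 := by rw [hq0]; exact h.hasFDerivAt p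
        exact h1.comp_hasDerivAt (0 : ℝ) hq
      have hNa : HasDerivAt (fun t => adjointL V W (N (c t).1))
          (adjointL V W (fderiv ℝ N p w.1)) 0 :=
        ((adjointL V W).hasFDerivAt (x := N (c 0).1)).comp_hasDerivAt (0 : ℝ) hN
      have hζt := hNa.clm_apply hr
      have hcomb := hN.clm_apply hζt
      have heq : (fun t => (c t).2) =ᶠ[𝓝 0]
          fun t => N (c t).1 (adjointL V W (N (c t).1) (c t).2) := by
        filter_upwards [hcM] with t ht
        exact ((h.mem_normalSpaceAt_iff ht.1 _).1 ht.2).symm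
      have := hr.unique (hcomb.congr_of_eventuallyEq heq)
      rw [hq0, hr0] at this
      exact ⟨_, this⟩
    exact this hv
  · rintro ⟨hv1, η, hη⟩
    obtain ⟨γ, hγ1, hγ2, hγ3, hγ4⟩ := h.exists_curve hp hv1
    have hγ1' : ContDiffAt ℝ ∞ (fun t => N (γ t)) 0 :=
      h.contDiff.contDiffAt.comp (0 : ℝ) hγ1
    refine Submodule.subset_span ⟨fun t => (γ t, N (γ t) (ζ + t • η)), ?_, ?_, ?_, ?_⟩
    · refine hγ1.prodMk (hγ1'.clm_apply ?_)
      exact contDiffAt_const.add (contDiffAt_id.smul contDiffAt_const)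
    · simp [hγ2, hNζ]
    · filter_upwards [hγ3] with t ht
      exact ⟨ht, h.apply_mem_normalSpaceAt ht _⟩
    · have hN : HasDerivAt (fun t => N (γ t)) (fderiv ℝ N p v.1) 0 := by
        have h1 : HasFDerivAt N (fderiv ℝ N p) (γ 0) := by rw [hγ2]; exact h.hasFDerivAt p
        exact h1.comp_hasDerivAt (0 : ℝ) hγ4
      have hl : HasDerivAt (fun t : ℝ => ζ + t • η) η 0 := by
        simpa using ((hasDerivAt_id (0 : ℝ)).smul_const η).const_add ζ
      have := hγ4.prodMk (hN.clm_apply hl)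
      simp only [zero_smul, add_zero, hγ2] at this
      rw [← hη] at this
      exact this

end IsFramedSubmanifold

end FramedSubmanifold

/-! ### The normal exponential map and the shape operators -/

section FramedSubmanifold

variable {V : Type*} [NormedAddCommGroup V] [InnerProductSpace ℝ V] [CompleteSpace V]
  {W : Type*} [NormedAddCommGroup W] [InnerProductSpace ℝ W] [CompleteSpace W]

/-- The Fredholm alternative: an injective operator `1 + K` with compact `K` has a bounded inverse. -/
theorem exists_inverse_one_add_of_isCompactOperator {X : Type*} [NormedAddCommGroup X]
    [NormedSpace ℝ X] [CompleteSpace X] (K : X →L[ℝ] X) (hK : IsCompactOperator K)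
    (hinj : ∀ x, x + K x = 0 → x = 0) :
    ∃ R : X →L[ℝ] X, (∀ x, R (x + K x) = x) ∧ ∀ x, R x + K (R x) = x := by
  rcases hK.hasEigenvalue_or_mem_resolventSet (μ := (-1 : ℝ)) (by norm_num) with h | h
  · exfalso
    obtain ⟨x, hx⟩ := h.exists_hasEigenvector
    refine hx.2 (hinj x ?_)
    have : K x = (-1 : ℝ) • x := Module.End.mem_eigenspace_iff.1 hx.1
    rw [this]; simp
  · rw [spectrum.mem_resolventSet_iff] at h
    obtain ⟨e, he⟩ := h
    have he' : ∀ x, (e : X →L[ℝ] X) x = -(x + K x) := by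
      intro x
      rw [he]
      simp [Algebra.algebraMap_eq_smul_one, sub_eq_add_neg]
      abel
    refine ⟨-(↑e⁻¹ : X →L[ℝ] X), fun x => ?_, fun x => ?_⟩
    · have : (↑e⁻¹ : X →L[ℝ] X) ((e : X →L[ℝ] X) x) = x := by
        have := congrArg (fun A : X →L[ℝ] X => A x) e.inv_mul
        exact this
      rw [he'] at this
      simpa using this
    · have : (e : X →L[ℝ] X) ((↑e⁻¹ : X →L[ℝ] X) x) = x := by
        have := congrArg (fun A : X →L[ℝ] X => A x) e.mul_inv
        exact this
      rw [he'] at this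
      simpa [neg_add, add_comm] using this

open scoped LinearMap.FiniteRangeSetoid in
/-- Linear maps that agree on the kernel of a map to a finite-dimensional space differ by a map of
finite rank. -/
theorem equiv_of_eqOn_ker {X Y Z : Type*} [AddCommGroup X] [Module ℝ X] [AddCommGroup Y]
    [Module ℝ Y] [AddCommGroup Z] [Module ℝ Z] [FiniteDimensional ℝ Z] {u v : X →ₗ[ℝ] Y}
    (f : X →ₗ[ℝ] Z) (huv : ∀ x, f x = 0 → u x = v x) : u ≈ v := by
  refine LinearMap.FiniteRangeSetoid.equiv_of_eqOn_coFG (A := LinearMap.ker f) ?_ huv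
  rw [LinearMap.ker_coFG_iff_hasFiniteRange]
  exact IsNoetherian.noetherian _

namespace IsFramedSubmanifold

variable {N : V → W →L[ℝ] V} {M : Set V}

/-- The tangent space of the normal bundle is parametrized by `X`, up to finitely many dimensions, and
the differential of the normal exponential map is `X ↦ X + DN(p)X ζ` up to finite rank. Hence it is
Fredholm once `1 + K` is invertible for the compact operator `K = DN(p)(·)ζ`. -/
theorem isFredholm [FiniteDimensional ℝ W] (h : IsFramedSubmanifold N M) {x : V × V}
    (hx : x ∈ normalBundleSet M)
    (hK : ∀ ζ : W, IsCompactOperator ((fderiv ℝ N x.1).flip ζ))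
    (hinj : ∀ ζ : W, ∀ y, y + (fderiv ℝ N x.1).flip ζ y = 0 → y = 0) :
    ((ContinuousLinearMap.fst ℝ V V + ContinuousLinearMap.snd ℝ V V).comp
      (curveTangentSpace (normalBundleSet M) x).subtypeL).IsFredholm := by
  set p := x.1 with hp
  set ζ := adjointL V W (N p) x.2 with hζ
  set K := (fderiv ℝ N p).flip ζ with hKdef
  set Na := adjointL V W (N p) with hNa
  have hNN : ∀ ξ, Na (N p ξ) = ξ := h.adjointL_apply_self p
  obtain ⟨R, hR1, hR2⟩ := exists_inverse_one_add_of_isCompactOperator K (hK ζ) (hinj ζ)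
  have hT : ∀ v : V × V, v ∈ curveTangentSpace (normalBundleSet M) x ↔
      Na v.1 = 0 ∧ ∃ η : W, v.2 = K v.1 + N p η :=
    fun v => h.mem_curveTangentSpace_normalBundleSet_iff hx v
  let Q : V →L[ℝ] V := ContinuousLinearMap.id ℝ V - (N p).comp Na
  have hQ : ∀ w, Q w = w - N p (Na w) := fun w => rfl
  have hNQ : ∀ w, Na (Q w) = 0 := fun w => by rw [hQ, map_sub, hNN, sub_self]
  -- the parametrization of the tangent space of the normal bundle by `V`
  let c : V →L[ℝ] V × V := Q.prod (K.comp Q + (N p).comp Na)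
  let v : V →L[ℝ] curveTangentSpace (normalBundleSet M) x :=
    (c.comp R).codRestrict _ (fun w => (hT _).2 ⟨hNQ _, Na (R w), rfl⟩)
  have hv : ∀ w, (v w : V × V) = (Q (R w), K (Q (R w)) + N p (Na (R w))) := fun w => rfl
  have huv : ∀ t : curveTangentSpace (normalBundleSet M) x,
      ((ContinuousLinearMap.fst ℝ V V + ContinuousLinearMap.snd ℝ V V).comp
      (curveTangentSpace (normalBundleSet M) x).subtypeL) t = (t : V × V).1 + (t : V × V).2 :=
    fun t => rfl
  refine ContinuousLinearMap.IsFredholm.of_isQuasiInverse (v := v) ⟨?_, ?_⟩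
  · -- `v ∘ u` is the identity on the vectors with vanishing vertical normal component
    refine equiv_of_eqOn_ker (Z := W)
      ((Na.comp (ContinuousLinearMap.snd ℝ V V - K.comp (ContinuousLinearMap.fst ℝ V V))).comp
        (curveTangentSpace (normalBundleSet M) x).subtypeL : _ →ₗ[ℝ] W) ?_
    intro t ht
    obtain ⟨h1, η, hη⟩ := (hT t).1 t.2
    have h2 : Na ((t : V × V).2 - K (t : V × V).1) = 0 := ht
    rw [hη, add_sub_cancel_left, hNN] at h2
    rw [h2, map_zero, add_zero] at hη
    apply Subtype.ext
    show (v _ : V × V) = t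
    rw [hv]
    have h3 : ((ContinuousLinearMap.fst ℝ V V + ContinuousLinearMap.snd ℝ V V).comp
      (curveTangentSpace (normalBundleSet M) x).subtypeL) t =
        (t : V × V).1 + K (t : V × V).1 := by rw [huv, hη]
    have h3' : R ((((ContinuousLinearMap.fst ℝ V V + ContinuousLinearMap.snd ℝ V V).comp
      (curveTangentSpace (normalBundleSet M) x).subtypeL : _ →L[ℝ] V) : _ →ₗ[ℝ] V) t) =
        (t : V × V).1 := by
      rw [ContinuousLinearMap.coe_coe, h3, hR1]
    rw [h3', hQ, h1, map_zero, sub_zero, add_zero, ← hη]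
  · refine equiv_of_eqOn_ker (Z := W) (Na.comp R : V →ₗ[ℝ] W) ?_
    intro w hw
    have hw' : Na (R w) = 0 := hw
    show (v w : V × V).1 + (v w : V × V).2 = w
    rw [hv]
    simp only [hQ, hw', map_zero, sub_zero, add_zero, hR2]

/-- The normal bundle is proper over closed balls as soon as the normal frames over bounded sets
lie in compact sets. -/
theorem isProperMap (h : IsFramedSubmanifold N M) (hM : IsClosed M)
    (hcpt : ∀ R r : ℝ, ∃ 𝒦 : Set V, IsCompact 𝒦 ∧ ∀ p, ‖p‖ ≤ R → ∀ ζ : W, ‖ζ‖ ≤ r → N p ζ ∈ 𝒦)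
    (r : ℝ) :
    IsProperMap (fun x : {x : V × V // x ∈ normalBundleSet M ∧ ‖x.2‖ ≤ r} => x.1.1 + x.1.2) := by
  have hnorm : ∀ p ζ, ‖N p ζ‖ = ‖ζ‖ := by
    intro p ζ
    rw [norm_eq_sqrt_real_inner, h.inner_map, ← norm_eq_sqrt_real_inner]
  refine isProperMap_iff_ultrafilter.2 ⟨by fun_prop, ?_⟩
  intro 𝒰 y hy
  obtain ⟨𝒦, h𝒦, h𝒦'⟩ := hcpt (‖y‖ + 1 + r) r
  have hev : ∀ᶠ x in (𝒰 : Filter {x : V × V // x ∈ normalBundleSet M ∧ ‖x.2‖ ≤ r}), x.1.2 ∈ 𝒦 := by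
    have h1 : ∀ᶠ x in (𝒰 : Filter {x : V × V // x ∈ normalBundleSet M ∧ ‖x.2‖ ≤ r}),
        ‖x.1.1 + x.1.2‖ < ‖y‖ + 1 :=
      hy.norm.eventually (gt_mem_nhds (by linarith))
    filter_upwards [h1] with x hx
    have h2 := (h.mem_normalSpaceAt_iff x.2.1.1 _).1 x.2.1.2
    rw [← h2]
    refine h𝒦' _ ?_ _ ?_
    · have h3 : ‖x.1.1‖ ≤ ‖x.1.1 + x.1.2‖ + ‖x.1.2‖ := by
        simpa using norm_sub_le (x.1.1 + x.1.2) x.1.2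
      linarith [x.2.2]
    · rw [← hnorm x.1.1, h2]; exact x.2.2
  obtain ⟨k, -, hk⟩ := h𝒦.ultrafilter_le_nhds (𝒰.map fun x => x.1.2)
    (by rw [Ultrafilter.coe_map]; exact tendsto_principal.2 hev)
  have hk' : Tendsto (fun x : {x : V × V // x ∈ normalBundleSet M ∧ ‖x.2‖ ≤ r} => x.1.2) 𝒰 (𝓝 k) :=
    hk
  have hq : Tendsto (fun x : {x : V × V // x ∈ normalBundleSet M ∧ ‖x.2‖ ≤ r} => x.1.1) 𝒰
      (𝓝 (y - k)) := by
    simpa using hy.sub hk'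
  have hqM : y - k ∈ M := hM.mem_of_tendsto hq (Eventually.of_forall fun x => x.2.1.1)
  have hkr : ‖k‖ ≤ r := le_of_tendsto hk'.norm (Eventually.of_forall fun x => x.2.2)
  have hcont : Continuous fun z : V × V => N z.1 (adjointL V W (N z.1) z.2) := by
    have h1 : Continuous fun z : V × V => N z.1 := h.contDiff.continuous.comp continuous_fst
    exact h1.clm_apply (((adjointL V W).continuous.comp h1).clm_apply continuous_snd)
  have h1 := (hcont.tendsto (y - k, k)).comp (hq.prodMk_nhds hk')
  have hkn : N (y - k) (adjointL V W (N (y - k)) k) = k := by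
    refine tendsto_nhds_unique h1 (hk'.congr fun x => ?_)
    exact ((h.mem_normalSpaceAt_iff x.2.1.1 _).1 x.2.1.2).symm
  refine ⟨⟨(y - k, k), ⟨hqM, (h.mem_normalSpaceAt_iff hqM _).2 hkn⟩, hkr⟩, by simp, ?_⟩
  rw [nhds_subtype_eq_comap]
  refine tendsto_iff_comap.1 ?_
  exact hq.prodMk_nhds hk'

/-- Symmetry of the second fundamental form: it comes from the symmetry of the second derivative of
a local defining submersion `F`, by differentiation of the identity `F' q = F' q ∘ N q ∘ (N q)†`. -/
theorem inner_fderiv_apply_comm (h : IsFramedSubmanifold N M) {p : V} (hp : p ∈ M) (ζ : W)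
    {X Y : V} (hX : adjointL V W (N p) X = 0) (hY : adjointL V W (N p) Y = 0) :
    inner ℝ (fderiv ℝ N p X ζ) Y = inner ℝ X (fderiv ℝ N p Y ζ) := by
  obtain ⟨U, F, hU, hpU, hF, hF', hM⟩ := h.exists_submersion p hp
  obtain ⟨S, hS⟩ := hF' p hpU
  have hFc : ContDiffAt ℝ ∞ F p := hF.contDiffAt (hU.mem_nhds hpU)
  have hF2 : HasFDerivAt (fderiv ℝ F) (fderiv ℝ (fderiv ℝ F) p) p :=
    ((hFc.fderiv_right (m := 1) (by norm_cast)).differentiableAt (by simp)).hasFDerivAt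
  have hsymm := second_derivative_symmetric_of_eventually (𝕜 := ℝ) (f := F) (x := p)
    (f' := fderiv ℝ F) (f'' := fderiv ℝ (fderiv ℝ F) p) (by
      filter_upwards [hU.mem_nhds hpU] with q hq
      exact ((hF.contDiffAt (hU.mem_nhds hq)).differentiableAt (by simp)).hasFDerivAt) hF2
  have key : ∀ X Y : V, adjointL V W (N p) Y = 0 →
      fderiv ℝ (fderiv ℝ F) p X Y = S (adjointL V W (fderiv ℝ N p X) Y) := by
    intro X Y hY
    have hN := h.hasFDerivAt p
    have hNa := (adjointL V W).hasFDerivAt.comp p hN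
    have h1 := hF2.clm_apply (hN.clm_apply (hNa.clm_apply (hasFDerivAt_const Y p)))
    have h2 := hF2.clm_apply (hasFDerivAt_const Y p)
    have heq : (fun q => fderiv ℝ F q Y) =ᶠ[𝓝 p]
        fun q => fderiv ℝ F q (N q ((adjointL V W ∘ N) q Y)) := by
      filter_upwards [hU.mem_nhds hpU] with q hq
      obtain ⟨S', hS'⟩ := hF' q hq
      rw [hS']
      simp [h.adjointL_apply_self]
    have h3 := congrArg (fun A => A X) (h2.unique (h1.congr_of_eventuallyEq heq))
    simp [hS, hY, h.adjointL_apply_self] at h3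
    exact h3
  have h1 : adjointL V W (fderiv ℝ N p X) Y = adjointL V W (fderiv ℝ N p Y) X := by
    apply S.injective
    rw [← key X Y hY, ← key Y X hX]
    exact hsymm X Y
  rw [← adjointL_inner_right, h1, adjointL_inner_right, real_inner_comm]

/-- A framed submanifold is minimal regularizable if the frames over bounded sets stay in compact sets
and the derivatives `K = DN(p)(·)ζ` of the framing are compact and Hilbert–Schmidt without eigenvalue
`-1`, and if an isometry `S` that fixes the normal vectors anticommutes with each `K`, on the tangent
space and up to normal vectors. The shape operators, which are the tangential parts of `-K`, then
anticommute with `S` on the tangent space. -/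
theorem isMinimalRegularizableSubmanifold [FiniteDimensional ℝ W] (h : IsFramedSubmanifold N M)
    (hM : IsClosed M)
    (hcpt : ∀ R r : ℝ, ∃ 𝒦 : Set V, IsCompact 𝒦 ∧ ∀ p, ‖p‖ ≤ R → ∀ ζ : W, ‖ζ‖ ≤ r → N p ζ ∈ 𝒦)
    (hK : ∀ p ∈ M, ∀ ζ : W, IsCompactOperator ((fderiv ℝ N p).flip ζ))
    (hinj : ∀ p ∈ M, ∀ ζ : W, ∀ y, y + (fderiv ℝ N p).flip ζ y = 0 → y = 0)
    (hHS : ∀ p ∈ M, ∀ ζ : W, ∃ C : ℝ, ∀ (ι : Type) [Fintype ι] (e : ι → V), Orthonormal ℝ e →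
      ∑ i, ‖fderiv ℝ N p (e i) ζ‖ ^ 2 ≤ C)
    (hrev : ∀ p ∈ M, ∃ S : V ≃ₗᵢ[ℝ] V, (∀ ζ, S (N p ζ) = N p ζ) ∧
      ∀ ζ X, adjointL V W (N p) X = 0 →
        ∃ η, fderiv ℝ N p (S X) ζ + S (fderiv ℝ N p X ζ) = N p η) :
    IsMinimalRegularizableSubmanifold M := by
  refine ⟨⟨h.isFiniteCodimSubmanifold, fun x hx => h.isFredholm hx (hK _ hx.1) (hinj _ hx.1),
    h.isProperMap hM hcpt⟩, ?_⟩
  intro p hp ξ hξ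
  set Na := adjointL V W (N p) with hNa
  have hNN : ∀ ξ, Na (N p ξ) = ξ := h.adjointL_apply_self p
  set ζ := Na ξ with hζ
  have hNζ : N p ζ = ξ := (h.mem_normalSpaceAt_iff hp ξ).1 hξ
  have hT : ∀ v, v ∈ curveTangentSpace M p ↔ Na v = 0 := h.mem_curveTangentSpace_iff hp
  let K : V →L[ℝ] V := (fderiv ℝ N p).flip ζ
  have hKdef : ∀ x, K x = fderiv ℝ N p x ζ := fun x => rfl
  let Q : V →L[ℝ] V := ContinuousLinearMap.id ℝ V - (N p).comp Na
  have hQ : ∀ w, Q w = w - N p (Na w) := fun w => rfl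
  have hNQ : ∀ w, Na (Q w) = 0 := fun w => by rw [hQ, map_sub, hNN, sub_self]
  have hQinner : ∀ w Y, Na Y = 0 → inner ℝ (Q w) Y = inner ℝ w Y := by
    intro w Y hY
    rw [hQ, inner_sub_left, ← adjointL_inner_right, ← hNa, hY, inner_zero_right, sub_zero]
  have hQnorm : ∀ w, ‖Q w‖ ≤ ‖w‖ := by
    intro w
    have h1 : ‖Q w‖ ^ 2 = inner ℝ w (Q w) := by
      rw [← hQinner w (Q w) (hNQ w), real_inner_self_eq_norm_sq]
    have h2 := real_inner_le_norm w (Q w)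
    rcases (norm_nonneg (Q w)).eq_or_lt with h3 | h3
    · rw [← h3]; exact norm_nonneg w
    · nlinarith
  let T := curveTangentSpace M p
  let A : T →L[ℝ] T := (-(Q.comp (K.comp T.subtypeL))).codRestrict T
    (fun x => (hT _).2 (by simp [hNQ]))
  have hA : ∀ x : T, (A x : V) = -Q (K x) := fun x => rfl
  have hTc : IsClosed (T : Set V) := by
    have : (T : Set V) = Na ⁻¹' {0} := by ext v; exact hT v
    rw [this]
    exact isClosed_singleton.preimage Na.continuous
  refine ⟨A, ⟨fun q => N q ζ, ?_, hNζ, ?_, ?_⟩, ?_⟩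
  · exact h.contDiff.contDiffAt.clm_apply contDiffAt_const
  · filter_upwards [self_mem_nhdsWithin] with q hq
    exact h.apply_mem_normalSpaceAt hq ζ
  · intro X Y
    have h1 : fderiv ℝ (fun q => N q ζ) p (X : V) = K X := by
      have := (h.hasFDerivAt p).clm_apply (hasFDerivAt_const ζ p)
      rw [this.fderiv]
      simp [hKdef]
    rw [hA, inner_neg_left, hQinner _ _ ((hT _).1 Y.2), h1]
  · obtain ⟨C, hC⟩ := hHS p hp ζ
    obtain ⟨S, hSN, hSK⟩ := hrev p hp
    have hNaS : ∀ x, Na (S x) = Na x := by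
      intro x
      refine ext_inner_right ℝ fun η => ?_
      rw [adjointL_inner_left, adjointL_inner_left, ← hSN η, S.inner_map_map, hSN]
    have hNaS' : ∀ x, Na (S.symm x) = Na x := by
      intro x
      rw [← hNaS, S.apply_symm_apply]
    have hQS : ∀ x, Q (S x) = S (Q x) := by
      intro x
      rw [hQ, hQ, hNaS, map_sub, hSN]
    have hQN : ∀ η, Q (N p η) = 0 := fun η => by rw [hQ, hNN, sub_self]
    refine hasRegularizedTrace_zero_of_anticommute A ?_ ?_ C ?_ ?_ ?_
    · intro X Y
      show inner ℝ (A X : V) (Y : V) = inner ℝ (X : V) (A Y : V)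
      rw [hA, hA, inner_neg_left, inner_neg_right, hQinner _ _ ((hT _).1 Y.2),
        real_inner_comm, real_inner_comm (Q (K Y)), hQinner _ _ ((hT _).1 X.2), hKdef, hKdef,
        real_inner_comm, h.inner_fderiv_apply_comm hp ζ ((hT _).1 X.2) ((hT _).1 Y.2),
        real_inner_comm]
    · have h1 : IsCompactOperator (Q ∘ (K ∘ T.subtypeL)) :=
        ((hK p hp ζ).comp_clm T.subtypeL).clm_comp Q
      exact IsCompactOperator.codRestrict h1.neg _ hTc
    · intro ι _ e he
      refine (Finset.sum_le_sum fun i _ => ?_).trans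
        (hC ι (fun i => (e i : V)) (he.comp_linearIsometry T.subtypeₗᵢ))
      have : ‖A (e i)‖ ≤ ‖fderiv ℝ N p (e i : V) ζ‖ := by
        show ‖(A (e i) : V)‖ ≤ _
        rw [hA, norm_neg]
        exact hQnorm _
      gcongr
    · exact
        LinearEquiv.ofSubmodules S.toLinearEquiv T T (by
          ext x
          simp only [Submodule.mem_map]
          constructor
          · rintro ⟨y, hy, rfl⟩
            exact (hT _).2 ((hNaS y).trans ((hT _).1 hy))
          · intro hx
            exact ⟨S.symm x, (hT _).2 ((hNaS' x).trans ((hT _).1 hx)), S.apply_symm_apply x⟩)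
    · intro X
      apply Subtype.ext
      show -Q (K (S X)) = -(S (-Q (K X)))
      obtain ⟨η, hη⟩ := hSK ζ X ((hT _).1 X.2)
      have h1 : K (S X) = N p η - S (K X) := by
        rw [← hη]; simp [hKdef]
      rw [h1, map_sub, hQN, hQS]
      simp

end IsFramedSubmanifold

end FramedSubmanifold

/-! ### Square-integrable functions on the unit interval -/

section UnitIntervalL2

-- These instances for the fibres of Riemannian bundles are tried on every type and slow down the search
-- for the norm and the inner product of a plain vector space.
attribute [-instance] Bundle.instNormedAddCommGroupOfRiemannianBundleOfIsTopologicalAddGroupOfContinuousConstSMulReal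
  Bundle.instInnerProductSpaceReal

/-- The Hilbert space of square-integrable functions on `[0,1]` with values in `W`. -/
abbrev L2I (W : Type*) [NormedAddCommGroup W] : Type _ :=
  Lp W 2 (volume.restrict (Icc (0 : ℝ) 1))

variable {W : Type*} [NormedAddCommGroup W] [InnerProductSpace ℝ W]

/-- The projection of the real line to the unit interval. -/
noncomputable abbrev projI : ℝ → unitInterval := projIcc 0 1 zero_le_one

theorem continuous_projI : Continuous projI := continuous_projIcc

theorem projI_of_mem {t : ℝ} (ht : t ∈ Icc (0 : ℝ) 1) : projI t = ⟨t, ht⟩ := projIcc_of_mem _ ht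

theorem projI_val (t : unitInterval) : projI t = t := projIcc_val _ t

theorem ae_restrict_Icc {P : ℝ → Prop} (h : ∀ᵐ t ∂(volume.restrict (Icc (0 : ℝ) 1)), P t) :
    ∀ᵐ t ∂(volume.restrict (Icc (0 : ℝ) 1)), t ∈ Ioo (0 : ℝ) 1 ∧ P t := by
  have h1 : ∀ᵐ t ∂(volume.restrict (Icc (0 : ℝ) 1)), t ∈ Ioo (0 : ℝ) 1 := by
    rw [← restrict_Ioo_eq_restrict_Icc]
    exact ae_restrict_mem measurableSet_Ioo
  filter_upwards [h, h1] with t h2 h3 using ⟨h3, h2⟩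

/-! #### Pointwise multiplication -/

theorem memLp_bilinI {X : Type*} [NormedAddCommGroup X] [NormedSpace ℝ X]
    (B : X →L[ℝ] W →L[ℝ] W) (a : C(unitInterval, X)) (f : L2I W) :
    MemLp (fun t => B (a (projI t)) (f t)) 2 (volume.restrict (Icc (0 : ℝ) 1)) := by
  refine MemLp.of_le_mul (c := ‖B‖ * ‖a‖) (Lp.memLp f) ?_ (Eventually.of_forall fun t => ?_)
  · exact B.aestronglyMeasurable_comp₂
      (a.continuous.comp continuous_projI).aestronglyMeasurable (Lp.aestronglyMeasurable f)
  · refine (B.le_opNorm₂ _ _).trans (mul_le_mul_of_nonneg_right ?_ (norm_nonneg _))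
    exact mul_le_mul_of_nonneg_left (a.norm_coe_le_norm _) B.opNorm_nonneg

/-- Pointwise application of a bilinear map to a continuous function and an `L²` function. -/
noncomputable def bilinI {X : Type*} [NormedAddCommGroup X] [NormedSpace ℝ X]
    (B : X →L[ℝ] W →L[ℝ] W) : C(unitInterval, X) →L[ℝ] L2I W →L[ℝ] L2I W :=
  LinearMap.mkContinuous₂ (LinearMap.mk₂ ℝ (fun a f => (memLp_bilinI B a f).toLp _)
    (fun a b f => by
      rw [← MemLp.toLp_add]
      refine MemLp.toLp_congr _ _ (Eventually.of_forall fun t => ?_)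
      simp)
    (fun c a f => by
      rw [← MemLp.toLp_const_smul]
      refine MemLp.toLp_congr _ _ (Eventually.of_forall fun t => ?_)
      simp)
    (fun a f g => by
      rw [← MemLp.toLp_add]
      refine MemLp.toLp_congr _ _ ?_
      filter_upwards [Lp.coeFn_add f g] with t ht
      rw [ht, Pi.add_apply, map_add, Pi.add_apply])
    (fun c a f => by
      rw [← MemLp.toLp_const_smul]
      refine MemLp.toLp_congr _ _ ?_
      filter_upwards [Lp.coeFn_smul c f] with t ht
      rw [ht, Pi.smul_apply, map_smul, Pi.smul_apply])) ‖B‖ (fun a f => by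
        refine Lp.norm_le_mul_norm_of_ae_le_mul ?_
        filter_upwards [(memLp_bilinI B a f).coeFn_toLp] with t ht
        rw [LinearMap.mk₂_apply, ht]
        refine (B.le_opNorm₂ _ _).trans (mul_le_mul_of_nonneg_right ?_ (norm_nonneg _))
        exact mul_le_mul_of_nonneg_left (a.norm_coe_le_norm _) B.opNorm_nonneg)

theorem coeFn_bilinI {X : Type*} [NormedAddCommGroup X] [NormedSpace ℝ X]
    (B : X →L[ℝ] W →L[ℝ] W) (a : C(unitInterval, X)) (f : L2I W) :
    bilinI B a f =ᵐ[volume.restrict (Icc (0 : ℝ) 1)] fun t => B (a (projI t)) (f t) :=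
  (memLp_bilinI B a f).coeFn_toLp

/-- Pointwise application of a continuous operator-valued function to an `L²` function. -/
noncomputable def mulI : C(unitInterval, W →L[ℝ] W) →L[ℝ] L2I W →L[ℝ] L2I W :=
  bilinI (ContinuousLinearMap.id ℝ (W →L[ℝ] W))

theorem coeFn_mulI (a : C(unitInterval, W →L[ℝ] W)) (f : L2I W) :
    mulI a f =ᵐ[volume.restrict (Icc (0 : ℝ) 1)] fun t => a (projI t) (f t) :=
  coeFn_bilinI _ a f

theorem mulI_mul (a b : C(unitInterval, W →L[ℝ] W)) (f : L2I W) :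
    mulI (a * b) f = mulI a (mulI b f) := by
  refine Lp.ext ?_
  filter_upwards [coeFn_mulI (a * b) f, coeFn_mulI a (mulI b f), coeFn_mulI b f] with t h1 h2 h3
  rw [h1, h2, h3]
  rfl

theorem mulI_one (f : L2I W) : mulI 1 f = f := by
  refine Lp.ext ?_
  filter_upwards [coeFn_mulI 1 f] with t h1
  rw [h1]
  rfl

theorem norm_mulI_of_isometry (a : C(unitInterval, W →L[ℝ] W)) (ha : ∀ t w, ‖a t w‖ = ‖w‖)
    (f : L2I W) : ‖mulI a f‖ = ‖f‖ := by
  have h : ∀ᵐ t ∂(volume.restrict (Icc (0 : ℝ) 1)), ‖mulI a f t‖ = ‖f t‖ := by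
    filter_upwards [coeFn_mulI a f] with t ht
    rw [ht, ha]
  refine le_antisymm (Lp.norm_le_norm_of_ae_le (h.mono fun t ht => ht.le))
    (Lp.norm_le_norm_of_ae_le (h.mono fun t ht => ht.ge))

/-- The constant functions in `L²`. -/
noncomputable def constI (W : Type*) [NormedAddCommGroup W] [InnerProductSpace ℝ W] :
    W →L[ℝ] L2I W :=
  Lp.constL 2 (volume.restrict (Icc (0 : ℝ) 1)) ℝ

theorem coeFn_constI (w : W) :
    constI W w =ᵐ[volume.restrict (Icc (0 : ℝ) 1)] fun _ => w :=
  Lp.coeFn_const ..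

/-! #### Primitives -/

theorem integrable_L2I (f : L2I W) : IntegrableOn f (Icc (0 : ℝ) 1) :=
  (Lp.memLp f).integrable (by norm_num)

theorem intervalIntegrable_L2I (f : L2I W) {s t : ℝ} (hs : s ∈ Icc (0 : ℝ) 1)
    (ht : t ∈ Icc (0 : ℝ) 1) : IntervalIntegrable f volume s t := by
  rw [intervalIntegrable_iff]
  refine (integrable_L2I f).mono_set ?_
  exact uIoc_subset_uIcc.trans (uIcc_subset_Icc hs ht)

variable [CompleteSpace W]

/-- The pairing of an integral over a subinterval with a vector, as an inner product in `L²`. -/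
theorem inner_intervalIntegral_L2I (f : L2I W) {s t : ℝ} (hs : 0 ≤ s) (hst : s ≤ t) (ht : t ≤ 1)
    (w : W) : inner ℝ w (∫ r in s..t, f r) =
      inner ℝ (indicatorConstLp (μ := volume.restrict (Icc (0 : ℝ) 1)) 2
        (measurableSet_Ioc (a := s) (b := t)) (measure_ne_top _ _) w) f := by
  rw [L2.inner_indicatorConstLp_eq_inner_setIntegral, intervalIntegral.integral_of_le hst,
    Measure.restrict_restrict measurableSet_Ioc, inter_eq_left.2]
  exact fun r hr => ⟨hs.trans hr.1.le, hr.2.trans ht⟩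

theorem norm_indicatorConstLp_Ioc {s t : ℝ} (hs : 0 ≤ s) (hst : s ≤ t) (ht : t ≤ 1) (w : W) :
    ‖indicatorConstLp (μ := volume.restrict (Icc (0 : ℝ) 1)) 2
        (measurableSet_Ioc (a := s) (b := t)) (measure_ne_top _ _) w‖ = ‖w‖ * √(t - s) := by
  rw [norm_indicatorConstLp (by norm_num) (by norm_num), Real.sqrt_eq_rpow, measureReal_def,
    Measure.restrict_apply measurableSet_Ioc, inter_eq_left.2, Real.volume_Ioc,
    ENNReal.toReal_ofReal (by linarith)]
  · norm_num
  · exact fun r hr => ⟨hs.trans hr.1.le, hr.2.trans ht⟩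

/-- The Cauchy–Schwarz bound that makes primitives of `L²` functions Hölder continuous. -/
theorem norm_intervalIntegral_L2I_le (f : L2I W) {s t : ℝ} (hs : s ∈ Icc (0 : ℝ) 1)
    (ht : t ∈ Icc (0 : ℝ) 1) : ‖∫ r in s..t, f r‖ ≤ √|t - s| * ‖f‖ := by
  wlog hst : s ≤ t generalizing s t
  · rw [intervalIntegral.integral_symm, norm_neg, abs_sub_comm]
    exact this ht hs (le_of_not_ge hst)
  rw [abs_of_nonneg (by linarith)]
  set w := ∫ r in s..t, f r with hw
  have h1 := inner_intervalIntegral_L2I f hs.1 hst ht.2 w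
  rw [← hw, real_inner_self_eq_norm_sq] at h1
  have h2 := real_inner_le_norm (indicatorConstLp (μ := volume.restrict (Icc (0 : ℝ) 1)) 2
        (measurableSet_Ioc (a := s) (b := t)) (measure_ne_top _ _) w) f
  rw [← h1, norm_indicatorConstLp_Ioc hs.1 hst ht.2] at h2
  rcases (norm_nonneg w).eq_or_lt with h3 | h3
  · rw [← h3]; positivity
  · have : ‖w‖ * ‖w‖ ≤ ‖w‖ * (√(t - s) * ‖f‖) := by nlinarith
    exact le_of_mul_le_mul_left this h3

/-- The function `t ↦ ∫₀ᵗ f`. -/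
noncomputable def primFun (f : L2I W) : C(unitInterval, W) where
  toFun t := ∫ r in (0 : ℝ)..t, f r
  continuous_toFun := by
    have h := intervalIntegral.continuousOn_primitive_interval
      (f := f) (μ := volume) (a := 0) (b := 1) (by
        rw [uIcc_of_le zero_le_one]; exact integrable_L2I f)
    rw [uIcc_of_le zero_le_one] at h
    exact continuousOn_iff_continuous_domRestrict.1 h

theorem primFun_sub (f : L2I W) (s t : unitInterval) :
    primFun f t - primFun f s = ∫ r in (s : ℝ)..t, f r := by
  have h0 : (0 : ℝ) ∈ Icc (0 : ℝ) 1 := by simp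
  exact intervalIntegral.integral_interval_sub_left (intervalIntegrable_L2I f h0 t.2)
    (intervalIntegrable_L2I f h0 s.2)

theorem norm_primFun_le (f : L2I W) (t : unitInterval) : ‖primFun f t‖ ≤ ‖f‖ := by
  have h0 : (0 : ℝ) ∈ Icc (0 : ℝ) 1 := by simp
  refine (norm_intervalIntegral_L2I_le f h0 t.2).trans ?_
  have : √|(t : ℝ) - 0| ≤ 1 := by
    rw [sub_zero, abs_of_nonneg t.2.1]
    exact Real.sqrt_le_one.2 t.2.2
  exact mul_le_of_le_one_left (norm_nonneg _) this

/-- The operator `f ↦ (t ↦ ∫₀ᵗ f)` from `L²` to the continuous functions. -/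
noncomputable def primI (W : Type*) [NormedAddCommGroup W] [InnerProductSpace ℝ W]
    [CompleteSpace W] : L2I W →L[ℝ] C(unitInterval, W) :=
  LinearMap.mkContinuous
    { toFun := primFun
      map_add' := fun f g => by
        ext t
        have h0 : (0 : ℝ) ∈ Icc (0 : ℝ) 1 := by simp
        show ∫ r in (0 : ℝ)..t, (f + g) r = (∫ r in (0 : ℝ)..t, f r) + ∫ r in (0 : ℝ)..t, g r
        rw [← intervalIntegral.integral_add (intervalIntegrable_L2I f h0 t.2)
          (intervalIntegrable_L2I g h0 t.2)]
        refine intervalIntegral.integral_congr_ae ?_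
        have := Lp.coeFn_add f g
        rw [Filter.EventuallyEq, ae_restrict_iff' measurableSet_Icc] at this
        filter_upwards [this] with r hr hrt
        rw [uIoc_of_le t.2.1] at hrt
        exact hr ⟨hrt.1.le, hrt.2.trans t.2.2⟩
      map_smul' := fun c f => by
        ext t
        show ∫ r in (0 : ℝ)..t, (c • f) r = c • ∫ r in (0 : ℝ)..t, f r
        rw [← intervalIntegral.integral_smul]
        refine intervalIntegral.integral_congr_ae ?_
        have := Lp.coeFn_smul c f
        rw [Filter.EventuallyEq, ae_restrict_iff' measurableSet_Icc] at this
        filter_upwards [this] with r hr hrt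
        rw [uIoc_of_le t.2.1] at hrt
        exact hr ⟨hrt.1.le, hrt.2.trans t.2.2⟩ } 1 (fun f => by
      rw [one_mul]
      exact (ContinuousMap.norm_le _ (norm_nonneg _)).2 (norm_primFun_le f))

theorem primI_apply (f : L2I W) (t : unitInterval) : primI W f t = ∫ r in (0 : ℝ)..t, f r := rfl

theorem norm_primI_sub_le (f : L2I W) (s t : unitInterval) :
    ‖primI W f t - primI W f s‖ ≤ √|(t : ℝ) - s| * ‖f‖ := by
  have : primI W f t - primI W f s = ∫ r in (s : ℝ)..t, f r := primFun_sub f s t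
  rw [this]
  exact norm_intervalIntegral_L2I_le f s.2 t.2

theorem primI_zero (f : L2I W) : primI W f 0 = 0 := by
  rw [primI_apply]; simp

theorem primI_constI (w : W) (t : unitInterval) : primI W (constI W w) t = (t : ℝ) • w := by
  rw [primI_apply]
  have h1 : ∫ r in (0 : ℝ)..t, constI W w r = ∫ r in (0 : ℝ)..t, w := by
    refine intervalIntegral.integral_congr_ae ?_
    have := coeFn_constI w
    rw [Filter.EventuallyEq, ae_restrict_iff' measurableSet_Icc] at this
    filter_upwards [this] with r hr hrt
    rw [uIoc_of_le t.2.1] at hrt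
    exact hr ⟨hrt.1.le, hrt.2.trans t.2.2⟩
  rw [h1, intervalIntegral.integral_const, sub_zero]

/-- The primitive is differentiable at almost all points, with the expected derivative. -/
theorem ae_hasDerivAt_primI (f : L2I W) : ∀ᵐ t ∂(volume.restrict (Icc (0 : ℝ) 1)),
    HasDerivAt (fun s => primI W f (projI s)) (f t) t := by
  have h := (intervalIntegrable_L2I f (s := 0) (t := 1) (by simp) (by simp)).ae_hasDerivAt_integral
  have h' : ∀ᵐ t ∂(volume.restrict (Icc (0 : ℝ) 1)),
      HasDerivAt (fun s => ∫ r in (0 : ℝ)..s, f r) (f t) t := by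
    rw [ae_restrict_iff' measurableSet_Icc]
    filter_upwards [h] with t ht htI
    rw [uIcc_of_le zero_le_one] at ht
    exact ht htI 0 (by simp)
  filter_upwards [ae_restrict_Icc h'] with t ht
  refine ht.2.congr_of_eventuallyEq ?_
  filter_upwards [Ioo_mem_nhds ht.1.1 ht.1.2] with s hs
  rw [projI_of_mem (Ioo_subset_Icc_self hs)]
  rfl

/-- The adjoint of the inclusion of the constants is the integral over `[0,1]`. -/
theorem adjointL_constI [FiniteDimensional ℝ W] (f : L2I W) :
    adjointL (L2I W) W (constI W) f = primI W f 1 := by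
  refine ext_inner_left ℝ fun w => ?_
  rw [adjointL_inner_right, primI_apply]
  have := inner_intervalIntegral_L2I f (s := 0) (t := 1) le_rfl zero_le_one le_rfl w
  rw [Set.Icc.coe_one, this]
  congr 1
  refine Lp.ext ?_
  have h1 := indicatorConstLp_coeFn (μ := volume.restrict (Icc (0 : ℝ) 1)) (p := 2)
    (hs := measurableSet_Ioc (a := (0 : ℝ)) (b := 1)) (hμs := measure_ne_top _ _) (c := w)
  have h2 := ae_restrict_Icc (coeFn_constI w)
  filter_upwards [h1, h2] with t ht1 ht2
  have ht3 : t ∈ Ioc (0 : ℝ) 1 := ⟨ht2.1.1, ht2.1.2.le⟩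
  rw [ht1, ht2.2, indicator_of_mem ht3]

/-! #### Compactness -/

/-- The Arzelà–Ascoli theorem for bounded functions with a common Hölder-`1/2` constant. -/
theorem isCompact_holder_half (X : Type*) [NormedAddCommGroup X] [NormedSpace ℝ X]
    [FiniteDimensional ℝ X] (C : ℝ) :
    IsCompact {a : C(unitInterval, X) | (∀ t, ‖a t‖ ≤ C) ∧
      ∀ s t : unitInterval, ‖a t - a s‖ ≤ √|(t : ℝ) - s| * C} := by
  have : ProperSpace X := FiniteDimensional.proper ℝ X
  let φ := ContinuousMap.isometryEquivBoundedOfCompact unitInterval X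
  let A : Set (BoundedContinuousFunction unitInterval X) := {a | (∀ t, ‖a t‖ ≤ C) ∧
      ∀ s t : unitInterval, ‖a t - a s‖ ≤ √|(t : ℝ) - s| * C}
  have hA : IsCompact A := by
    refine BoundedContinuousFunction.arzela_ascoli₂ (Metric.closedBall 0 C)
      (isCompact_closedBall 0 C) A ?_ ?_ ?_
    · have : A = (⋂ t, {a | ‖a t‖ ≤ C}) ∩ ⋂ s : unitInterval, ⋂ t : unitInterval,
          {a | ‖a t - a s‖ ≤ √|(t : ℝ) - s| * C} := by
        ext a; simp only [A, mem_inter_iff, mem_iInter, mem_ofPred_eq]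
      rw [this]
      have hev : ∀ t, Continuous fun a : BoundedContinuousFunction unitInterval X => a t :=
        fun t => (BoundedContinuousFunction.lipschitz_eval_const t).continuous
      refine (isClosed_iInter fun t => isClosed_le (hev t).norm continuous_const).inter
        (isClosed_iInter fun s => isClosed_iInter fun t =>
          isClosed_le ((hev t).sub (hev s)).norm continuous_const)
    · intro f t hf
      simpa using hf.1 t
    · have hlim : ∀ s : unitInterval,
          Tendsto (fun t : unitInterval => √|(t : ℝ) - s| * C) (𝓝 s) (𝓝 0) := by
        intro s
        have : Continuous fun t : unitInterval => √|(t : ℝ) - s| * C := by fun_prop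
        simpa using this.tendsto s
      intro s
      refine Metric.equicontinuousAt_of_continuity_modulus
        (fun t : unitInterval => √|(t : ℝ) - s| * C) (hlim s) _ (Eventually.of_forall fun t a => ?_)
      rw [dist_comm, dist_eq_norm]
      exact a.2.2 s t
  have := hA.image φ.symm.continuous
  refine (congrArg IsCompact (Set.ext fun a => ?_)).mp this
  symm
  constructor
  · intro ha
    exact ⟨φ a, ha, φ.symm_apply_apply a⟩
  · rintro ⟨b, hb, rfl⟩
    exact hb

theorem isCompactOperator_primI [FiniteDimensional ℝ W] : IsCompactOperator (primI W) := by
  refine ⟨_, isCompact_holder_half W 1, ?_⟩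
  filter_upwards [Metric.closedBall_mem_nhds (0 : L2I W) one_pos] with f hf
  rw [mem_closedBall_zero_iff] at hf
  refine ⟨fun t => (norm_primFun_le f t).trans hf, fun s t => (norm_primI_sub_le f s t).trans ?_⟩
  gcongr

/-! #### The Hilbert–Schmidt bound -/

/-- Evaluation of primitives at `t` is the pairing with the indicator functions of `(0,t]`, so that
Bessel's inequality bounds its Hilbert–Schmidt norm. -/
theorem sum_norm_sq_primI_le [FiniteDimensional ℝ W] {ι : Type*} [Fintype ι] {e : ι → L2I W}
    (he : Orthonormal ℝ e) (t : unitInterval) :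
    ∑ i, ‖primI W (e i) t‖ ^ 2 ≤ Module.finrank ℝ W := by
  let b := stdOrthonormalBasis ℝ W
  have h1 : ∀ i, ‖primI W (e i) t‖ ^ 2 = ∑ j, (inner ℝ (e i)
      (indicatorConstLp (μ := volume.restrict (Icc (0 : ℝ) 1)) 2
        (measurableSet_Ioc (a := 0) (b := (t : ℝ))) (measure_ne_top _ _) (b j))) ^ 2 := by
    intro i
    rw [← b.sum_sq_norm_inner_right]
    refine Finset.sum_congr rfl fun j _ => ?_
    rw [primI_apply, inner_intervalIntegral_L2I (e i) le_rfl t.2.1 t.2.2, real_inner_comm,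
      Real.norm_eq_abs, sq_abs]
  simp_rw [h1]
  rw [Finset.sum_comm]
  have h2 : ∀ j ∈ (Finset.univ : Finset (Fin (Module.finrank ℝ W))), ∑ i, (inner ℝ (e i)
      (indicatorConstLp (μ := volume.restrict (Icc (0 : ℝ) 1)) 2
        (measurableSet_Ioc (a := 0) (b := (t : ℝ))) (measure_ne_top _ _) (b j))) ^ 2 ≤ (1 : ℝ) := by
    intro j _
    have h3 := he.sum_inner_products_le (s := Finset.univ)
      (indicatorConstLp (μ := volume.restrict (Icc (0 : ℝ) 1)) 2
        (measurableSet_Ioc (a := 0) (b := (t : ℝ))) (measure_ne_top _ _) (b j))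
    simp only [Real.norm_eq_abs, sq_abs] at h3
    refine h3.trans ?_
    rw [norm_indicatorConstLp_Ioc le_rfl t.2.1 t.2.2, b.norm_eq_one, one_mul, sub_zero,
      Real.sq_sqrt t.2.1]
    exact t.2.2
  refine (Finset.sum_le_sum h2).trans ?_
  simp

theorem sum_norm_sq_L2I_le {ι : Type*} [Fintype ι] (f : ι → L2I W) (C : ℝ)
    (hf : ∀ᵐ t ∂(volume.restrict (Icc (0 : ℝ) 1)), ∑ i, ‖f i t‖ ^ 2 ≤ C) :
    ∑ i, ‖f i‖ ^ 2 ≤ C := by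
  have h1 : ∀ i, ‖f i‖ ^ 2 = ∫ t in Icc (0 : ℝ) 1, ‖f i t‖ ^ 2 := by
    intro i
    rw [← real_inner_self_eq_norm_sq, L2.inner_def]
    simp only [real_inner_self_eq_norm_sq]
  have hint : ∀ i, Integrable (fun t => ‖f i t‖ ^ 2) (volume.restrict (Icc (0 : ℝ) 1)) :=
    fun i => (Lp.memLp (f i)).integrable_norm_pow (by norm_num)
  simp_rw [h1]
  rw [← integral_finsetSum _ (fun i _ => hint i)]
  refine (integral_mono_ae (integrable_finsetSum _ fun i _ => hint i)
    (integrable_const C) hf).trans ?_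
  simp

/-! #### Time reversal -/

theorem measurePreserving_one_sub :
    MeasurePreserving (fun t : ℝ => 1 - t) (volume.restrict (Icc (0 : ℝ) 1))
      (volume.restrict (Icc (0 : ℝ) 1)) := by
  have h := (volume.measurePreserving_sub_left (1 : ℝ)).restrict_preimage
    (measurableSet_Icc (a := (0 : ℝ)) (b := 1))
  have : (fun t : ℝ => 1 - t) ⁻¹' Icc (0 : ℝ) 1 = Icc 0 1 := by
    ext t; simp only [mem_preimage, mem_Icc]; constructor <;> rintro ⟨h1, h2⟩ <;>
      constructor <;> linarith
  rwa [this] at h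

/-- The isometry `f ↦ (t ↦ f (1 - t))` of `L²([0,1])`. -/
noncomputable def reverseI (W : Type*) [NormedAddCommGroup W] [InnerProductSpace ℝ W] :
    L2I W ≃ₗᵢ[ℝ] L2I W :=
  LinearIsometryEquiv.ofSurjective
    (Lp.compMeasurePreservingₗᵢ ℝ (fun t : ℝ => 1 - t) measurePreserving_one_sub) (by
      intro f
      refine ⟨Lp.compMeasurePreservingₗᵢ ℝ (fun t : ℝ => 1 - t) measurePreserving_one_sub f, ?_⟩
      refine Lp.ext ?_
      have h1 := Lp.coeFn_compMeasurePreserving f measurePreserving_one_sub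
      have h2 := Lp.coeFn_compMeasurePreserving
        (Lp.compMeasurePreserving (fun t : ℝ => 1 - t) measurePreserving_one_sub f)
        measurePreserving_one_sub
      have h3 := measurePreserving_one_sub.quasiMeasurePreserving.ae_eq_comp h1
      refine h2.trans (h3.trans (Eventually.of_forall fun t => ?_))
      simp)

theorem coeFn_reverseI (f : L2I W) :
    reverseI W f =ᵐ[volume.restrict (Icc (0 : ℝ) 1)] fun t => f (1 - t) :=
  Lp.coeFn_compMeasurePreserving f measurePreserving_one_sub

theorem reverseI_constI (w : W) : reverseI W (constI W w) = constI W w := by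
  refine Lp.ext ?_
  have h3 := measurePreserving_one_sub.quasiMeasurePreserving.ae_eq_comp (coeFn_constI w)
  exact (coeFn_reverseI _).trans (h3.trans (coeFn_constI w).symm)

theorem projI_one_sub (t : ℝ) : projI (1 - t) = unitInterval.symm (projI t) := by
  apply Subtype.ext
  simp only [projIcc, unitInterval.coe_symm_eq]
  rcases le_total t 0 with h | h <;> rcases le_total t 1 with h' | h' <;>
    simp [h, h', sub_nonneg] <;> linarith

/-- Time reversal of a pointwise product. -/
theorem mulI_comp_symm_reverseI (a : C(unitInterval, W →L[ℝ] W)) (f : L2I W) :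
    mulI (a.comp ⟨unitInterval.symm, unitInterval.continuous_symm⟩) (reverseI W f) =
      reverseI W (mulI a f) := by
  refine Lp.ext ?_
  have h3 := measurePreserving_one_sub.quasiMeasurePreserving.ae_eq_comp (coeFn_mulI a f)
  filter_upwards [coeFn_mulI (a.comp ⟨unitInterval.symm, unitInterval.continuous_symm⟩)
    (reverseI W f), coeFn_reverseI f, coeFn_reverseI (mulI a f), h3] with t h1 h2 h4 h5
  rw [h1, h2, h4]
  simp only [Function.comp_apply] at h5
  rw [h5, projI_one_sub]
  rfl

/-- For functions with integral zero, time reversal anticommutes with the primitive. -/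
theorem primI_reverseI (f : L2I W) (hf : primI W f 1 = 0) (t : unitInterval) :
    primI W (reverseI W f) t = -primI W f (unitInterval.symm t) := by
  have h1 : primI W (reverseI W f) t = ∫ r in (0 : ℝ)..t, f (1 - r) := by
    rw [primI_apply]
    refine intervalIntegral.integral_congr_ae ?_
    have := coeFn_reverseI f
    rw [Filter.EventuallyEq, ae_restrict_iff' measurableSet_Icc] at this
    filter_upwards [this] with r hr hrt
    rw [uIoc_of_le t.2.1] at hrt
    exact hr ⟨hrt.1.le, hrt.2.trans t.2.2⟩
  rw [h1, intervalIntegral.integral_comp_sub_left (fun r => f r) 1, sub_zero]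
  have h2 := primFun_sub f (unitInterval.symm t) 1
  have h3 : primFun f 1 = 0 := hf
  rw [h3, zero_sub] at h2
  rw [unitInterval.coe_symm_eq, Set.Icc.coe_one] at h2
  exact h2.symm

/-! #### Volterra equations -/

/-- Volterra operators do not have the eigenvalue `-1`, by Grönwall's inequality. -/
theorem eq_zero_of_add_mulI_primI_eq_zero [FiniteDimensional ℝ W] (B : W →L[ℝ] W →L[ℝ] W) (w : W)
    (f : L2I W)
    (hf : f + mulI ((B.compLeftContinuous ℝ unitInterval) (primI W f)) (constI W w) = 0) :
    f = 0 := by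
  set j := primI W f with hj
  let b : W →L[ℝ] W := B.flip w
  have h1 : ∀ᵐ t ∂(volume.restrict (Icc (0 : ℝ) 1)), f t = -b (j (projI t)) := by
    have h2 : f = -mulI ((B.compLeftContinuous ℝ unitInterval) j) (constI W w) :=
      eq_neg_of_add_eq_zero_left hf
    have h3 : f =ᵐ[volume.restrict (Icc (0 : ℝ) 1)]
        -(mulI ((B.compLeftContinuous ℝ unitInterval) j) (constI W w)) :=
      (Filter.EventuallyEq.of_eq (congrArg (fun g : L2I W => (g : ℝ → W)) h2)).trans
        (Lp.coeFn_neg _)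
    filter_upwards [h3, coeFn_mulI ((B.compLeftContinuous ℝ unitInterval) j) (constI W w),
      coeFn_constI w] with t h4 h5 h6
    rw [h4, Pi.neg_apply, h5, h6]
    rfl
  have hjc : Continuous fun t : ℝ => -b (j (projI t)) :=
    (b.continuous.comp (j.continuous.comp continuous_projI)).neg
  have h2 : ∀ t ∈ Icc (0 : ℝ) 1, j (projI t) = ∫ r in (0 : ℝ)..t, -b (j (projI r)) := by
    intro t ht
    rw [projI_of_mem ht, hj, primI_apply]
    refine intervalIntegral.integral_congr_ae ?_
    rw [ae_restrict_iff' measurableSet_Icc] at h1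
    filter_upwards [h1] with r hr hrt
    rw [uIoc_of_le ht.1] at hrt
    exact hr ⟨hrt.1.le, hrt.2.trans ht.2⟩
  let g : ℝ → W := fun t => ∫ r in (0 : ℝ)..t, -b (j (projI r))
  have hg : ∀ t, HasDerivAt g (-b (j (projI t))) t := fun t =>
    intervalIntegral.integral_hasDerivAt_right (hjc.intervalIntegrable _ _)
      (hjc.stronglyMeasurableAtFilter _ _) hjc.continuousAt
  have hgr := norm_le_gronwallBound_of_norm_deriv_right_le (f := g)
    (f' := fun t => -b (j (projI t))) (δ := 0) (K := ‖b‖) (ε := 0) (a := 0) (b := 1)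
    (fun t _ => (hg t).continuousAt.continuousWithinAt)
    (fun t _ => (hg t).hasDerivWithinAt) (by simp [g]) (by
      intro t ht
      rw [norm_neg, add_zero, h2 t (Ico_subset_Icc_self ht)]
      exact b.le_opNorm _)
  have hj0 : ∀ t ∈ Icc (0 : ℝ) 1, j (projI t) = 0 := by
    intro t ht
    have := hgr t ht
    rw [gronwallBound_ε0_δ0, norm_le_zero_iff] at this
    rw [h2 t ht]; exact this
  refine Lp.ext ?_
  filter_upwards [h1, ae_restrict_mem measurableSet_Icc,
    Lp.coeFn_zero W 2 (volume.restrict (Icc (0 : ℝ) 1))] with t h3 h4 h5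
  rw [h3, h5, hj0 t h4]; simp

end UnitIntervalL2

/-! ### Superposition operators and the local flow -/

section Superposition

attribute [-instance] Bundle.instNormedAddCommGroupOfRiemannianBundleOfIsTopologicalAddGroupOfContinuousConstSMulReal
  Bundle.instInnerProductSpaceReal

variable {K : Type*} [TopologicalSpace K] [CompactSpace K]

/-- Pointwise application of a bilinear map to two continuous functions. -/
noncomputable def bilinC {X Y Z : Type*} [NormedAddCommGroup X] [NormedSpace ℝ X]
    [NormedAddCommGroup Y] [NormedSpace ℝ Y] [NormedAddCommGroup Z] [NormedSpace ℝ Z]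
    (B : X →L[ℝ] Y →L[ℝ] Z) : C(K, X) →L[ℝ] C(K, Y) →L[ℝ] C(K, Z) :=
  LinearMap.mkContinuous₂ (LinearMap.mk₂ ℝ
    (fun a f => ⟨fun t => B (a t) (f t), by fun_prop⟩)
    (fun a b f => by ext t; simp)
    (fun c a f => by ext t; simp)
    (fun a f g => by ext t; simp)
    (fun c a f => by ext t; simp)) ‖B‖ (fun a f => by
      have hB : 0 ≤ ‖B‖ := B.opNorm_nonneg
      refine (ContinuousMap.norm_le _ (by positivity)).2 fun t => ?_
      refine (B.le_opNorm₂ _ _).trans ?_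
      gcongr
      · exact a.norm_coe_le_norm t
      · exact f.norm_coe_le_norm t)

/-- The superposition operator `f ↦ F ∘ f` of a `C¹` map `F` is differentiable, and its derivative
is the multiplication by `F' ∘ f`: this follows from the uniform continuity of `F'` near the compact
range of `f`. -/
theorem hasFDerivAt_superposition {X Y : Type*} [NormedAddCommGroup X] [NormedSpace ℝ X]
    [NormedAddCommGroup Y] [NormedSpace ℝ Y] {F : C(X, Y)} {F' : C(X, X →L[ℝ] Y)}
    (hF : ∀ x, HasFDerivAt F (F' x) x) (f : C(K, X)) :
    HasFDerivAt (fun f : C(K, X) => F.comp f)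
      (bilinC (ContinuousLinearMap.id ℝ (X →L[ℝ] Y)) (F'.comp f)) f := by
  refine HasFDerivAt.of_isLittleO (Asymptotics.isLittleO_iff.2 fun ε hε => ?_)
  have hc : IsCompact (range f) := isCompact_range f.continuous
  obtain ⟨δ, hδ, hδ'⟩ := Metric.mem_uniformity_dist.1
    (hc.uniformContinuousAt_of_continuousAt (f := F') (r := {p | dist p.1 p.2 < ε})
      (fun x _ => F'.continuous.continuousAt) (Metric.dist_mem_uniformity hε))
  filter_upwards [Metric.ball_mem_nhds f hδ] with g hg
  refine (ContinuousMap.norm_le _ (by positivity)).2 fun t => ?_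
  show ‖F (g t) - F (f t) - F' (f t) (g t - f t)‖ ≤ ε * ‖g - f‖
  have hgt : g t ∈ Metric.ball (f t) δ := by
    rw [Metric.mem_ball] at hg ⊢
    exact (ContinuousMap.dist_apply_le_dist t).trans_lt hg
  have h1 := (convex_ball (f t) δ).norm_image_sub_le_of_norm_hasFDerivWithin_le' (f := F)
    (f' := F') (φ := F' (f t)) (C := ε) (x := f t) (y := g t)
    (fun x _ => (hF x).hasFDerivWithinAt) (fun x hx => by
      rw [← dist_eq_norm, dist_comm]
      refine (hδ' (a := f t) (b := x) ?_ (mem_range_self t)).le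
      rw [dist_comm]; exact hx) (Metric.mem_ball_self hδ) hgt
  refine h1.trans ?_
  gcongr
  exact (g - f).norm_coe_le_norm t

/-- The superposition operator of a `Cⁿ` map is `Cⁿ`, by induction on `n` through its derivative. -/
theorem contDiff_superposition {X : Type u} [NormedAddCommGroup X] [NormedSpace ℝ X] (n : ℕ) :
    ∀ {Y : Type u} [NormedAddCommGroup Y] [NormedSpace ℝ Y] (F : C(X, Y)), ContDiff ℝ n F →
      ContDiff ℝ n (fun f : C(K, X) => F.comp f) := by
  induction n with
  | zero =>
    intro Y _ _ F hF
    rw [Nat.cast_zero, contDiff_zero]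
    exact F.continuous_postcomp
  | succ n ih =>
    intro Y _ _ F hF
    rw [Nat.cast_add, Nat.cast_one] at hF ⊢
    obtain ⟨F', hF', hd⟩ := contDiff_succ_iff_hasFDerivAt.1 hF
    refine contDiff_succ_iff_hasFDerivAt.2
      ⟨fun f => bilinC (ContinuousLinearMap.id ℝ (X →L[ℝ] Y))
        ((⟨F', hF'.continuous⟩ : C(X, X →L[ℝ] Y)).comp f), ?_, fun f => ?_⟩
    · exact (bilinC (K := K) (ContinuousLinearMap.id ℝ (X →L[ℝ] Y))).contDiff.comp
        (ih ⟨F', hF'.continuous⟩ hF')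
    · exact hasFDerivAt_superposition (F' := ⟨F', hF'.continuous⟩) hd f

theorem contDiff_infty_superposition {X Y : Type u} [NormedAddCommGroup X] [NormedSpace ℝ X]
    [NormedAddCommGroup Y] [NormedSpace ℝ Y] (F : C(X, Y)) (hF : ContDiff ℝ ∞ F) :
    ContDiff ℝ ∞ (fun f : C(K, X) => F.comp f) :=
  contDiff_infty.2 fun n => contDiff_superposition n F (contDiff_infty.1 hF n)

end Superposition

section LocalFlow

attribute [-instance] Bundle.instNormedAddCommGroupOfRiemannianBundleOfIsTopologicalAddGroupOfContinuousConstSMulReal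
  Bundle.instInnerProductSpaceReal

variable {W : Type*} [NormedAddCommGroup W] [InnerProductSpace ℝ W] [CompleteSpace W]

theorem contDiff_bilinI {X : Type*} [NormedAddCommGroup X] [NormedSpace ℝ X]
    (B : X →L[ℝ] W →L[ℝ] W) : ContDiff ℝ ∞ (fun a : C(unitInterval, X) => bilinI B a) :=
  ContinuousLinearMap.contDiff _

theorem contDiff_mulI : ContDiff ℝ ∞ (fun a : C(unitInterval, W →L[ℝ] W) => mulI a) :=
  contDiff_bilinI (ContinuousLinearMap.id ℝ (W →L[ℝ] W))

/-- The equation `x' = F(x) u`, `x(0) = 0`, on `[0,1]` is solvable for small `u ∈ L²`, with a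
solution that depends smoothly on `u`.  This is the implicit function theorem for the map
`(x, u) ↦ x - ∫ F(x) u`, whose partial derivative in `x` at the origin is the identity. -/
theorem exists_localFlow (F : C(W, W →L[ℝ] W)) (hF : ContDiff ℝ ∞ F)
    (hF0 : F 0 = ContinuousLinearMap.id ℝ W) :
    ∃ x : L2I W → C(unitInterval, W), ContDiffAt ℝ ∞ x 0 ∧ x 0 = 0 ∧
      HasFDerivAt x (primI W) 0 ∧ ∀ᶠ u in 𝓝 0, x u = primI W (mulI (F.comp (x u)) u) := by
  let J := primI W
  let Ψ : C(unitInterval, W) × L2I W → C(unitInterval, W) × L2I W :=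
    fun z => (z.1 - J (mulI (F.comp z.1) z.2), z.2)
  have hm : ContDiff ℝ ∞ fun z : C(unitInterval, W) × L2I W => mulI (F.comp z.1) :=
    contDiff_mulI.comp ((contDiff_infty_superposition F hF).comp contDiff_fst)
  have hΨ : ContDiff ℝ ∞ Ψ :=
    (contDiff_fst.sub (J.contDiff.comp (hm.clm_apply contDiff_snd))).prodMk contDiff_snd
  let L : C(unitInterval, W) × L2I W →L[ℝ] C(unitInterval, W) × L2I W :=
    (ContinuousLinearMap.fst ℝ _ _ - J.comp (ContinuousLinearMap.snd ℝ _ _)).prod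
      (ContinuousLinearMap.snd ℝ _ _)
  let L' : C(unitInterval, W) × L2I W →L[ℝ] C(unitInterval, W) × L2I W :=
    (ContinuousLinearMap.fst ℝ _ _ + J.comp (ContinuousLinearMap.snd ℝ _ _)).prod
      (ContinuousLinearMap.snd ℝ _ _)
  let e := ContinuousLinearEquiv.equivOfInverse L L'
    (fun z => by ext1 <;> simp [L, L']) (fun z => by ext1 <;> simp [L, L'])
  have hF0' : F.comp (0 : C(unitInterval, W)) = 1 := by
    ext t : 1
    show F 0 = _
    rw [hF0]; rfl
  have hΨ' : HasFDerivAt Ψ (e : C(unitInterval, W) × L2I W →L[ℝ] C(unitInterval, W) × L2I W) 0 := by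
    have h1 : HasFDerivAt (fun z : C(unitInterval, W) × L2I W => mulI (F.comp z.1)) _ 0 :=
      (hm.differentiable (by simp) 0).hasFDerivAt
    have h2 := h1.clm_apply hasFDerivAt_snd
    have h3 := (hasFDerivAt_fst.sub (J.hasFDerivAt.comp _ h2)).prodMk
      (hasFDerivAt_snd (p := (0 : C(unitInterval, W) × L2I W)))
    refine h3.congr_fderiv ?_
    refine ContinuousLinearMap.ext fun z => Prod.ext ?_ ?_
    · show z.1 - J (mulI (F.comp (0 : C(unitInterval, W))) z.2 +
        fderiv ℝ (fun z : C(unitInterval, W) × L2I W => mulI (F.comp z.1)) 0 z 0) = z.1 - J z.2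
      rw [hF0', mulI_one, map_zero, add_zero]
    · rfl
  have hΨ0 : Ψ 0 = 0 := by simp [Ψ]
  obtain ⟨g, hg1, hg2, hg3, hg4, -⟩ := exists_contDiffAt_local_inverse hΨ.contDiffAt hΨ'
  rw [hΨ0] at hg1 hg2 hg3 hg4
  let i : L2I W →L[ℝ] C(unitInterval, W) × L2I W := ContinuousLinearMap.inr ℝ _ _
  have hi0 : i 0 = 0 := map_zero i
  have hi : Tendsto i (𝓝 0) (𝓝 0) := by simpa [hi0] using i.continuous.tendsto 0
  refine ⟨fun u => (g (i u)).1, ?_, ?_, ?_, ?_⟩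
  · exact contDiffAt_fst.comp (0 : L2I W)
      (ContDiffAt.comp (0 : L2I W) (by rw [hi0]; exact hg2) i.contDiff.contDiffAt)
  · show (g (i 0)).1 = 0
    rw [hi0, hg1]; rfl
  · have h1 : HasFDerivAt g (e.symm : _ →L[ℝ] _) (i 0) := by rw [hi0]; exact hg3
    have h2 := hasFDerivAt_fst.comp (0 : L2I W) (h1.comp (0 : L2I W) i.hasFDerivAt)
    refine h2.congr_fderiv ?_
    ext1 u
    show (L' (i u)).1 = J u
    simp [L', i]
  · filter_upwards [hi.eventually hg4] with u hu
    have h1 := congrArg Prod.fst hu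
    have h2 := congrArg Prod.snd hu
    simp only [Ψ, i, ContinuousLinearMap.inr_apply] at h1 h2 ⊢
    rw [h2] at h1
    exact sub_eq_zero.1 h1

end LocalFlow

/-! ### Curves of class `H¹` in metric spaces -/

section HOneCurves

attribute [-instance] Bundle.instNormedAddCommGroupOfRiemannianBundleOfIsTopologicalAddGroupOfContinuousConstSMulReal
  Bundle.instInnerProductSpaceReal

variable {X Y : Type*} [PseudoMetricSpace X] [PseudoMetricSpace Y]

/-- Near the time `t₀ ∈ [0,1]`, the curve `F` in a metric space is an `H¹` curve: its increments are
bounded by the integrals of a square-integrable function. -/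
def IsHOneCurveAt (F : ℝ → X) (t₀ : ℝ) : Prop :=
  ∃ g : ℝ → ℝ, MemLp g 2 (volume.restrict (Icc (0 : ℝ) 1)) ∧ 0 ≤ g ∧
    ∃ U ∈ 𝓝[Icc 0 1] t₀, ∀ s ∈ U, ∀ t ∈ U, 0 ≤ s → s ≤ t → t ≤ 1 →
      dist (F s) (F t) ≤ ∫ r in s..t, g r

theorem intervalIntegrable_of_memLp_Icc {g : ℝ → ℝ}
    (hg : MemLp g 2 (volume.restrict (Icc (0 : ℝ) 1))) {s t : ℝ} (hs : s ∈ Icc (0 : ℝ) 1)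
    (ht : t ∈ Icc (0 : ℝ) 1) : IntervalIntegrable g volume s t := by
  rw [intervalIntegrable_iff]
  exact IntegrableOn.mono_set (hg.integrable (by norm_num))
    (uIoc_subset_uIcc.trans (uIcc_subset_Icc hs ht))

namespace IsHOneCurveAt

theorem congr {F F' : ℝ → X} {t₀ : ℝ} (h : IsHOneCurveAt F t₀)
    (hF : F =ᶠ[𝓝[Icc 0 1] t₀] F') : IsHOneCurveAt F' t₀ := by
  obtain ⟨g, hg, hg0, U, hU, h⟩ := h
  refine ⟨g, hg, hg0, _, inter_mem hU hF, fun s hs t ht h0 hst h1 => ?_⟩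
  have h2 : F s = F' s := hs.2
  have h3 : F t = F' t := ht.2
  rw [← h2, ← h3]
  exact h s hs.1 t ht.1 h0 hst h1

theorem prodMk {F : ℝ → X} {F' : ℝ → Y} {t₀ : ℝ} (h : IsHOneCurveAt F t₀)
    (h' : IsHOneCurveAt F' t₀) : IsHOneCurveAt (fun t => (F t, F' t)) t₀ := by
  obtain ⟨g, hg, hg0, U, hU, h⟩ := h
  obtain ⟨g', hg', hg0', U', hU', h'⟩ := h'
  refine ⟨g + g', hg.add hg', add_nonneg hg0 hg0', _, inter_mem hU hU',
    fun s hs t ht h0 hst h1 => ?_⟩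
  have hs1 : s ∈ Icc (0 : ℝ) 1 := ⟨h0, hst.trans h1⟩
  have ht1 : t ∈ Icc (0 : ℝ) 1 := ⟨h0.trans hst, h1⟩
  have h2 := h s hs.1 t ht.1 h0 hst h1
  have h3 := h' s hs.2 t ht.2 h0 hst h1
  have h4 : ∫ r in s..t, (g + g') r = (∫ r in s..t, g r) + ∫ r in s..t, g' r :=
    intervalIntegral.integral_add (intervalIntegrable_of_memLp_Icc hg hs1 ht1)
      (intervalIntegrable_of_memLp_Icc hg' hs1 ht1)
  rw [h4, Prod.dist_eq]
  have h5 : 0 ≤ ∫ r in s..t, g r := intervalIntegral.integral_nonneg hst fun r _ => hg0 r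
  have h6 : 0 ≤ ∫ r in s..t, g' r := intervalIntegral.integral_nonneg hst fun r _ => hg0' r
  exact max_le (by linarith) (by linarith)

theorem lipschitz_comp {F : ℝ → X} {t₀ : ℝ} (h : IsHOneCurveAt F t₀)
    (hc : ContinuousWithinAt F (Icc 0 1) t₀) {Φ : X → Y} {K : NNReal} {S : Set X}
    (hS : S ∈ 𝓝 (F t₀)) (hΦ : LipschitzOnWith K Φ S) : IsHOneCurveAt (fun t => Φ (F t)) t₀ := by
  obtain ⟨g, hg, hg0, U, hU, h⟩ := h
  refine ⟨fun r => K * g r, hg.const_mul _, fun r => mul_nonneg K.2 (hg0 r), _,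
    inter_mem hU (hc hS), fun s hs t ht h0 hst h1 => ?_⟩
  rw [intervalIntegral.integral_const_mul]
  exact (hΦ.dist_le_mul _ hs.2 _ ht.2).trans
    (mul_le_mul_of_nonneg_left (h s hs.1 t ht.1 h0 hst h1) K.2)

theorem contDiffAt_comp {X Y : Type*} [NormedAddCommGroup X] [NormedSpace ℝ X]
    [NormedAddCommGroup Y] [NormedSpace ℝ Y] {F : ℝ → X} {t₀ : ℝ} (h : IsHOneCurveAt F t₀)
    (hc : ContinuousWithinAt F (Icc 0 1) t₀) {Φ : X → Y} (hΦ : ContDiffAt ℝ ∞ Φ (F t₀)) :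
    IsHOneCurveAt (fun t => Φ (F t)) t₀ := by
  obtain ⟨K, S, hS, hK⟩ := (hΦ.of_le (m := 1) (by exact_mod_cast le_top)).exists_lipschitzOnWith
  exact h.lipschitz_comp hc hS hK

/-- A curve is `H¹` if its increments are controlled by the sum of the increments of finitely many
`H¹` curves, such as its coordinates. -/
theorem of_sum {ι : Type*} [Fintype ι] {F : ℝ → X} {t₀ : ℝ} {f : ι → ℝ → ℝ}
    (hf : ∀ i, IsHOneCurveAt (f i) t₀) {C : ℝ} (hC : 0 ≤ C)
    {U : Set ℝ} (hU : U ∈ 𝓝[Icc 0 1] t₀)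
    (hF : ∀ s ∈ U, ∀ t ∈ U, dist (F s) (F t) ≤ C * ∑ i, dist (f i s) (f i t)) :
    IsHOneCurveAt F t₀ := by
  choose g hg hg0 V hV hd using hf
  refine ⟨fun r => C * ∑ i, g i r, (memLp_finsetSum _ fun i _ => hg i).const_mul _,
    fun r => mul_nonneg hC (Finset.sum_nonneg fun i _ => hg0 i r), U ∩ ⋂ i, V i,
    inter_mem hU (iInter_mem.2 hV), fun s hs t ht h0 hst h1 => ?_⟩
  have hs1 : s ∈ Icc (0 : ℝ) 1 := ⟨h0, hst.trans h1⟩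
  have ht1 : t ∈ Icc (0 : ℝ) 1 := ⟨h0.trans hst, h1⟩
  rw [intervalIntegral.integral_const_mul, intervalIntegral.integral_finsetSum
    fun i _ => intervalIntegrable_of_memLp_Icc (hg i) hs1 ht1]
  refine (hF s hs.1 t ht.1).trans (mul_le_mul_of_nonneg_left (Finset.sum_le_sum fun i _ => ?_) hC)
  exact hd i s (mem_iInter.1 hs.2 i) t (mem_iInter.1 ht.2 i) h0 hst h1

end IsHOneCurveAt

/-- A curve that is locally `H¹` on `[0,1]` is so globally, with one bounding function. -/
theorem exists_dist_le_integral {F : ℝ → X} (h : ∀ t₀ ∈ Icc (0 : ℝ) 1, IsHOneCurveAt F t₀) :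
    ∃ g : ℝ → ℝ, MemLp g 2 (volume.restrict (Icc (0 : ℝ) 1)) ∧ 0 ≤ g ∧
      ∀ s t, 0 ≤ s → s ≤ t → t ≤ 1 → dist (F s) (F t) ≤ ∫ r in s..t, g r := by
  choose! g hg hg0 U hU hd using h
  have hU' : ∀ t₀ ∈ Icc (0 : ℝ) 1, ∃ V ∈ 𝓝 t₀, V ∩ Icc 0 1 ⊆ U t₀ := fun t₀ ht₀ =>
    mem_nhdsWithin_iff_exists_mem_nhds_inter.1 (hU t₀ ht₀)
  choose! V hV hVU using hU'
  obtain ⟨T, hT, hcov⟩ := isCompact_Icc.elim_nhds_subcover (fun t => interior (V t))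
    (s := Icc (0 : ℝ) 1) fun t ht => interior_mem_nhds.2 (hV t ht)
  obtain ⟨δ, hδ, hL⟩ := lebesgue_number_lemma_of_metric (s := Icc (0 : ℝ) 1)
    (c := fun t : T => interior (V t)) isCompact_Icc (fun _ => isOpen_interior)
    (fun x hx => by
      obtain ⟨t, ht, hx⟩ := mem_iUnion₂.1 (hcov hx)
      exact mem_iUnion.2 ⟨⟨t, ht⟩, hx⟩)
  have hgm : MemLp (fun r => ∑ t ∈ T, g t r) 2 (volume.restrict (Icc (0 : ℝ) 1)) :=
    memLp_finsetSum _ fun t ht => hg t (hT t ht)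
  refine ⟨_, hgm, fun r => Finset.sum_nonneg fun t ht => hg0 t (hT t ht) r, ?_⟩
  have hsmall : ∀ s t, 0 ≤ s → s ≤ t → t ≤ 1 → t - s < δ →
      dist (F s) (F t) ≤ ∫ r in s..t, ∑ t ∈ T, g t r := by
    intro s t h0 hst h1 hlt
    have hs1 : s ∈ Icc (0 : ℝ) 1 := ⟨h0, hst.trans h1⟩
    have ht1 : t ∈ Icc (0 : ℝ) 1 := ⟨h0.trans hst, h1⟩
    obtain ⟨⟨τ, hτ⟩, hb⟩ := hL s hs1
    have hsU : s ∈ U τ := hVU τ (hT τ hτ)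
      ⟨interior_subset (hb (Metric.mem_ball_self hδ)), hs1⟩
    have htU : t ∈ U τ := hVU τ (hT τ hτ) ⟨interior_subset (hb (by
      rw [Metric.mem_ball, Real.dist_eq, abs_of_nonneg (by linarith)]; exact hlt)), ht1⟩
    refine (hd τ (hT τ hτ) s hsU t htU h0 hst h1).trans ?_
    refine intervalIntegral.integral_mono_on hst
      (intervalIntegrable_of_memLp_Icc (hg τ (hT τ hτ)) hs1 ht1)
      (intervalIntegrable_of_memLp_Icc hgm hs1 ht1) fun r _ => ?_
    exact Finset.single_le_sum (f := fun t => g t r) (fun i hi => hg0 i (hT i hi) r) hτ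
  have hind : ∀ n : ℕ, ∀ s t, 0 ≤ s → s ≤ t → t ≤ 1 → t - s ≤ n * (δ / 2) →
      dist (F s) (F t) ≤ ∫ r in s..t, ∑ t ∈ T, g t r := by
    intro n
    induction n with
    | zero =>
      intro s t h0 hst h1 hn
      exact hsmall s t h0 hst h1 (by simp at hn; linarith)
    | succ n ih =>
      intro s t h0 hst h1 hn
      push_cast at hn
      by_cases hc : t - s < δ
      · exact hsmall s t h0 hst h1 hc
      · have h2 := hsmall s (s + δ / 2) h0 (by linarith) (by linarith) (by linarith)
        have h3 := ih (s + δ / 2) t (by linarith) (by linarith) h1 (by linarith)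
        have h4 := intervalIntegral.integral_add_adjacent_intervals
          (intervalIntegrable_of_memLp_Icc hgm (s := s) (t := s + δ / 2) ⟨h0, by linarith⟩
            ⟨by linarith, by linarith⟩)
          (intervalIntegrable_of_memLp_Icc hgm (s := s + δ / 2) (t := t)
            ⟨by linarith, by linarith⟩ ⟨by linarith, h1⟩)
        rw [← h4]
        exact (dist_triangle _ (F (s + δ / 2)) _).trans (add_le_add h2 h3)
  intro s t h0 hst h1
  obtain ⟨n, hn⟩ := exists_nat_ge ((t - s) / (δ / 2))
  exact hind n s t h0 hst h1 ((div_le_iff₀ (by linarith)).1 hn)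

/-- By Lebesgue differentiation, the bounding function also bounds the derivative. -/
theorem ae_deriv_abs_le_of_dist_le_integral {F g : ℝ → ℝ}
    (hg : MemLp g 2 (volume.restrict (Icc (0 : ℝ) 1)))
    (h : ∀ s t, 0 ≤ s → s ≤ t → t ≤ 1 → dist (F s) (F t) ≤ ∫ r in s..t, g r) :
    ∀ᵐ t ∂(volume.restrict (Icc (0 : ℝ) 1)), ‖deriv F t‖ ≤ ‖g t‖ := by
  have hae : ∀ᵐ t ∂(volume.restrict (Icc (0 : ℝ) 1)),
      HasDerivAt (fun t => ∫ r in (0 : ℝ)..t, g r) (g t) t := by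
    have h1 := (intervalIntegrable_of_memLp_Icc hg (s := 0) (t := 1) (by simp)
      (by simp)).ae_hasDerivAt_integral
    rw [ae_restrict_iff' measurableSet_Icc]
    filter_upwards [h1] with t ht ht1
    exact ht (by simpa using ht1) 0 (by simp)
  filter_upwards [ae_restrict_Icc hae] with t ⟨ht, hd⟩
  by_cases hF : DifferentiableAt ℝ F t
  · have h1 := (hasDerivAt_iff_tendsto_slope.1 hF.hasDerivAt).mono_left
      (nhdsWithin_mono t fun x (hx : x ∈ Ioi t) => hx.ne')
    have h2 := (hasDerivAt_iff_tendsto_slope.1 hd).mono_left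
      (nhdsWithin_mono t fun x (hx : x ∈ Ioi t) => hx.ne')
    refine (le_of_tendsto_of_tendsto h1.norm h2 ?_).trans (Real.le_norm_self _)
    filter_upwards [Ioo_mem_nhdsGT ht.2] with s hs
    have h3 := h t s ht.1.le hs.1.le hs.2.le
    have ht1 : t ∈ Icc (0 : ℝ) 1 := ⟨ht.1.le, ht.2.le⟩
    have hs1 : s ∈ Icc (0 : ℝ) 1 := ⟨ht.1.le.trans hs.1.le, hs.2.le⟩
    rw [slope_def_field, slope_def_field, norm_div, intervalIntegral.integral_interval_sub_left
      (intervalIntegrable_of_memLp_Icc hg (by simp) hs1)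
      (intervalIntegrable_of_memLp_Icc hg (by simp) ht1), Real.norm_of_nonneg (sub_pos.2 hs.1).le]
    rw [dist_comm, dist_eq_norm] at h3
    exact div_le_div_of_nonneg_right h3 (sub_pos.2 hs.1).le
  · rw [deriv_zero_of_not_differentiableAt hF, norm_zero]
    exact norm_nonneg _

/-- For real-valued functions, the bound of the increments by a square-integrable function gives
absolute continuity and a square-integrable derivative. -/
theorem isHOne_of_dist_le_integral {F g : ℝ → ℝ}
    (hg : MemLp g 2 (volume.restrict (Icc (0 : ℝ) 1)))
    (h : ∀ s t, 0 ≤ s → s ≤ t → t ≤ 1 → dist (F s) (F t) ≤ ∫ r in s..t, g r) :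
    AbsolutelyContinuousOnInterval F 0 1 ∧
      MemLp (deriv F) 2 (volume.restrict (Icc (0 : ℝ) 1)) := by
  have hgi := intervalIntegrable_of_memLp_Icc hg (s := 0) (t := 1) (by simp) (by simp)
  refine ⟨?_, hg.of_le (measurable_deriv F).aestronglyMeasurable
    (ae_deriv_abs_le_of_dist_le_integral hg h)⟩
  have h1 := hgi.absolutelyContinuousOnInterval_intervalIntegral (c := 0) (by simp)
  refine squeeze_zero' (Eventually.of_forall fun E => Finset.sum_nonneg fun i _ => dist_nonneg) ?_ h1
  filter_upwards [mem_inf_of_right (mem_principal_self _)] with E hE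
  refine Finset.sum_le_sum fun i hi => ?_
  have h2 := hE.1 i hi
  rw [uIcc_of_le zero_le_one] at h2
  have key : ∀ s t, s ∈ Icc (0 : ℝ) 1 → t ∈ Icc (0 : ℝ) 1 → s ≤ t →
      dist (F s) (F t) ≤ dist (∫ r in (0 : ℝ)..s, g r) (∫ r in (0 : ℝ)..t, g r) := by
    intro s t hs ht hst
    refine (h s t hs.1 hst ht.2).trans ?_
    rw [dist_comm, Real.dist_eq, intervalIntegral.integral_interval_sub_left
      (intervalIntegrable_of_memLp_Icc hg (by simp) ht)
      (intervalIntegrable_of_memLp_Icc hg (by simp) hs)]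
    exact le_abs_self _
  rcases le_total (E.2 i).1 (E.2 i).2 with h3 | h3
  · exact key _ _ h2.1 h2.2 h3
  · rw [dist_comm, dist_comm (∫ r in (0 : ℝ).._, g r)]
    exact key _ _ h2.2 h2.1 h3

theorem isHOneCurveAt_of_absolutelyContinuous {F : ℝ → ℝ}
    (h : AbsolutelyContinuousOnInterval F 0 1)
    (h' : MemLp (deriv F) 2 (volume.restrict (Icc (0 : ℝ) 1))) (t₀ : ℝ) : IsHOneCurveAt F t₀ := by
  refine ⟨fun r => ‖deriv F r‖, h'.norm, fun r => norm_nonneg _, univ, univ_mem,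
    fun s _ t _ h0 hst h1 => ?_⟩
  have h2 : AbsolutelyContinuousOnInterval F s t := h.mono (by
    rw [uIcc_of_le hst, uIcc_of_le zero_le_one]; exact Icc_subset_Icc h0 h1)
  rw [dist_comm, dist_eq_norm, ← h2.integral_deriv_eq_sub]
  exact intervalIntegral.norm_integral_le_integral_norm hst

theorem isHOneCurveAt_primI {W : Type*} [NormedAddCommGroup W] [InnerProductSpace ℝ W]
    [CompleteSpace W] (u : L2I W) (t₀ : ℝ) :
    IsHOneCurveAt (fun t => primI W u (projI t)) t₀ := by
  refine ⟨fun r => ‖u r‖, (Lp.memLp u).norm, fun r => norm_nonneg _, univ, univ_mem,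
    fun s _ t _ h0 hst h1 => ?_⟩
  have hs1 : s ∈ Icc (0 : ℝ) 1 := ⟨h0, hst.trans h1⟩
  have ht1 : t ∈ Icc (0 : ℝ) 1 := ⟨h0.trans hst, h1⟩
  rw [dist_comm, dist_eq_norm]
  beta_reduce
  rw [projI_of_mem hs1, projI_of_mem ht1, primI_apply, primI_apply,
    intervalIntegral.integral_interval_sub_left (intervalIntegrable_L2I u (by simp) ht1)
      (intervalIntegrable_L2I u (by simp) hs1)]
  exact intervalIntegral.norm_integral_le_integral_norm hst

end HOneCurves

/-! ### A chart of the Lie group at the identity -/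

section LogarithmicChart

attribute [-instance] Bundle.instNormedAddCommGroupOfRiemannianBundleOfIsTopologicalAddGroupOfContinuousConstSMulReal
  Bundle.instInnerProductSpaceReal

variable {E : Type*} [NormedAddCommGroup E] [NormedSpace ℝ E]
  {G : Type*} [TopologicalSpace G] [ChartedSpace E G] [Group G] [LieGroup 𝓘(ℝ, E) ∞ G]
  {W : Type*} [NormedAddCommGroup W] [NormedSpace ℝ W] (ι : W ≃L[ℝ] E)

/-- A chart of the Lie group `G` at the identity, centred at `0` and taking its values in a normed
space `W` that is identified with the model space (in practice, the Lie algebra). -/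
noncomputable def unitChart (g : G) : W :=
  ι.symm (extChartAt 𝓘(ℝ, E) (1 : G) g - extChartAt 𝓘(ℝ, E) (1 : G) 1)

variable (G) in
/-- The inverse of the chart `unitChart`. -/
noncomputable def unitParam (y : W) : G :=
  (extChartAt 𝓘(ℝ, E) (1 : G)).symm (ι y + extChartAt 𝓘(ℝ, E) (1 : G) 1)

@[simp] theorem unitChart_one : unitChart ι (1 : G) = 0 := by simp [unitChart]

@[simp] theorem unitParam_zero : unitParam G ι 0 = 1 := by simp [unitParam]

theorem eventually_unitChart : ∀ᶠ g in 𝓝 (1 : G),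
    ContMDiffAt 𝓘(ℝ, E) 𝓘(ℝ, W) ∞ (unitChart ι) g ∧ unitParam G ι (unitChart ι g) = g := by
  filter_upwards [extChartAt_source_mem_nhds (I := 𝓘(ℝ, E)) (1 : G)] with g hg
  constructor
  · have h1 : ContMDiffAt 𝓘(ℝ, E) 𝓘(ℝ, E) ∞ (extChartAt 𝓘(ℝ, E) (1 : G)) g :=
      contMDiffAt_extChartAt' (by simpa using hg)
    have h2 : ContMDiff 𝓘(ℝ, E) 𝓘(ℝ, W) ∞
        (fun e : E => ι.symm (e - extChartAt 𝓘(ℝ, E) (1 : G) 1)) :=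
      (ι.symm.contDiff.comp (contDiff_id.sub contDiff_const)).contMDiff
    exact h2.contMDiffAt.comp g h1
  · simp only [unitParam, unitChart, ContinuousLinearEquiv.apply_symm_apply, sub_add_cancel]
    exact (extChartAt 𝓘(ℝ, E) (1 : G)).left_inv hg

theorem eventually_unitParam : ∀ᶠ y in 𝓝 (0 : W),
    ContMDiffAt 𝓘(ℝ, W) 𝓘(ℝ, E) ∞ (unitParam G ι) y ∧ unitChart ι (unitParam G ι y) = y := by
  have hc : Continuous fun y : W => ι y + extChartAt 𝓘(ℝ, E) (1 : G) 1 := by fun_prop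
  have h0 := hc.tendsto 0
  simp only [map_zero, zero_add] at h0
  filter_upwards [h0.eventually (extChartAt_target_mem_nhds (I := 𝓘(ℝ, E)) (1 : G))] with y hy
  constructor
  · have h1 : ContMDiffAt 𝓘(ℝ, E) 𝓘(ℝ, E) ∞ (extChartAt 𝓘(ℝ, E) (1 : G)).symm
        (ι y + extChartAt 𝓘(ℝ, E) (1 : G) 1) :=
      (contMDiffOn_extChartAt_symm (1 : G)).contMDiffAt
        ((isOpen_extChartAt_target (1 : G)).mem_nhds hy)
    have h2 : ContMDiff 𝓘(ℝ, W) 𝓘(ℝ, E) ∞ (fun y : W => ι y + extChartAt 𝓘(ℝ, E) (1 : G) 1) :=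
      (ι.contDiff.add contDiff_const).contMDiff
    exact h1.comp y h2.contMDiffAt
  · simp only [unitParam, unitChart]
    rw [(extChartAt 𝓘(ℝ, E) (1 : G)).right_inv hy, add_sub_cancel_right,
      ContinuousLinearEquiv.symm_apply_apply]

theorem contMDiffAt_unitChart_one :
    ContMDiffAt 𝓘(ℝ, E) 𝓘(ℝ, W) ∞ (unitChart ι) (1 : G) := (eventually_unitChart ι).self_of_nhds.1

theorem contMDiffAt_unitParam_zero :
    ContMDiffAt 𝓘(ℝ, W) 𝓘(ℝ, E) ∞ (unitParam G ι) 0 := (eventually_unitParam ι).self_of_nhds.1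

theorem tendsto_unitChart : Tendsto (unitChart ι) (𝓝 (1 : G)) (𝓝 0) := by
  simpa using (contMDiffAt_unitChart_one ι).continuousAt.tendsto (x := (1 : G))

theorem tendsto_unitParam : Tendsto (unitParam G ι) (𝓝 0) (𝓝 1) := by
  simpa using (contMDiffAt_unitParam_zero (G := G) ι).continuousAt.tendsto (x := (0 : W))

theorem hasMFDerivAt_unitParam_zero :
    HasMFDerivAt 𝓘(ℝ, W) 𝓘(ℝ, E) (unitParam G ι) 0
      (ι : W →L[ℝ] E) := by
  have h2 : HasFDerivAt (fun y : W => ι y + extChartAt 𝓘(ℝ, E) (1 : G) 1) (ι : W →L[ℝ] E) 0 :=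
    ι.hasFDerivAt.add_const _
  have h1 : HasMFDerivAt 𝓘(ℝ, E) 𝓘(ℝ, E) (extChartAt 𝓘(ℝ, E) (1 : G)).symm
      (ι 0 + extChartAt 𝓘(ℝ, E) (1 : G) 1) (ContinuousLinearMap.id ℝ E) := by
    rw [map_zero, zero_add]
    have h3 := mfderivWithin_range_extChartAt_symm (I := 𝓘(ℝ, E)) (x := (1 : G))
    rw [ModelWithCorners.range_eq_univ, mfderivWithin_univ] at h3
    have h4 : MDifferentiableAt 𝓘(ℝ, E) 𝓘(ℝ, E) (extChartAt 𝓘(ℝ, E) (1 : G)).symm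
        (extChartAt 𝓘(ℝ, E) (1 : G) 1) :=
      ((contMDiffOn_extChartAt_symm (n := ∞) (1 : G)).contMDiffAt
        (extChartAt_target_mem_nhds (1 : G))).mdifferentiableAt (by simp)
    have h5 := h4.hasMFDerivAt
    rw [h3] at h5
    exact h5
  exact h1.comp (0 : W) h2.hasMFDerivAt

theorem hasMFDerivAt_unitChart_one :
    HasMFDerivAt 𝓘(ℝ, E) 𝓘(ℝ, W) (unitChart ι) (1 : G)
      (ι.symm : E →L[ℝ] W) := by
  have h2 : HasFDerivAt (fun e : E => ι.symm (e - extChartAt 𝓘(ℝ, E) (1 : G) 1))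
      (ι.symm : E →L[ℝ] W) (extChartAt 𝓘(ℝ, E) (1 : G) 1) :=
    ι.symm.hasFDerivAt.comp _ ((hasFDerivAt_id _).sub_const _)
  have h1 : HasMFDerivAt 𝓘(ℝ, E) 𝓘(ℝ, E) (extChartAt 𝓘(ℝ, E) (1 : G)) (1 : G)
      (ContinuousLinearMap.id ℝ E) := by
    have h3 := mfderiv_extChartAt_self (I := 𝓘(ℝ, E)) (x := (1 : G))
    have h5 := (mdifferentiableAt_extChartAt (I := 𝓘(ℝ, E)) (mem_chart_source E (1 : G))).hasMFDerivAt
    rw [h3] at h5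
    exact h5
  exact h2.hasMFDerivAt.comp (1 : G) h1

variable {X : Type*} [NormedAddCommGroup X] [NormedSpace ℝ X]

theorem contDiffAt_unitChart_comp {f : X → G} {x₀ : X}
    (hf : ContMDiffAt 𝓘(ℝ, X) 𝓘(ℝ, E) ∞ f x₀) (h1 : f x₀ = 1) :
    ContDiffAt ℝ ∞ (fun x => unitChart ι (f x)) x₀ := by
  rw [← contMDiffAt_iff_contDiffAt]
  exact ContMDiffAt.comp x₀ (g := unitChart ι) (by rw [h1]; exact contMDiffAt_unitChart_one ι) hf

/-- A smooth map into `G` with value `1` at `x₀` is smooth in the chart, at all points near `x₀`. -/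
theorem eventually_contDiffAt_unitChart_comp {f : X → G} {x₀ : X}
    (hf : ∀ᶠ x in 𝓝 x₀, ContMDiffAt 𝓘(ℝ, X) 𝓘(ℝ, E) ∞ f x) (h1 : f x₀ = 1) :
    ∀ᶠ x in 𝓝 x₀, ContDiffAt ℝ ∞ (fun x => unitChart ι (f x)) x ∧
      unitParam G ι (unitChart ι (f x)) = f x := by
  have h2 : Tendsto f (𝓝 x₀) (𝓝 1) := by
    have := hf.self_of_nhds.continuousAt.tendsto
    rwa [h1] at this
  filter_upwards [hf, h2.eventually (eventually_unitChart ι)] with x hx hx'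
  refine ⟨?_, hx'.2⟩
  rw [← contMDiffAt_iff_contDiffAt]
  exact ContMDiffAt.comp (g := unitChart ι) x hx'.1 hx

end LogarithmicChart

/-! ### The adjoint action and logarithmic derivatives -/

section AdjointAction

attribute [-instance] Bundle.instNormedAddCommGroupOfRiemannianBundleOfIsTopologicalAddGroupOfContinuousConstSMulReal
  Bundle.instInnerProductSpaceReal

variable {E : Type*} [NormedAddCommGroup E] [NormedSpace ℝ E]
  {G : Type*} [TopologicalSpace G] [ChartedSpace E G] [Group G] [LieGroup 𝓘(ℝ, E) ∞ G]
  {W : Type*} [NormedAddCommGroup W] [NormedSpace ℝ W] (ι : W ≃L[ℝ] E)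
  {X : Type*} [NormedAddCommGroup X] [NormedSpace ℝ X]

variable (G) in
theorem contMDiffAt_unitParam_comp {f : X → W} {x₀ : X}
    (hf : ContDiffAt ℝ ∞ f x₀) (h : f x₀ = 0) :
    ContMDiffAt 𝓘(ℝ, X) 𝓘(ℝ, E) ∞ (fun x => unitParam G ι (f x)) x₀ :=
  ContMDiffAt.comp (g := unitParam G ι) x₀ (by rw [h]; exact contMDiffAt_unitParam_zero ι)
    hf.contMDiffAt

variable (G) in
theorem eventually_contMDiffAt_unitParam_comp (f : X →L[ℝ] W) :
    ∀ᶠ x in 𝓝 (0 : X), ContMDiffAt 𝓘(ℝ, X) 𝓘(ℝ, E) ∞ (fun x => unitParam G ι (f x)) x := by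
  have h0 : Tendsto f (𝓝 0) (𝓝 0) := by simpa using f.continuous.tendsto 0
  filter_upwards [h0.eventually (eventually_unitParam (G := G) ι)] with x hx
  exact ContMDiffAt.comp (g := unitParam G ι) x hx.1 f.contDiff.contDiffAt.contMDiffAt

/-- The adjoint action of the group element `g`: the differential at the identity of the conjugation
by `g`, read in the chart `unitChart`. -/
noncomputable def adjointAction (g : G) : W →L[ℝ] W :=
  fderiv ℝ (fun y => unitChart ι (g * unitParam G ι y * g⁻¹)) 0

theorem hasFDerivAt_conj (g : G) :
    HasFDerivAt (fun y => unitChart ι (g * unitParam G ι y * g⁻¹)) (adjointAction ι g) 0 := by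
  refine (ContDiffAt.differentiableAt (n := ∞) ?_ (by simp)).hasFDerivAt
  refine contDiffAt_unitChart_comp ι ?_ (by simp)
  exact (contMDiffAt_const.mul (contMDiffAt_unitParam_zero ι)).mul contMDiffAt_const

theorem eventually_unitParam_unitChart_comp [TopologicalSpace X] {f : X → G} {x₀ : X}
    (hf : ContinuousAt f x₀) (h1 : f x₀ = 1) :
    ∀ᶠ x in 𝓝 x₀, unitParam G ι (unitChart ι (f x)) = f x := by
  have h2 : Tendsto f (𝓝 x₀) (𝓝 1) := by
    have := hf.tendsto
    rwa [h1] at this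
  filter_upwards [h2.eventually (eventually_unitChart ι)] with x hx using hx.2

@[simp] theorem adjointAction_one : adjointAction ι (1 : G) = ContinuousLinearMap.id ℝ W := by
  refine (hasFDerivAt_conj ι (1 : G)).unique ((hasFDerivAt_id (0 : W)).congr_of_eventuallyEq ?_)
  filter_upwards [eventually_unitParam (G := G) ι] with y hy
  simp [hy.2]

theorem adjointAction_mul (g h : G) :
    adjointAction ι (g * h) = (adjointAction ι g).comp (adjointAction ι h) := by
  have h1 := hasFDerivAt_conj ι h
  have h2 : HasFDerivAt (fun y => unitChart ι (g * unitParam G ι y * g⁻¹)) (adjointAction ι g)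
      (unitChart ι (h * unitParam G ι 0 * h⁻¹)) := by
    simpa using hasFDerivAt_conj ι g
  refine (hasFDerivAt_conj ι (g * h)).unique ((h2.comp (0 : W) h1).congr_of_eventuallyEq ?_)
  have hc : ContinuousAt (fun y => h * unitParam G ι y * h⁻¹) (0 : W) :=
    ((contMDiffAt_const (n := ∞)).mul (contMDiffAt_unitParam_zero ι)).mul
      contMDiffAt_const |>.continuousAt
  filter_upwards [eventually_unitParam_unitChart_comp ι hc (by simp)] with y hy
  simp only [Function.comp_apply, hy]
  congr 1
  group

theorem adjointAction_mul_apply (g h : G) (w : W) :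
    adjointAction ι (g * h) w = adjointAction ι g (adjointAction ι h w) := by
  rw [adjointAction_mul]; rfl

theorem adjointAction_inv_apply (g : G) (w : W) :
    adjointAction ι g⁻¹ (adjointAction ι g w) = w := by
  rw [← adjointAction_mul_apply]; simp

theorem adjointAction_apply_inv (g : G) (w : W) :
    adjointAction ι g (adjointAction ι g⁻¹ w) = w := by
  rw [← adjointAction_mul_apply]; simp

/-- The adjoint action is smooth near the identity, as a partial derivative of a smooth map. -/
theorem eventually_contDiffAt_adjointAction_unitParam :
    ∀ᶠ x in 𝓝 (0 : W), ContDiffAt ℝ ∞ (fun x => adjointAction ι (unitParam G ι x)) x := by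
  have h1 : ∀ᶠ p in 𝓝 (0 : W × W), ContMDiffAt 𝓘(ℝ, W × W) 𝓘(ℝ, E) ∞
      (fun p => unitParam G ι p.1 * unitParam G ι p.2 * (unitParam G ι p.1)⁻¹) p := by
    filter_upwards [eventually_contMDiffAt_unitParam_comp G ι (ContinuousLinearMap.fst ℝ W W),
      eventually_contMDiffAt_unitParam_comp G ι (ContinuousLinearMap.snd ℝ W W)] with p hp hq
    exact (hp.mul hq).mul hp.inv
  have h2 := eventually_contDiffAt_unitChart_comp ι h1 (by simp)
  have h3 : Tendsto (fun x : W => (x, (0 : W))) (𝓝 0) (𝓝 0) := by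
    have : Continuous fun x : W => (x, (0 : W)) := by fun_prop
    exact this.tendsto 0
  filter_upwards [h3.eventually h2] with x hx
  exact ContDiffAt.fderiv (n := ∞)
    (f := fun x y => unitChart ι (unitParam G ι x * unitParam G ι y * (unitParam G ι x)⁻¹))
    (g := fun _ => 0) hx.1 contDiffAt_const (by simp)

variable [IsTopologicalGroup G]

theorem continuous_adjointAction : Continuous (adjointAction ι : G → W →L[ℝ] W) := by
  rw [continuous_iff_continuousAt]
  intro g₀
  have h1 : ContinuousAt (adjointAction ι : G → W →L[ℝ] W) 1 := by
    have h2 : ContinuousAt (fun g : G => adjointAction ι (unitParam G ι (unitChart ι g))) 1 := by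
      have h3 := (eventually_contDiffAt_adjointAction_unitParam (G := G) ι).self_of_nhds.continuousAt
      exact ContinuousAt.comp (f := unitChart ι) (x := (1 : G)) (by rw [unitChart_one]; exact h3)
        (contMDiffAt_unitChart_one ι).continuousAt
    refine h2.congr ?_
    filter_upwards [eventually_unitChart (G := G) ι] with g hg
    rw [hg.2]
  have h4 : ContinuousAt (fun g : G => (adjointAction ι (g * g₀⁻¹)).comp (adjointAction ι g₀)) g₀ := by
    have h5 : ContinuousAt (fun g : G => adjointAction ι (g * g₀⁻¹)) g₀ :=
      ContinuousAt.comp (f := fun g : G => g * g₀⁻¹) (g := adjointAction ι) (by rw [mul_inv_cancel]; exact h1) (by fun_prop)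
    exact ((ContinuousLinearMap.compL ℝ W W W).flip (adjointAction ι g₀)).continuous.continuousAt.comp
      h5
  refine h4.congr (Eventually.of_forall fun g => ?_)
  beta_reduce
  rw [← adjointAction_mul, inv_mul_cancel_right]

end AdjointAction

section LogarithmicDerivative

attribute [-instance] Bundle.instNormedAddCommGroupOfRiemannianBundleOfIsTopologicalAddGroupOfContinuousConstSMulReal
  Bundle.instInnerProductSpaceReal

variable {E : Type*} [NormedAddCommGroup E] [NormedSpace ℝ E]
  {G : Type*} [TopologicalSpace G] [ChartedSpace E G] [Group G] [LieGroup 𝓘(ℝ, E) ∞ G]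
  {W : Type*} [NormedAddCommGroup W] [NormedSpace ℝ W] (ι : W ≃L[ℝ] E) [IsTopologicalGroup G]

/-- The curve `γ` has the right logarithmic derivative `u` at `t`. -/
def HasLogDerivAt (γ : ℝ → G) (u : W) (t : ℝ) : Prop :=
  ContinuousAt γ t ∧ HasDerivAt (fun s => unitChart ι (γ s * (γ t)⁻¹)) u t

/-- The logarithmic derivative `u` expresses that the velocity is the right translate of `u`. -/
theorem hasLogDerivAt_iff {γ : ℝ → G} {u : W} {t : ℝ} :
    HasLogDerivAt ι γ u t ↔ HasMFDerivAt 𝓘(ℝ, ℝ) 𝓘(ℝ, E) γ t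
      (ContinuousLinearMap.toSpanSingleton ℝ
        (mfderiv 𝓘(ℝ, E) 𝓘(ℝ, E) (fun x : G => x * γ t) (1 : G) (ι u) : E)) := by
  have hR : HasMFDerivAt 𝓘(ℝ, E) 𝓘(ℝ, E) (fun x : G => x * γ t) (1 : G)
      (mfderiv 𝓘(ℝ, E) 𝓘(ℝ, E) (fun x : G => x * γ t) (1 : G)) :=
    ((contMDiff_mul_right (I := 𝓘(ℝ, E)) (n := ∞) (a := γ t)).mdifferentiable (by simp)
      1).hasMFDerivAt
  constructor
  · rintro ⟨hc, hd⟩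
    have h1 : HasMFDerivAt 𝓘(ℝ, W) 𝓘(ℝ, E) (fun y => unitParam G ι y * γ t) 0
        ((mfderiv 𝓘(ℝ, E) 𝓘(ℝ, E) (fun x : G => x * γ t) (1 : G) : E →L[ℝ] E).comp
          (ι : W →L[ℝ] E)) :=
      HasMFDerivAt.comp (g := fun x : G => x * γ t) (f := unitParam G ι) (0 : W)
        (by rw [unitParam_zero]; exact hR) (hasMFDerivAt_unitParam_zero ι)
    have h2 : HasMFDerivAt 𝓘(ℝ, ℝ) 𝓘(ℝ, E)
        ((fun y => unitParam G ι y * γ t) ∘ fun s => unitChart ι (γ s * (γ t)⁻¹)) t _ :=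
      HasMFDerivAt.comp t (by rw [mul_inv_cancel, unitChart_one]; exact h1)
        hd.hasFDerivAt.hasMFDerivAt
    refine (h2.congr_of_eventuallyEq ?_).congr_mfderiv ?_
    · filter_upwards [eventually_unitParam_unitChart_comp (X := ℝ) ι
        (f := fun s => γ s * (γ t)⁻¹) (by fun_prop) (by simp)] with s hs
      simp only [Function.comp_apply, hs, inv_mul_cancel_right]
    · refine ContinuousLinearMap.ext fun (r : ℝ) => ?_
      let L : E →L[ℝ] E := mfderiv 𝓘(ℝ, E) 𝓘(ℝ, E) (fun x : G => x * γ t) (1 : G)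
      show L (ι (r • u)) = r • L (ι u)
      rw [map_smul, map_smul]
  · intro h
    refine ⟨h.continuousAt, ?_⟩
    have h1 : HasMFDerivAt 𝓘(ℝ, E) 𝓘(ℝ, W) (fun g : G => unitChart ι (g * (γ t)⁻¹)) (γ t)
        (mfderiv 𝓘(ℝ, E) 𝓘(ℝ, W) (fun g : G => unitChart ι (g * (γ t)⁻¹)) (γ t)) := by
      refine (ContMDiffAt.mdifferentiableAt (n := ∞) ?_ (by simp)).hasMFDerivAt
      refine ContMDiffAt.comp (g := unitChart ι) (f := fun g : G => g * (γ t)⁻¹) (γ t) ?_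
        (contMDiff_mul_right.contMDiffAt)
      rw [mul_inv_cancel]
      exact contMDiffAt_unitChart_one ι
    have h2 := h1.comp t h
    have h3 : HasMFDerivAt 𝓘(ℝ, E) 𝓘(ℝ, W)
      ((fun g : G => unitChart ι (g * (γ t)⁻¹)) ∘ fun x : G => x * γ t) (1 : G) _ :=
      HasMFDerivAt.comp (1 : G) (by rw [one_mul]; exact h1) hR
    have h4 : HasMFDerivAt 𝓘(ℝ, E) 𝓘(ℝ, W)
        ((fun g : G => unitChart ι (g * (γ t)⁻¹)) ∘ fun x : G => x * γ t) (1 : G)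
        (ι.symm : E →L[ℝ] W) := by
      refine (hasMFDerivAt_unitChart_one ι).congr_of_eventuallyEq (Eventually.of_forall fun x => ?_)
      simp
    have h5 := congrArg (fun L : E →L[ℝ] W => L (ι u)) (hasMFDerivAt_unique h3 h4)
    let L : E →L[ℝ] E := mfderiv 𝓘(ℝ, E) 𝓘(ℝ, E) (fun x : G => x * γ t) (1 : G)
    let L' : E →L[ℝ] W :=
      mfderiv 𝓘(ℝ, E) 𝓘(ℝ, W) (fun g : G => unitChart ι (g * (γ t)⁻¹)) (γ t)
    have h7 : L' (L (ι u)) = u := (show L' (L (ι u)) = ι.symm (ι u) from h5).trans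
      (ι.symm_apply_apply u)
    have h6 : HasFDerivAt ((fun g : G => unitChart ι (g * (γ t)⁻¹)) ∘ γ)
        (L'.comp (ContinuousLinearMap.toSpanSingleton ℝ (L (ι u)))) t := h2.hasFDerivAt
    refine h6.hasDerivAt.congr_deriv ?_
    show L' ((1 : ℝ) • L (ι u)) = u
    rw [one_smul, h7]

/-- The product rule for right logarithmic derivatives. -/
theorem HasLogDerivAt.mul {γ δ : ℝ → G} {u v : W} {t : ℝ} (hγ : HasLogDerivAt ι γ u t)
    (hδ : HasLogDerivAt ι δ v t) :
    HasLogDerivAt ι (fun s => γ s * δ s) (u + adjointAction ι (γ t) v) t := by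
  refine ⟨hγ.1.mul hδ.1, ?_⟩
  set a := γ t with ha
  let m : W × W → W := fun p => unitChart ι (unitParam G ι p.1 * (a * unitParam G ι p.2 * a⁻¹))
  have hm : ContDiffAt ℝ ∞ m 0 := by
    refine contDiffAt_unitChart_comp ι ?_ (by simp)
    have h1 := (eventually_contMDiffAt_unitParam_comp G ι
      (ContinuousLinearMap.fst ℝ W W)).self_of_nhds
    have h2 := (eventually_contMDiffAt_unitParam_comp G ι
      (ContinuousLinearMap.snd ℝ W W)).self_of_nhds
    exact h1.mul ((contMDiffAt_const.mul h2).mul contMDiffAt_const)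
  have hD := (hm.differentiableAt (by simp)).hasFDerivAt
  have hD1 : (fderiv ℝ m 0).comp (ContinuousLinearMap.inl ℝ W W) = ContinuousLinearMap.id ℝ W := by
    have h1 : HasFDerivAt (m ∘ ContinuousLinearMap.inl ℝ W W) _ 0 :=
      HasFDerivAt.comp (0 : W) (by rw [map_zero]; exact hD)
        (ContinuousLinearMap.inl ℝ W W).hasFDerivAt
    refine h1.unique ((hasFDerivAt_id (0 : W)).congr_of_eventuallyEq ?_)
    filter_upwards [eventually_unitParam (G := G) ι] with y hy
    simp [m, hy.2]
  have hD2 : (fderiv ℝ m 0).comp (ContinuousLinearMap.inr ℝ W W) = adjointAction ι a := by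
    have h1 : HasFDerivAt (m ∘ ContinuousLinearMap.inr ℝ W W) _ 0 :=
      HasFDerivAt.comp (0 : W) (by rw [map_zero]; exact hD)
        (ContinuousLinearMap.inr ℝ W W).hasFDerivAt
    refine h1.unique ((hasFDerivAt_conj ι a).congr_of_eventuallyEq ?_)
    exact Eventually.of_forall fun y => by simp [m]
  have hc := hγ.2.prodMk hδ.2
  have h1 := HasFDerivAt.comp_hasDerivAt t (l := m) (l' := fderiv ℝ m 0)
    (f := fun s => (unitChart ι (γ s * (γ t)⁻¹), unitChart ι (δ s * (δ t)⁻¹)))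
    (by simp only [mul_inv_cancel, unitChart_one]; exact hD) hc
  have h2 : fderiv ℝ m 0 (u, v) = u + adjointAction ι a v := by
    rw [← hD2, show (u, v) = ContinuousLinearMap.inl ℝ W W u + ContinuousLinearMap.inr ℝ W W v by
      simp, map_add, ← ContinuousLinearMap.comp_apply, hD1]
    rfl
  rw [← h2]
  refine h1.congr_of_eventuallyEq ?_
  have hγc := hγ.1
  have hδc := hδ.1
  filter_upwards [eventually_unitParam_unitChart_comp (X := ℝ) ι
      (f := fun s => γ s * (γ t)⁻¹) (by fun_prop) (by simp),
    eventually_unitParam_unitChart_comp (X := ℝ) ι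
      (f := fun s => δ s * (δ t)⁻¹) (by fun_prop) (by simp)] with s hs hs'
  simp only [Function.comp_apply, m, hs, hs']
  congr 1
  simp only [ha]
  group

/-- The quotient `γ⁻¹ δ` of two curves with the same logarithmic derivative has derivative zero. -/
theorem HasLogDerivAt.inv_mul {γ δ : ℝ → G} {u : W} {t : ℝ} (hγ : HasLogDerivAt ι γ u t)
    (hδ : HasLogDerivAt ι δ u t) : HasLogDerivAt ι (fun s => (γ s)⁻¹ * δ s) 0 t := by
  refine ⟨hγ.1.inv.mul hδ.1, ?_⟩
  set a := γ t with ha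
  let m : W × W → W := fun p =>
    unitChart ι (a⁻¹ * (unitParam G ι p.1)⁻¹ * unitParam G ι p.2 * a)
  have hm : ContDiffAt ℝ ∞ m 0 := by
    refine contDiffAt_unitChart_comp ι ?_ (by simp)
    have h1 := (eventually_contMDiffAt_unitParam_comp G ι
      (ContinuousLinearMap.fst ℝ W W)).self_of_nhds
    have h2 := (eventually_contMDiffAt_unitParam_comp G ι
      (ContinuousLinearMap.snd ℝ W W)).self_of_nhds
    exact ((contMDiffAt_const.mul h1.inv).mul h2).mul contMDiffAt_const
  have hD := (hm.differentiableAt (by simp)).hasFDerivAt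
  -- the map `m` vanishes on the diagonal, hence so does its differential
  have hD1 : (fderiv ℝ m 0).comp ((ContinuousLinearMap.id ℝ W).prod (ContinuousLinearMap.id ℝ W))
      = 0 := by
    have h1 : HasFDerivAt (m ∘ ((ContinuousLinearMap.id ℝ W).prod (ContinuousLinearMap.id ℝ W))) _
      0 := HasFDerivAt.comp (0 : W) (by rw [map_zero]; exact hD)
        ((ContinuousLinearMap.id ℝ W).prod (ContinuousLinearMap.id ℝ W)).hasFDerivAt
    refine h1.unique ((hasFDerivAt_const (0 : W) (0 : W)).congr_of_eventuallyEq ?_)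
    exact Eventually.of_forall fun y => by simp [m]
  have hc := hγ.2.prodMk hδ.2
  have h1 := HasFDerivAt.comp_hasDerivAt t (l := m) (l' := fderiv ℝ m 0)
    (f := fun s => (unitChart ι (γ s * (γ t)⁻¹), unitChart ι (δ s * (δ t)⁻¹)))
    (by simp only [mul_inv_cancel, unitChart_one]; exact hD) hc
  have h2 : fderiv ℝ m 0 (u, u) = 0 := congrArg (fun L : W →L[ℝ] W => L u) hD1
  rw [h2] at h1
  refine h1.congr_of_eventuallyEq ?_
  have hγc := hγ.1
  have hδc := hδ.1
  filter_upwards [eventually_unitParam_unitChart_comp (X := ℝ) ι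
      (f := fun s => γ s * (γ t)⁻¹) (by fun_prop) (by simp),
    eventually_unitParam_unitChart_comp (X := ℝ) ι
      (f := fun s => δ s * (δ t)⁻¹) (by fun_prop) (by simp)] with s hs hs'
  simp only [Function.comp_apply, m, hs, hs']
  congr 1
  simp only [ha]
  group

end LogarithmicDerivative

/-! ### `H¹`-paths in the Lie group -/

section HOnePaths

attribute [-instance] Bundle.instNormedAddCommGroupOfRiemannianBundleOfIsTopologicalAddGroupOfContinuousConstSMulReal
  Bundle.instInnerProductSpaceReal

variable {E : Type*} [NormedAddCommGroup E] [NormedSpace ℝ E] [FiniteDimensional ℝ E]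
  {G : Type*} [TopologicalSpace G] [ChartedSpace E G] [Group G] [LieGroup 𝓘(ℝ, E) ∞ G]
  [IsTopologicalGroup G] [T2Space G] [CompactSpace G]
  {W : Type*} [NormedAddCommGroup W] [NormedSpace ℝ W] (ι : W ≃L[ℝ] E)

/-- The chart at the identity extends, from a smaller neighbourhood, to a smooth map on `G`. -/
theorem exists_contMDiff_eventuallyEq_unitChart :
    ∃ k : G → W, ContMDiff 𝓘(ℝ, E) 𝓘(ℝ, W) ∞ k ∧ k =ᶠ[𝓝 1] unitChart ι := by
  let f : SmoothBumpFunction 𝓘(ℝ, E) (1 : G) := Classical.arbitrary _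
  refine ⟨fun g => f g • unitChart ι g, f.contMDiff_smul ?_, ?_⟩
  · have h2 : ContMDiff 𝓘(ℝ, E) 𝓘(ℝ, W) ∞
        (fun e : E => ι.symm (e - extChartAt 𝓘(ℝ, E) (1 : G) 1)) :=
      (ι.symm.contDiff.comp (contDiff_id.sub contDiff_const)).contMDiff
    exact h2.comp_contMDiffOn contMDiffOn_extChartAt
  · filter_upwards [f.eventuallyEq_one] with g hg
    rw [hg, Pi.one_apply, one_smul]

/-- The `H¹`-paths in `G` are the continuous paths that are locally `H¹` curves in the translates of
the chart at the identity. -/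
theorem isH1Path_iff {γ : ℝ → G} : IsH1Path E γ ↔ ContinuousOn γ (Icc 0 1) ∧
    ∀ t₀ ∈ Icc (0 : ℝ) 1, IsHOneCurveAt (fun s => unitChart ι (γ s * (γ t₀)⁻¹)) t₀ := by
  constructor
  · rintro ⟨hc, hf⟩
    refine ⟨hc, fun t₀ ht₀ => ?_⟩
    obtain ⟨k, hk, hk1⟩ := exists_contMDiff_eventuallyEq_unitChart (G := G) ι
    have : FiniteDimensional ℝ W := ι.symm.toLinearEquiv.finiteDimensional
    let b := Module.finBasis ℝ W
    have h1 : ∀ i, IsHOneCurveAt (fun s => b.coord i (k (γ s * (γ t₀)⁻¹))) t₀ := fun i => by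
      have h2 : ContMDiff 𝓘(ℝ, E) 𝓘(ℝ, ℝ) ∞
          (fun g : G => (b.coord i).toContinuousLinearMap (k (g * (γ t₀)⁻¹))) :=
        (b.coord i).toContinuousLinearMap.contDiff.contMDiff.comp (hk.comp contMDiff_mul_right)
      obtain ⟨h3, h4⟩ := hf _ h2
      exact isHOneCurveAt_of_absolutelyContinuous h3 h4 t₀
    have h2 : IsHOneCurveAt (fun s => k (γ s * (γ t₀)⁻¹)) t₀ := by
      refine IsHOneCurveAt.of_sum h1 (C := ∑ i, ‖b i‖) (by positivity) univ_mem
        fun s _ t _ => ?_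
      rw [dist_eq_norm]
      have h3 : k (γ s * (γ t₀)⁻¹) - k (γ t * (γ t₀)⁻¹) =
          ∑ i, b.coord i (k (γ s * (γ t₀)⁻¹) - k (γ t * (γ t₀)⁻¹)) • b i :=
        (b.sum_repr _).symm
      rw [h3, Finset.mul_sum]
      refine (norm_sum_le _ _).trans (Finset.sum_le_sum fun i _ => ?_)
      rw [norm_smul, map_sub, ← dist_eq_norm, mul_comm]
      exact mul_le_mul_of_nonneg_right
        (Finset.single_le_sum (f := fun i => ‖b i‖) (fun j _ => norm_nonneg _) (Finset.mem_univ i))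
        dist_nonneg
    refine h2.congr ?_
    have h3 : Tendsto (fun s => γ s * (γ t₀)⁻¹) (𝓝[Icc 0 1] t₀) (𝓝 1) := by
      have := (hc t₀ ht₀).mul_const (γ t₀)⁻¹
      rwa [ContinuousWithinAt, mul_inv_cancel] at this
    exact h3.eventually hk1
  · rintro ⟨hc, h⟩
    refine ⟨hc, fun f hf => ?_⟩
    have h1 : ∀ t₀ ∈ Icc (0 : ℝ) 1, IsHOneCurveAt (f ∘ γ) t₀ := fun t₀ ht₀ => by
      have hc' : ContinuousWithinAt (fun s => γ s * (γ t₀)⁻¹) (Icc 0 1) t₀ :=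
        (hc t₀ ht₀).mul_const (γ t₀)⁻¹
      have h3 : Tendsto (fun s => γ s * (γ t₀)⁻¹) (𝓝[Icc 0 1] t₀) (𝓝 1) := by
        rwa [ContinuousWithinAt, mul_inv_cancel] at hc'
      have h2 : ContDiffAt ℝ ∞ (fun y => f (unitParam G ι y * γ t₀)) 0 := by
        rw [← contMDiffAt_iff_contDiffAt]
        exact hf.contMDiffAt.comp (0 : W) ((contMDiffAt_unitParam_zero ι).mul contMDiffAt_const)
      have h4 : ContinuousWithinAt (fun s => unitChart ι (γ s * (γ t₀)⁻¹)) (Icc 0 1) t₀ := by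
        rw [ContinuousWithinAt, mul_inv_cancel, unitChart_one]
        exact (tendsto_unitChart ι).comp h3
      refine ((h t₀ ht₀).contDiffAt_comp h4
        (by rw [mul_inv_cancel, unitChart_one]; exact h2)).congr ?_
      filter_upwards [h3.eventually (eventually_unitChart ι)] with s hs
      rw [hs.2, inv_mul_cancel_right, Function.comp_apply]
    obtain ⟨g, hg, -, h2⟩ := exists_dist_le_integral h1
    exact isHOne_of_dist_le_integral hg h2

/-- A continuous path, translated to the identity, is eventually in the domain of the chart. -/
theorem tendsto_unitChart_mul_inv {γ : ℝ → G} {S : Set ℝ} {t₀ : ℝ}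
    (hγ : ContinuousWithinAt γ S t₀) :
    ContinuousWithinAt (fun s => unitChart ι (γ s * (γ t₀)⁻¹)) S t₀ ∧
      ∀ᶠ s in 𝓝[S] t₀, unitParam G ι (unitChart ι (γ s * (γ t₀)⁻¹)) = γ s * (γ t₀)⁻¹ := by
  have hc' : ContinuousWithinAt (fun s => γ s * (γ t₀)⁻¹) S t₀ := hγ.mul_const (γ t₀)⁻¹
  have h3 : Tendsto (fun s => γ s * (γ t₀)⁻¹) (𝓝[S] t₀) (𝓝 1) := by
    rwa [ContinuousWithinAt, mul_inv_cancel] at hc'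
  refine ⟨?_, ?_⟩
  · rw [ContinuousWithinAt, mul_inv_cancel, unitChart_one]
    exact (tendsto_unitChart ι).comp h3
  · filter_upwards [h3.eventually (eventually_unitChart ι)] with s hs using hs.2

/-- `H¹`-paths are stable under a pointwise operation of two paths that is smooth in the charts. -/
theorem isH1Path_of_unitParam {γ δ η : ℝ → G} (hγ : IsH1Path E γ) (hδ : IsH1Path E δ)
    (hη : ContinuousOn η (Icc 0 1)) (m : ℝ → W × W → W) (hm : ∀ t₀, ContDiffAt ℝ ∞ (m t₀) 0)
    (h : ∀ t₀ s x y, unitParam G ι x = γ s * (γ t₀)⁻¹ → unitParam G ι y = δ s * (δ t₀)⁻¹ →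
      unitChart ι (η s * (η t₀)⁻¹) = m t₀ (x, y)) : IsH1Path E η := by
  refine (isH1Path_iff ι).2 ⟨hη, fun t₀ ht₀ => ?_⟩
  obtain ⟨hγ1, hγ2⟩ := (isH1Path_iff ι).1 hγ
  obtain ⟨hδ1, hδ2⟩ := (isH1Path_iff ι).1 hδ
  obtain ⟨h1, h1'⟩ := tendsto_unitChart_mul_inv ι (hγ1 t₀ ht₀)
  obtain ⟨h2, h2'⟩ := tendsto_unitChart_mul_inv ι (hδ1 t₀ ht₀)
  refine (((hγ2 t₀ ht₀).prodMk (hδ2 t₀ ht₀)).contDiffAt_comp (h1.prodMk h2) (Φ := m t₀) ?_).congr ?_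
  · simp only [mul_inv_cancel, unitChart_one]
    exact hm t₀
  · filter_upwards [h1', h2'] with s hs hs' using (h t₀ s _ _ hs hs').symm

theorem IsH1Path.mul {γ δ : ℝ → G} (hγ : IsH1Path E γ) (hδ : IsH1Path E δ) :
    IsH1Path E (fun s => γ s * δ s) := by
  refine isH1Path_of_unitParam (ContinuousLinearEquiv.refl ℝ E) hγ hδ (hγ.1.mul hδ.1)
    (fun t₀ p => unitChart (ContinuousLinearEquiv.refl ℝ E)
      (unitParam G (ContinuousLinearEquiv.refl ℝ E) p.1 *
        (γ t₀ * unitParam G (ContinuousLinearEquiv.refl ℝ E) p.2 * (γ t₀)⁻¹)))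
    (fun t₀ => ?_) fun t₀ s x y hx hy => ?_
  · refine contDiffAt_unitChart_comp _ ?_ (by simp)
    have h1 := (eventually_contMDiffAt_unitParam_comp G (ContinuousLinearEquiv.refl ℝ E)
      (ContinuousLinearMap.fst ℝ E E)).self_of_nhds
    have h2 := (eventually_contMDiffAt_unitParam_comp G (ContinuousLinearEquiv.refl ℝ E)
      (ContinuousLinearMap.snd ℝ E E)).self_of_nhds
    exact h1.mul ((contMDiffAt_const.mul h2).mul contMDiffAt_const)
  · rw [hx, hy]
    congr 1
    group

theorem IsH1Path.inv_mul {γ δ : ℝ → G} (hγ : IsH1Path E γ) (hδ : IsH1Path E δ) :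
    IsH1Path E (fun s => (γ s)⁻¹ * δ s) := by
  refine isH1Path_of_unitParam (ContinuousLinearEquiv.refl ℝ E) hγ hδ (hγ.1.inv.mul hδ.1)
    (fun t₀ p => unitChart (ContinuousLinearEquiv.refl ℝ E)
      ((γ t₀)⁻¹ * (unitParam G (ContinuousLinearEquiv.refl ℝ E) p.1)⁻¹ *
        unitParam G (ContinuousLinearEquiv.refl ℝ E) p.2 * γ t₀))
    (fun t₀ => ?_) fun t₀ s x y hx hy => ?_
  · refine contDiffAt_unitChart_comp _ ?_ (by simp)
    have h1 := (eventually_contMDiffAt_unitParam_comp G (ContinuousLinearEquiv.refl ℝ E)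
      (ContinuousLinearMap.fst ℝ E E)).self_of_nhds
    have h2 := (eventually_contMDiffAt_unitParam_comp G (ContinuousLinearEquiv.refl ℝ E)
      (ContinuousLinearMap.snd ℝ E E)).self_of_nhds
    exact ((contMDiffAt_const.mul h1.inv).mul h2).mul contMDiffAt_const
  · rw [hx, hy]
    congr 1
    group

/-- `γ` is an `H¹`-path from the identity with the right logarithmic derivative `u`. -/
def IsLogPrimitive (u : ℝ → W) (γ : ℝ → G) : Prop :=
  IsH1Path E γ ∧ γ 0 = 1 ∧
    ∀ᵐ t ∂(volume.restrict (Icc (0 : ℝ) 1)), HasLogDerivAt ι γ (u t) t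

theorem IsLogPrimitive.mul {u v w : ℝ → W} {γ δ : ℝ → G} (hγ : IsLogPrimitive ι u γ)
    (hδ : IsLogPrimitive ι v δ)
    (hw : ∀ᵐ t ∂(volume.restrict (Icc (0 : ℝ) 1)), w t = u t + adjointAction ι (γ t) (v t)) :
    IsLogPrimitive ι w (fun s => γ s * δ s) := by
  refine ⟨hγ.1.mul hδ.1, by simp [hγ.2.1, hδ.2.1], ?_⟩
  filter_upwards [hγ.2.2, hδ.2.2, hw] with t h1 h2 h3
  rw [h3]
  exact h1.mul ι h2

/-- A path is determined by its initial value and its logarithmic derivative. -/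
theorem IsLogPrimitive.eqOn {u : ℝ → W} {γ δ : ℝ → G} (hγ : IsLogPrimitive ι u γ)
    (hδ : IsLogPrimitive ι u δ) : EqOn γ δ (Icc 0 1) := by
  intro t ht
  by_contra hne
  have hne' : (γ t)⁻¹ * δ t ≠ 1 := fun h => hne (inv_mul_eq_one.1 h)
  obtain ⟨f, hf0, hf1, -⟩ := exists_contMDiffMap_zero_one_of_isClosed 𝓘(ℝ, E) (n := ⊤)
    (isClosed_singleton (x := (1 : G))) (isClosed_singleton (x := (γ t)⁻¹ * δ t))
    (disjoint_singleton.2 hne'.symm)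
  obtain ⟨h1, -⟩ := (hγ.1.inv_mul hδ.1).2 f f.contMDiff
  have h2 : ∀ᵐ s ∂(volume.restrict (Icc (0 : ℝ) 1)),
      HasDerivAt (f ∘ fun s => (γ s)⁻¹ * δ s) 0 s := by
    filter_upwards [hγ.2.2, hδ.2.2] with s h3 h4
    have h5 := (hasLogDerivAt_iff ι).1 (h3.inv_mul ι h4)
    have h6 := ((f.contMDiff.mdifferentiable (by simp)) ((γ s)⁻¹ * δ s)).hasMFDerivAt.comp s h5
    let L : E →L[ℝ] E :=
      mfderiv 𝓘(ℝ, E) 𝓘(ℝ, E) (fun x : G => x * ((γ s)⁻¹ * δ s)) (1 : G)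
    let L' : E →L[ℝ] ℝ := mfderiv 𝓘(ℝ, E) 𝓘(ℝ, ℝ) f ((γ s)⁻¹ * δ s)
    have h7 : HasFDerivAt (f ∘ fun s => (γ s)⁻¹ * δ s)
        (L'.comp (ContinuousLinearMap.toSpanSingleton ℝ (L (ι 0)))) s := h6.hasFDerivAt
    refine h7.hasDerivAt.congr_deriv ?_
    show L' ((1 : ℝ) • L (ι 0)) = 0
    rw [map_zero, map_zero, smul_zero, map_zero]
  rw [ae_restrict_iff' measurableSet_Icc] at h2
  obtain ⟨C, hC⟩ := h1.const_of_ae_hasDerivAt_zero (by simpa [uIcc_of_le zero_le_one] using h2)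
  rw [uIcc_of_le zero_le_one] at hC
  have h3 := hC 0 (by simp)
  have h4 := hC t ht
  have h5 : f ((γ t)⁻¹ * δ t) = 1 := hf1 rfl
  have h6 : f 1 = 0 := hf0 rfl
  simp only [Function.comp_apply, hγ.2.1, hδ.2.1, inv_one, mul_one, h6] at h3
  simp only [Function.comp_apply, h5] at h4
  rw [← h3] at h4
  exact one_ne_zero h4

end HOnePaths

/-! ### Solutions for small logarithmic derivatives -/

section LocalSolutions

attribute [-instance] Bundle.instNormedAddCommGroupOfRiemannianBundleOfIsTopologicalAddGroupOfContinuousConstSMulReal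
  Bundle.instInnerProductSpaceReal

/-- A map that is smooth near the origin extends, from a smaller neighbourhood, to a smooth map. -/
theorem exists_contDiff_eventuallyEq {W Y : Type*} [NormedAddCommGroup W] [InnerProductSpace ℝ W]
    [NormedAddCommGroup Y] [NormedSpace ℝ Y] {f : W → Y}
    (hf : ∀ᶠ x in 𝓝 (0 : W), ContDiffAt ℝ ∞ f x) :
    ∃ g : C(W, Y), ContDiff ℝ ∞ g ∧ g =ᶠ[𝓝 0] f := by
  obtain ⟨r, hr, hf⟩ := Metric.eventually_nhds_iff_ball.1 hf
  let ψ : ContDiffBump (0 : W) := ⟨r / 4, r / 2, by positivity, by linarith⟩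
  have h : ContDiff ℝ ∞ fun x => ψ x • f x := by
    rw [contDiff_iff_contDiffAt]
    intro x
    by_cases hx : x ∈ Metric.ball (0 : W) r
    · exact ψ.contDiffAt.smul (hf x hx)
    · have hx' : x ∈ (tsupport ψ)ᶜ := fun h => hx (by
        rw [ψ.tsupport_eq] at h
        exact Metric.closedBall_subset_ball (by show r / 2 < r; linarith) h)
      refine (contDiffAt_const (c := (0 : Y))).congr_of_eventuallyEq ?_
      filter_upwards [(isClosed_tsupport ψ).isOpen_compl.mem_nhds hx'] with y hy
      rw [image_eq_zero_of_notMem_tsupport hy, zero_smul]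
  refine ⟨⟨_, h.continuous⟩, h, ?_⟩
  filter_upwards [ψ.eventuallyEq_one] with x hx
  show ψ x • f x = f x
  rw [hx, Pi.one_apply, one_smul]

variable {E : Type*} [NormedAddCommGroup E] [NormedSpace ℝ E] [FiniteDimensional ℝ E]
  {G : Type*} [TopologicalSpace G] [ChartedSpace E G] [Group G] [LieGroup 𝓘(ℝ, E) ∞ G]
  [IsTopologicalGroup G] [T2Space G] [CompactSpace G]
  {W : Type u} [NormedAddCommGroup W] [InnerProductSpace ℝ W] (ι : W ≃L[ℝ] E)

variable (G) in
theorem contMDiffAt_unitParam_mul_inv {y : W}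
    (hy : ContMDiffAt 𝓘(ℝ, W) 𝓘(ℝ, E) ∞ (unitParam G ι) y) :
    ContDiffAt ℝ ∞ (fun x => unitChart ι (unitParam G ι x * (unitParam G ι y)⁻¹)) y :=
  contDiffAt_unitChart_comp ι (hy.mul contMDiffAt_const) (by simp)

variable (G) in
/-- In the chart at the identity, the right-invariant vector fields are given by a smooth field of
operators. -/
theorem exists_rightInvariantField : ∃ F : C(W, W →L[ℝ] W), ContDiff ℝ ∞ F ∧
    F 0 = ContinuousLinearMap.id ℝ W ∧ ∀ᶠ y in 𝓝 (0 : W), ∀ u : W,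
      fderiv ℝ (fun x => unitChart ι (unitParam G ι x * (unitParam G ι y)⁻¹)) y (F y u) = u := by
  let M : W × W → W := fun p => unitChart ι (unitParam G ι p.2 * unitParam G ι p.1)
  have h1 : ∀ᶠ p in 𝓝 (0 : W × W), ContMDiffAt 𝓘(ℝ, W × W) 𝓘(ℝ, E) ∞
      (fun p => unitParam G ι p.2 * unitParam G ι p.1) p := by
    filter_upwards [eventually_contMDiffAt_unitParam_comp G ι (ContinuousLinearMap.fst ℝ W W),
      eventually_contMDiffAt_unitParam_comp G ι (ContinuousLinearMap.snd ℝ W W)] with p hp hq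
    exact hq.mul hp
  have h2 := eventually_contDiffAt_unitChart_comp ι h1 (by simp)
  have h3 : Tendsto (fun x : W => (x, (0 : W))) (𝓝 0) (𝓝 0) := by
    have : Continuous fun x : W => (x, (0 : W)) := by fun_prop
    exact this.tendsto 0
  have h4 : ∀ᶠ y in 𝓝 (0 : W), ContDiffAt ℝ ∞ (fun y => fderiv ℝ (fun z => M (y, z)) 0) y := by
    filter_upwards [h3.eventually h2] with x hx
    exact ContDiffAt.fderiv (n := ∞) (f := fun x y => M (x, y)) (g := fun _ => 0) hx.1
      contDiffAt_const (by simp)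
  obtain ⟨F, hF, hFeq⟩ := exists_contDiff_eventuallyEq h4
  refine ⟨F, hF, ?_, ?_⟩
  · rw [hFeq.eq_of_nhds]
    refine HasFDerivAt.fderiv ((hasFDerivAt_id (0 : W)).congr_of_eventuallyEq ?_)
    filter_upwards [eventually_unitParam (G := G) ι] with y hy
    simp [M, hy.2]
  · filter_upwards [hFeq, h3.eventually h2.eventually_nhds, eventually_unitParam (G := G) ι]
      with y hy hM hρ u
    rw [hy]
    have hM0 : M (y, 0) = y := by simp [M, hρ.2]
    have h5 : HasFDerivAt (fun z => M (y, z)) (fderiv ℝ (fun z => M (y, z)) 0) 0 := by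
      refine DifferentiableAt.hasFDerivAt ?_
      exact DifferentiableAt.comp (0 : W) (g := M) (f := fun z => (y, z))
        (hM.self_of_nhds.1.differentiableAt (by simp)) (by fun_prop)
    have h6 : HasFDerivAt (fun x => unitChart ι (unitParam G ι x * (unitParam G ι y)⁻¹))
        (fderiv ℝ (fun x => unitChart ι (unitParam G ι x * (unitParam G ι y)⁻¹)) y) (M (y, 0)) := by
      rw [hM0]
      exact ((contMDiffAt_unitParam_mul_inv G ι hρ.1).differentiableAt (by simp)).hasFDerivAt
    have h7 : HasFDerivAt ((fun x => unitChart ι (unitParam G ι x * (unitParam G ι y)⁻¹)) ∘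
        fun z => M (y, z)) (ContinuousLinearMap.id ℝ W) 0 := by
      refine (hasFDerivAt_id (0 : W)).congr_of_eventuallyEq ?_
      have h8 : Tendsto (fun z : W => (y, z)) (𝓝 0) (𝓝 (y, 0)) := by
        have : Continuous fun z : W => (y, z) := by fun_prop
        exact this.tendsto 0
      filter_upwards [h8.eventually hM, eventually_unitParam (G := G) ι] with z hz hz'
      simp only [Function.comp_apply, id]
      rw [hz.2, mul_inv_cancel_right, hz'.2]
    exact congrArg (fun L : W →L[ℝ] W => L u) ((h6.comp (0 : W) h5).unique h7)

variable [FiniteDimensional ℝ W] [CompleteSpace W]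

variable (G) in
/-- For small `u`, the path in `G` with right logarithmic derivative `u` exists, is contained in the
domain of the chart at the identity, and depends smoothly on `u` there. -/
theorem exists_local_logPrimitive : ∃ x : L2I W → C(unitInterval, W),
    ContDiffAt ℝ ∞ x 0 ∧ x 0 = 0 ∧ HasFDerivAt x (primI W) 0 ∧
    (∃ 𝒦, IsCompact 𝒦 ∧ ∀ᶠ u in 𝓝 0, x u ∈ 𝒦) ∧
    ∀ᶠ u : L2I W in 𝓝 0, IsLogPrimitive (G := G) ι u (fun t => unitParam G ι (x u (projI t))) := by
  obtain ⟨F, hF, hF0, hFG⟩ := exists_rightInvariantField G ι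
  obtain ⟨x, hx, hx0, hx', hxeq⟩ := exists_localFlow F hF hF0
  have hxt : Tendsto x (𝓝 0) (𝓝 0) := by
    have := hx.continuousAt.tendsto
    rwa [hx0] at this
  refine ⟨x, hx, hx0, hx', ?_, ?_⟩
  · have h1 : Tendsto (fun u => mulI (F.comp (x u)) u) (𝓝 0) (𝓝 0) := by
      have h2 : ContDiffAt ℝ ∞ (fun u => mulI (F.comp (x u)) u) 0 :=
        ContDiffAt.clm_apply (((contDiff_mulI (W := W)).comp
          (contDiff_infty_superposition F hF)).contDiffAt.comp 0 hx) contDiffAt_id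
      have := h2.continuousAt.tendsto
      rwa [map_zero] at this
    obtain ⟨𝒦, h𝒦, hsub⟩ := (isCompactOperator_primI (W := W)).image_closedBall_subset_compact 1
    refine ⟨𝒦, h𝒦, ?_⟩
    filter_upwards [hxeq, h1.eventually (Metric.closedBall_mem_nhds 0 one_pos)] with u hu hu'
    rw [hu]
    exact hsub (mem_image_of_mem _ hu')
  · obtain ⟨δ, hδ, hball⟩ := Metric.eventually_nhds_iff_ball.1
      (hFG.and (eventually_unitParam (G := G) ι))
    filter_upwards [hxeq, hxt.eventually (Metric.ball_mem_nhds 0 hδ)] with u hu hu'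
    have hmem : ∀ t, x u t ∈ Metric.ball (0 : W) δ := fun t => by
      rw [dist_zero_right] at hu'
      rw [mem_ball_zero_iff]
      exact ((x u).norm_coe_le_norm t).trans_lt hu'
    have hcx : Continuous fun t => x u (projI t) := (x u).continuous.comp continuous_projI
    have hγc : Continuous fun t => unitParam G ι (x u (projI t)) := by
      refine continuous_iff_continuousAt.2 fun t => ?_
      exact ContinuousAt.comp (g := unitParam G ι) ((hball _ (hmem _)).2.1.continuousAt)
        hcx.continuousAt
    refine ⟨⟨hγc.continuousOn, fun f hf => ?_⟩, ?_, ?_⟩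
    · have h1 : ∀ t₀ ∈ Icc (0 : ℝ) 1,
          IsHOneCurveAt (f ∘ fun t => unitParam G ι (x u (projI t))) t₀ := fun t₀ ht₀ => by
        have h2 : IsHOneCurveAt (fun t => x u (projI t)) t₀ := by
          rw [hu]; exact isHOneCurveAt_primI _ t₀
        refine h2.contDiffAt_comp hcx.continuousWithinAt (Φ := fun y => f (unitParam G ι y)) ?_
        rw [← contMDiffAt_iff_contDiffAt]
        exact hf.contMDiffAt.comp _ (hball _ (hmem _)).2.1
      obtain ⟨g, hg, -, h2⟩ := exists_dist_le_integral h1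
      exact isHOne_of_dist_le_integral hg h2
    · have h0 : projI 0 = 0 := projI_of_mem (by simp)
      beta_reduce
      rw [h0, hu, primI_zero, unitParam_zero]
    · have h1 := ae_hasDerivAt_primI (mulI (F.comp (x u)) u)
      rw [← hu] at h1
      filter_upwards [h1, coeFn_mulI (F.comp (x u)) u] with t ht ht'
      refine ⟨hγc.continuousAt, ?_⟩
      rw [ht'] at ht
      obtain ⟨h2, h3⟩ := hball _ (hmem (projI t))
      have h4 := ((contMDiffAt_unitParam_mul_inv G ι h3.1).differentiableAt (by simp)).hasFDerivAt
      have h5 := h4.comp_hasDerivAt t ht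
      rw [ContinuousMap.comp_apply, h2] at h5
      exact h5

end LocalSolutions

/-! ### Global solutions and their adjoint fields -/

section MulIsometry

attribute [-instance] Bundle.instNormedAddCommGroupOfRiemannianBundleOfIsTopologicalAddGroupOfContinuousConstSMulReal
  Bundle.instInnerProductSpaceReal

variable {W : Type*} [NormedAddCommGroup W] [InnerProductSpace ℝ W]

/-- The pointwise multiplication by a continuous field `a` of linear isometries, with inverse `b`,
as an isometry of `L²`. -/
noncomputable def mulIsometry (a b : C(unitInterval, W →L[ℝ] W)) (hab : a * b = 1) (hba : b * a = 1)
    (ha : ∀ t w, ‖a t w‖ = ‖w‖) : L2I W ≃ₗᵢ[ℝ] L2I W where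
  toLinearEquiv := LinearEquiv.ofLinearMap (mulI a : L2I W →ₗ[ℝ] L2I W) (mulI b : L2I W →ₗ[ℝ] L2I W)
    (LinearMap.ext fun f => by
      show mulI a (mulI b f) = f
      rw [← mulI_mul, hab, mulI_one])
    (LinearMap.ext fun f => by
      show mulI b (mulI a f) = f
      rw [← mulI_mul, hba, mulI_one])
  norm_map' := norm_mulI_of_isometry a ha

/-- Induction on the norm: a property of small vectors that survives steps of length less than `ε`
is reached at every vector after finitely many steps along its segment to the origin. -/
theorem exists_of_norm_lt_of_step {V : Type*} [NormedAddCommGroup V] [NormedSpace ℝ V]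
    {ε : ℝ} {P : ℕ → V → Prop} (h0 : ∀ u, ‖u‖ < ε → P 0 u)
    (hstep : ∀ n u v, P n u → ‖v - u‖ < ε → P (n + 1) v) (n : ℕ) :
    ∀ u, ‖u‖ < (n + 1) * ε → P n u := by
  induction n with
  | zero => exact fun u hu => h0 u (by simpa using hu)
  | succ n ih =>
    intro u hu
    have hn : (0 : ℝ) < n + 2 := by positivity
    have hu' : ‖u‖ / (n + 2) < ε := by
      rw [div_lt_iff₀ hn]
      push_cast at hu
      linarith
    refine hstep n (((n + 1 : ℝ) / (n + 2)) • u) u (ih _ ?_) ?_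
    · rw [norm_smul, Real.norm_of_nonneg (by positivity), div_mul_eq_mul_div, mul_div_assoc]
      exact mul_lt_mul_of_pos_left hu' (by positivity)
    · have h1 : u - ((n + 1 : ℝ) / (n + 2)) • u = (1 / (n + 2 : ℝ)) • u := by
        rw [← one_smul ℝ u, smul_smul, ← sub_smul, one_smul]
        congr 1
        field_simp
        ring
      rw [h1, norm_smul, Real.norm_of_nonneg (by positivity), one_div_mul_eq_div]
      exact hu'

theorem contDiff_bilinC_apply {K : Type*} [TopologicalSpace K] [CompactSpace K] {X Y Z : Type*}
    [NormedAddCommGroup X] [NormedSpace ℝ X] [NormedAddCommGroup Y] [NormedSpace ℝ Y]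
    [NormedAddCommGroup Z] [NormedSpace ℝ Z] (B : X →L[ℝ] Y →L[ℝ] Z) (a : C(K, X)) :
    ContDiff ℝ ∞ fun f : C(K, Y) => bilinC B a f :=
  (bilinC B a).contDiff

theorem HasFDerivAt.bilinC_apply {K : Type*} [TopologicalSpace K] [CompactSpace K]
    {V X Y Z : Type*} [NormedAddCommGroup V] [NormedSpace ℝ V]
    [NormedAddCommGroup X] [NormedSpace ℝ X] [NormedAddCommGroup Y] [NormedSpace ℝ Y]
    [NormedAddCommGroup Z] [NormedSpace ℝ Z] (B : X →L[ℝ] Y →L[ℝ] Z) (a : C(K, X))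
    {f : V → C(K, Y)} {f' : V →L[ℝ] C(K, Y)} {v : V} (hf : HasFDerivAt f f' v) :
    HasFDerivAt (fun v => bilinC B a (f v)) ((bilinC B a).comp f') v :=
  (bilinC B a).hasFDerivAt.comp v hf

theorem HasFDerivAt.bilinI_apply {V X : Type*} [NormedAddCommGroup V] [NormedSpace ℝ V]
    [NormedAddCommGroup X] [NormedSpace ℝ X] (B : X →L[ℝ] W →L[ℝ] W) {a : V → C(unitInterval, X)}
    {a' : V →L[ℝ] C(unitInterval, X)} {v : V} (ha : HasFDerivAt a a' v) (f : L2I W) :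
    ∃ D : V →L[ℝ] L2I W, HasFDerivAt (fun v => bilinI B (a v) f) D v ∧
      ∀ w, D w = bilinI B (a' w) f :=
  ⟨_, ((bilinI B).flip f).hasFDerivAt.comp v ha, fun _ => rfl⟩

/-- The differential at a point of the composition of a smooth map with a family of functions. -/
theorem HasFDerivAt.superposition {K : Type*} [TopologicalSpace K] [CompactSpace K]
    {V X Y : Type*} [NormedAddCommGroup V] [NormedSpace ℝ V]
    [NormedAddCommGroup X] [NormedSpace ℝ X] [NormedAddCommGroup Y] [NormedSpace ℝ Y]
    (a : C(X, Y)) (ha : ContDiff ℝ ∞ a) {f : V → C(K, X)} {f' : V →L[ℝ] C(K, X)} {v : V}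
    (hf : HasFDerivAt f f' v) :
    ∃ D : V →L[ℝ] C(K, Y), HasFDerivAt (fun v => a.comp (f v)) D v ∧
      ∀ w t, D w t = fderiv ℝ a (f v t) (f' w t) := by
  let a' : C(X, X →L[ℝ] Y) := ⟨fderiv ℝ a, ha.continuous_fderiv (by simp)⟩
  exact ⟨_, (hasFDerivAt_superposition (F := a) (F' := a')
    (fun x => (ha.differentiable (by simp) x).hasFDerivAt) (f v)).comp v hf, fun w t => rfl⟩

end MulIsometry

section GlobalSolutions

attribute [-instance] Bundle.instNormedAddCommGroupOfRiemannianBundleOfIsTopologicalAddGroupOfContinuousConstSMulReal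
  Bundle.instInnerProductSpaceReal

variable {E : Type*} [NormedAddCommGroup E] [NormedSpace ℝ E] [FiniteDimensional ℝ E]
  {G : Type*} [TopologicalSpace G] [ChartedSpace E G] [Group G] [LieGroup 𝓘(ℝ, E) ∞ G]
  [IsTopologicalGroup G] [T2Space G] [CompactSpace G]
  {W : Type u} [NormedAddCommGroup W] [InnerProductSpace ℝ W] (ι : W ≃L[ℝ] E)

open Classical in
/-- The adjoint action along a path, as a continuous operator-valued function on `[0,1]`. If the path
is not continuous there, the value is the constant identity. -/
noncomputable def adjointAlong (γ : ℝ → G) : C(unitInterval, W →L[ℝ] W) :=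
  if h : ContinuousOn γ (Icc 0 1) then
    ⟨fun t => adjointAction ι (γ t), (continuous_adjointAction ι).comp
      (continuousOn_iff_continuous_domRestrict.1 h)⟩
  else 1

theorem adjointAlong_apply {γ : ℝ → G} (h : ContinuousOn γ (Icc 0 1)) (t : unitInterval) :
    adjointAlong ι γ t = adjointAction ι (γ t) := by
  rw [adjointAlong, dif_pos h]; rfl

theorem adjointAlong_mul_inv {γ : ℝ → G} (h : ContinuousOn γ (Icc 0 1)) :
    adjointAlong ι γ * adjointAlong ι γ⁻¹ = 1 := by
  ext t w
  show adjointAlong ι γ t (adjointAlong ι γ⁻¹ t w) = w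
  rw [adjointAlong_apply ι h, adjointAlong_apply ι h.inv, Pi.inv_apply, adjointAction_apply_inv]

theorem adjointAlong_inv_mul {γ : ℝ → G} (h : ContinuousOn γ (Icc 0 1)) :
    adjointAlong ι γ⁻¹ * adjointAlong ι γ = 1 := by
  ext t w
  show adjointAlong ι γ⁻¹ t (adjointAlong ι γ t w) = w
  rw [adjointAlong_apply ι h, adjointAlong_apply ι h.inv, Pi.inv_apply, adjointAction_inv_apply]

/-- The group law on `L²` that corresponds to the pointwise product of paths in `G`. -/
theorem IsLogPrimitive.mul_add_mulI {u v : L2I W} {γ δ : ℝ → G} (hγ : IsLogPrimitive ι u γ)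
    (hδ : IsLogPrimitive ι v δ) :
    IsLogPrimitive ι (u + mulI (adjointAlong ι γ) v : L2I W) (fun s => γ s * δ s) := by
  refine hγ.mul ι hδ ?_
  filter_upwards [ae_restrict_Icc (Lp.coeFn_add u (mulI (adjointAlong ι γ) v)),
    coeFn_mulI (adjointAlong ι γ) v] with t ⟨ht, h1⟩ h2
  have ht' : t ∈ Icc (0 : ℝ) 1 := Ioo_subset_Icc_self ht
  rw [h1, Pi.add_apply, h2, adjointAlong_apply ι hγ.1.1, projI_of_mem ht']

variable [FiniteDimensional ℝ W] [CompleteSpace W]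

/-- Paths with a prescribed logarithmic derivative exist: they do if this derivative is small in
`L²`, and by the invariance of the norm the general case follows by finitely many small steps. -/
theorem exists_isLogPrimitive (hAd : ∀ (g : G) (w : W), ‖adjointAction ι g w‖ = ‖w‖) (u : L2I W) :
    ∃ γ : ℝ → G, IsLogPrimitive ι u γ := by
  obtain ⟨x, -, -, -, -, hx⟩ := exists_local_logPrimitive G ι
  obtain ⟨ε, hε, hball⟩ := Metric.eventually_nhds_iff_ball.1 hx
  have hsmall : ∀ u : L2I W, ‖u‖ < ε → ∃ γ : ℝ → G, IsLogPrimitive ι u γ := fun u hu =>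
    ⟨_, hball u (by rwa [mem_ball_zero_iff])⟩
  obtain ⟨n, hn⟩ := exists_nat_gt (‖u‖ / ε)
  refine exists_of_norm_lt_of_step (P := fun _ (u : L2I W) => ∃ γ : ℝ → G, IsLogPrimitive ι u γ)
    hsmall ?_ n u ?_
  · rintro - u v ⟨γ, hγ⟩ hv
    obtain ⟨δ, hδ⟩ := hsmall (mulI (adjointAlong ι γ⁻¹) (v - u)) (by
      rw [norm_mulI_of_isometry _ fun t w => ?_]
      · exact hv
      · rw [adjointAlong_apply ι hγ.1.1.inv, hAd])
    have h1 := hγ.mul_add_mulI ι hδ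
    rw [← mulI_mul, adjointAlong_mul_inv ι hγ.1.1, mulI_one, add_sub_cancel] at h1
    exact ⟨_, h1⟩
  · rw [div_lt_iff₀ hε] at hn
    refine hn.trans_le (mul_le_mul_of_nonneg_right (by linarith) hε.le)

/-- The path in `G` from the identity with right logarithmic derivative `u`, if there is one: it exists
if the adjoint action is isometric, and is unique on `[0,1]`. -/
noncomputable def logPrimitive (u : L2I W) : ℝ → G :=
  Classical.epsilon fun γ : ℝ → G => IsLogPrimitive ι u γ

variable (G) in
/-- The adjoint action along the path with right logarithmic derivative `u`. -/
noncomputable def adjointField (u : L2I W) : C(unitInterval, W →L[ℝ] W) :=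
  adjointAlong ι (logPrimitive ι u : ℝ → G)

theorem isLogPrimitive_logPrimitive (hAd : ∀ (g : G) (w : W), ‖adjointAction ι g w‖ = ‖w‖)
    (u : L2I W) : IsLogPrimitive ι u (logPrimitive ι u : ℝ → G) :=
  Classical.epsilon_spec (exists_isLogPrimitive ι hAd u)

theorem adjointField_apply (hAd : ∀ (g : G) (w : W), ‖adjointAction ι g w‖ = ‖w‖)
    (u : L2I W) (t : unitInterval) :
    adjointField G ι u t = adjointAction ι (logPrimitive ι u t : G) :=
  adjointAlong_apply ι (isLogPrimitive_logPrimitive ι hAd u).1.1 t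

theorem norm_adjointField_apply (hAd : ∀ (g : G) (w : W), ‖adjointAction ι g w‖ = ‖w‖)
    (u : L2I W) (t : unitInterval) (w : W) : ‖adjointField G ι u t w‖ = ‖w‖ := by
  rw [adjointField_apply ι hAd, hAd]

/-- The isometry of `L²` given by the adjoint action along the path with logarithmic
derivative `u`. -/
noncomputable def adjointIsometry (hAd : ∀ (g : G) (w : W), ‖adjointAction ι g w‖ = ‖w‖)
    (u : L2I W) : L2I W ≃ₗᵢ[ℝ] L2I W :=
  mulIsometry (adjointField G ι u) (adjointAlong ι (logPrimitive ι u : ℝ → G)⁻¹)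
    (adjointAlong_mul_inv ι (isLogPrimitive_logPrimitive ι hAd u).1.1)
    (adjointAlong_inv_mul ι (isLogPrimitive_logPrimitive ι hAd u).1.1)
    (norm_adjointField_apply ι hAd u)

/-- The path for `u + Ad(γ)v`, where `γ` is the path for `u`, is the product of the paths for `u`
and `v`: the affine isometry `v ↦ u + Ad(γ)v` of `L²` covers a left translation of `G`. -/
theorem logPrimitive_add (hAd : ∀ (g : G) (w : W), ‖adjointAction ι g w‖ = ‖w‖) (u v : L2I W)
    {t : ℝ} (ht : t ∈ Icc (0 : ℝ) 1) :
    (logPrimitive ι (u + adjointIsometry ι hAd u v) t : G) =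
      logPrimitive ι u t * logPrimitive ι v t :=
  (isLogPrimitive_logPrimitive ι hAd _).eqOn ι
    ((isLogPrimitive_logPrimitive ι hAd u).mul_add_mulI ι (isLogPrimitive_logPrimitive ι hAd v)) ht

theorem adjointField_add (hAd : ∀ (g : G) (w : W), ‖adjointAction ι g w‖ = ‖w‖) (u v : L2I W) :
    adjointField G ι (u + adjointIsometry ι hAd u v) = adjointField G ι u * adjointField G ι v := by
  ext t w
  show _ = adjointField G ι u t (adjointField G ι v t w)
  simp only [adjointField_apply ι hAd]
  rw [logPrimitive_add ι hAd u v t.2, adjointAction_mul_apply]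

/-- Near the origin, `logPrimitive` and `adjointField` are given by smooth maps. -/
theorem exists_local_adjointField (hAd : ∀ (g : G) (w : W), ‖adjointAction ι g w‖ = ‖w‖) :
    ∃ (x : L2I W → C(unitInterval, W)) (a : C(W, W →L[ℝ] W)),
    ContDiffAt ℝ ∞ x 0 ∧ x 0 = 0 ∧ HasFDerivAt x (primI W) 0 ∧
    (∃ 𝒦, IsCompact 𝒦 ∧ ∀ᶠ u in 𝓝 0, x u ∈ 𝒦) ∧ ContDiff ℝ ∞ a ∧
    a 0 = ContinuousLinearMap.id ℝ W ∧
    ∀ᶠ u in 𝓝 0, adjointField G ι u = a.comp (x u) ∧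
      (logPrimitive ι u 1 : G) = unitParam G ι (x u 1) := by
  obtain ⟨x, hx, hx0, hx', h𝒦, hxp⟩ := exists_local_logPrimitive G ι
  obtain ⟨a, ha, haeq⟩ := exists_contDiff_eventuallyEq
    (eventually_contDiffAt_adjointAction_unitParam (G := G) ι)
  refine ⟨x, a, hx, hx0, hx', h𝒦, ha, by rw [haeq.eq_of_nhds]; simp, ?_⟩
  have hxt : Tendsto x (𝓝 0) (𝓝 0) := by
    have := hx.continuousAt.tendsto
    rwa [hx0] at this
  obtain ⟨δ, hδ, hball⟩ := Metric.eventually_nhds_iff_ball.1 haeq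
  filter_upwards [hxp, hxt.eventually (Metric.ball_mem_nhds 0 hδ)] with u hu hu'
  have h1 := (isLogPrimitive_logPrimitive ι hAd u).eqOn ι hu
  constructor
  · refine ContinuousMap.ext fun t => ?_
    rw [adjointField_apply ι hAd, h1 t.2, ContinuousMap.comp_apply, hball]
    · beta_reduce
      rw [projI_val]
    · rw [dist_zero_right] at hu'
      rw [mem_ball_zero_iff]
      exact ((x u).norm_coe_le_norm t).trans_lt hu'
  · rw [h1 (by simp : (1 : ℝ) ∈ Icc (0 : ℝ) 1)]
    beta_reduce
    rw [show projI 1 = 1 from projI_of_mem (by simp)]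

theorem logPrimitive_zero_one (hAd : ∀ (g : G) (w : W), ‖adjointAction ι g w‖ = ‖w‖) :
    (logPrimitive ι (0 : L2I W) 1 : G) = 1 := by
  obtain ⟨x, a, -, hx0, -, -, -, -, h⟩ := exists_local_adjointField ι hAd
  rw [h.self_of_nhds.2, hx0]
  exact unitParam_zero ι

/-- The affine isometry that carries `u` to the origin. -/
noncomputable def toOrigin (hAd : ∀ (g : G) (w : W), ‖adjointAction ι g w‖ = ‖w‖) (u v : L2I W) :
    L2I W := (adjointIsometry ι hAd u).symm (v - u)

theorem toOrigin_self (hAd : ∀ (g : G) (w : W), ‖adjointAction ι g w‖ = ‖w‖) (u : L2I W) :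
    toOrigin ι hAd u u = 0 := by simp [toOrigin]

theorem add_toOrigin (hAd : ∀ (g : G) (w : W), ‖adjointAction ι g w‖ = ‖w‖) (u v : L2I W) :
    u + adjointIsometry ι hAd u (toOrigin ι hAd u v) = v := by simp [toOrigin]

theorem contDiff_toOrigin (hAd : ∀ (g : G) (w : W), ‖adjointAction ι g w‖ = ‖w‖) (u : L2I W) :
    ContDiff ℝ ∞ (toOrigin ι hAd u) :=
  (adjointIsometry ι hAd u).symm.contDiff.comp (contDiff_id.sub contDiff_const)

theorem hasFDerivAt_toOrigin (hAd : ∀ (g : G) (w : W), ‖adjointAction ι g w‖ = ‖w‖)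
    (u v : L2I W) : HasFDerivAt (toOrigin ι hAd u)
      ((adjointIsometry ι hAd u).symm.toContinuousLinearEquiv : L2I W →L[ℝ] L2I W) v :=
  (adjointIsometry ι hAd u).symm.toContinuousLinearEquiv.hasFDerivAt.comp v
    ((hasFDerivAt_id v).sub_const u)

theorem adjointField_eq (hAd : ∀ (g : G) (w : W), ‖adjointAction ι g w‖ = ‖w‖) (u v : L2I W) :
    adjointField G ι v = adjointField G ι u * adjointField G ι (toOrigin ι hAd u v) := by
  rw [← adjointField_add ι hAd, add_toOrigin]

theorem logPrimitive_eq (hAd : ∀ (g : G) (w : W), ‖adjointAction ι g w‖ = ‖w‖) (u v : L2I W) :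
    (logPrimitive ι v 1 : G) = logPrimitive ι u 1 * logPrimitive ι (toOrigin ι hAd u v) 1 := by
  have h := logPrimitive_add (G := G) ι hAd u (toOrigin ι hAd u v) (t := 1) (by simp)
  rwa [add_toOrigin] at h

/-- By the group law, smoothness of the adjoint field at the origin implies smoothness everywhere. -/
theorem contDiff_adjointField (hAd : ∀ (g : G) (w : W), ‖adjointAction ι g w‖ = ‖w‖) :
    ContDiff ℝ ∞ (adjointField G ι : L2I W → C(unitInterval, W →L[ℝ] W)) := by
  obtain ⟨x, a, hx, hx0, hx', -, ha, ha0, h⟩ := exists_local_adjointField ι hAd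
  have h0 : ContDiffAt ℝ ∞ (adjointField G ι : L2I W → C(unitInterval, W →L[ℝ] W)) 0 :=
    ((contDiff_infty_superposition a ha).contDiffAt.comp 0 hx).congr_of_eventuallyEq
      (h.mono fun u hu => hu.1)
  refine contDiff_iff_contDiffAt.2 fun u => ?_
  rw [show (adjointField G ι : L2I W → C(unitInterval, W →L[ℝ] W)) = fun v =>
    bilinC (ContinuousLinearMap.compL ℝ W W W) (adjointField G ι u)
      (adjointField G ι (toOrigin ι hAd u v)) from funext fun v => adjointField_eq ι hAd u v]
  refine (contDiff_bilinC_apply (ContinuousLinearMap.compL ℝ W W W)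
    (adjointField G ι u)).contDiffAt.comp u
    (ContDiffAt.comp (g := adjointField G ι) u ?_ (contDiff_toOrigin ι hAd u).contDiffAt)
  rw [toOrigin_self]
  exact h0

/-- The differential of the adjoint field, after translation to the origin. -/
theorem exists_fderiv_adjointField (hAd : ∀ (g : G) (w : W), ‖adjointAction ι g w‖ = ‖w‖) :
    ∃ B : W →L[ℝ] W →L[ℝ] W, ∀ u X : L2I W,
      fderiv ℝ (adjointField G ι : L2I W → C(unitInterval, W →L[ℝ] W)) u X = adjointField G ι u *
        (B.compLeftContinuous ℝ unitInterval) (primI W ((adjointIsometry ι hAd u).symm X)) := by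
  obtain ⟨x, a, hx, hx0, hx', -, ha, ha0, h⟩ := exists_local_adjointField ι hAd
  refine ⟨fderiv ℝ a 0, fun u X => ContinuousMap.ext fun t => ?_⟩
  have h1 : HasFDerivAt (fun v => x (toOrigin ι hAd u v)) ((primI W).comp
      ((adjointIsometry ι hAd u).symm.toContinuousLinearEquiv : L2I W →L[ℝ] L2I W)) u :=
    HasFDerivAt.comp u (by rw [toOrigin_self]; exact hx') (hasFDerivAt_toOrigin ι hAd u u)
  obtain ⟨D, hD, hDX⟩ := h1.superposition a ha
  have h2 := (hD.bilinC_apply (ContinuousLinearMap.compL ℝ W W W)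
    (adjointField G ι u)).congr_of_eventuallyEq (f₁ := adjointField G ι) (by
      have h3 : Tendsto (toOrigin ι hAd u) (𝓝 u) (𝓝 0) := by
        have := (contDiff_toOrigin ι hAd u).continuous.tendsto u
        rwa [toOrigin_self] at this
      filter_upwards [h3.eventually h] with v hv
      rw [← hv.1]
      exact adjointField_eq ι hAd u v)
  rw [h2.fderiv]
  show (adjointField G ι u t).comp (D X t) = _
  rw [hDX, toOrigin_self, hx0]
  rfl

/-- The adjoint fields over a bounded set stay in a compact set. For small `u` they are images of
primitives of bounded functions, and the others are products of boundedly many of these. -/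
theorem exists_isCompact_adjointField (hAd : ∀ (g : G) (w : W), ‖adjointAction ι g w‖ = ‖w‖)
    (R : ℝ) : ∃ 𝒦 : Set C(unitInterval, W →L[ℝ] W), IsCompact 𝒦 ∧
      ∀ u : L2I W, ‖u‖ ≤ R → adjointField G ι u ∈ 𝒦 := by
  obtain ⟨x, a, -, -, -, ⟨𝒦, h𝒦, hx⟩, -, -, h⟩ := exists_local_adjointField ι hAd
  obtain ⟨ε, hε, hball⟩ := Metric.eventually_nhds_iff_ball.1 (hx.and h)
  let Q : Set C(unitInterval, W →L[ℝ] W) := (fun f => a.comp f) '' 𝒦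
  have hQ : IsCompact Q := h𝒦.image a.continuous_postcomp
  have hsmall : ∀ u : L2I W, ‖u‖ < ε → adjointField G ι u ∈ Q := fun u hu => by
    obtain ⟨h1, h2⟩ := hball u (by rwa [mem_ball_zero_iff])
    rw [h2.1]
    exact mem_image_of_mem _ h1
  let P : ℕ → Set C(unitInterval, W →L[ℝ] W) := fun n =>
    Nat.rec Q (fun _ S => (fun p : C(unitInterval, W →L[ℝ] W) × C(unitInterval, W →L[ℝ] W) =>
      p.1 * p.2) '' (S ×ˢ Q)) n
  have hP : ∀ n, IsCompact (P n) := fun n => by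
    induction n with
    | zero => exact hQ
    | succ n ih => exact (ih.prod hQ).image continuous_mul
  obtain ⟨n, hn⟩ := exists_nat_gt (R / ε)
  refine ⟨P n, hP n, fun u hu => ?_⟩
  refine exists_of_norm_lt_of_step (P := fun n (u : L2I W) => adjointField G ι u ∈ P n)
    hsmall ?_ n u ?_
  · intro n u v hu hv
    rw [adjointField_eq ι hAd u v]
    refine ⟨(_, _), ⟨hu, hsmall _ ?_⟩, rfl⟩
    rwa [toOrigin, LinearIsometryEquiv.norm_map]
  · rw [div_lt_iff₀ hε] at hn
    exact hu.trans_lt (hn.trans_le (mul_le_mul_of_nonneg_right (by linarith) hε.le))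

end GlobalSolutions

/-! ### The endpoint map -/

section FibresOfTransport

attribute [-instance] Bundle.instNormedAddCommGroupOfRiemannianBundleOfIsTopologicalAddGroupOfContinuousConstSMulReal
  Bundle.instInnerProductSpaceReal

variable {E : Type*} [NormedAddCommGroup E] [NormedSpace ℝ E] [FiniteDimensional ℝ E]
  {G : Type*} [TopologicalSpace G] [ChartedSpace E G] [Group G] [LieGroup 𝓘(ℝ, E) ∞ G]
  [IsTopologicalGroup G] [T2Space G] [CompactSpace G]
  {W : Type u} [NormedAddCommGroup W] [InnerProductSpace ℝ W] [FiniteDimensional ℝ W]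
  [CompleteSpace W] (ι : W ≃L[ℝ] E)

variable (G) in
/-- The endpoint of the path from the identity with right logarithmic derivative `u`. -/
noncomputable def transportEnd (u : L2I W) : G := logPrimitive ι u 1

variable (G) in
/-- The normal framing of the fibres: the adjoint action along the path with logarithmic derivative
`u`, applied to the constant functions. -/
noncomputable def normalFrame (u : L2I W) : W →L[ℝ] L2I W :=
  (mulI (adjointField G ι u)).comp (constI W)

theorem normalFrame_apply (hAd : ∀ (g : G) (w : W), ‖adjointAction ι g w‖ = ‖w‖) (u : L2I W)
    (w : W) : normalFrame G ι u w = adjointIsometry ι hAd u (constI W w) := rfl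

theorem contDiff_normalFrame (hAd : ∀ (g : G) (w : W), ‖adjointAction ι g w‖ = ‖w‖) :
    ContDiff ℝ ∞ (normalFrame G ι : L2I W → W →L[ℝ] L2I W) :=
  (contDiff_mulI.comp (contDiff_adjointField ι hAd)).clm_comp contDiff_const

/-- The derivative of the normal frame at `u` is, after translation to the origin, a Volterra operator:
the primitive followed by a pointwise multiplication. -/
theorem exists_fderiv_normalFrame (hAd : ∀ (g : G) (w : W), ‖adjointAction ι g w‖ = ‖w‖) :
    ∃ B : W →L[ℝ] W →L[ℝ] W, ∀ (u X : L2I W) (w : W),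
      fderiv ℝ (normalFrame G ι : L2I W → W →L[ℝ] L2I W) u X w =
        adjointIsometry ι hAd u (mulI ((B.compLeftContinuous ℝ unitInterval)
          (primI W ((adjointIsometry ι hAd u).symm X))) (constI W w)) := by
  obtain ⟨B, hB⟩ := exists_fderiv_adjointField ι hAd
  refine ⟨B, fun u X w => ?_⟩
  have h1 := ((contDiff_adjointField ι hAd).differentiable (by simp) u).hasFDerivAt
  obtain ⟨D, hD, hDX⟩ := h1.bilinI_apply (ContinuousLinearMap.id ℝ (W →L[ℝ] W)) (constI W w)
  have h3 := ((contDiff_normalFrame ι hAd).differentiable (by simp) u).hasFDerivAt.clm_apply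
    (hasFDerivAt_const w u)
  have h4 := congrArg (fun L : L2I W →L[ℝ] L2I W => L X) (h3.unique hD)
  have h5 : fderiv ℝ (normalFrame G ι : L2I W → W →L[ℝ] L2I W) u X w = D X := by
    rw [← h4]
    simp
  rw [h5, hDX, hB]
  exact mulI_mul _ _ _

/-- The adjoint of the normal frame is the integral over `[0,1]` after translation to the origin. -/
theorem adjointL_normalFrame (hAd : ∀ (g : G) (w : W), ‖adjointAction ι g w‖ = ‖w‖)
    (u X : L2I W) : adjointL (L2I W) W (normalFrame G ι u) X =
      primI W ((adjointIsometry ι hAd u).symm X) 1 := by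
  rw [← adjointL_constI]
  refine ext_inner_left ℝ fun w => ?_
  rw [adjointL_inner_right, adjointL_inner_right, normalFrame_apply ι hAd,
    ← (adjointIsometry ι hAd u).inner_map_map (constI W w), LinearIsometryEquiv.apply_symm_apply]

theorem inner_normalFrame (hAd : ∀ (g : G) (w : W), ‖adjointAction ι g w‖ = ‖w‖)
    (u : L2I W) (ξ η : W) :
    inner ℝ (normalFrame G ι u ξ) (normalFrame G ι u η) = inner ℝ ξ η := by
  rw [← adjointL_inner_right, adjointL_normalFrame ι hAd, normalFrame_apply ι hAd,
    LinearIsometryEquiv.symm_apply_apply, primI_constI, Set.Icc.coe_one, one_smul]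

/-- Near each point `u`, the map `transportEnd` is the composition of a submersion to `W`, whose
differential at `u` is the adjoint of the normal frame, with a parametrization of `G`. -/
theorem exists_local_transportEnd (hAd : ∀ (g : G) (w : W), ‖adjointAction ι g w‖ = ‖w‖)
    (u : L2I W) : ∃ y : L2I W → W, ContDiffAt ℝ ∞ y u ∧ y u = 0 ∧
      HasFDerivAt y (adjointL (L2I W) W (normalFrame G ι u)) u ∧
      ∀ᶠ v in 𝓝 u, transportEnd G ι v = transportEnd G ι u * unitParam G ι (y v) := by
  obtain ⟨x, a, hx, hx0, hx', -, -, -, h⟩ := exists_local_adjointField ι hAd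
  let ev : C(unitInterval, W) →L[ℝ] W := ContinuousMap.evalCLM ℝ 1
  have h1 : HasFDerivAt (fun v => x (toOrigin ι hAd u v)) ((primI W).comp
      ((adjointIsometry ι hAd u).symm.toContinuousLinearEquiv : L2I W →L[ℝ] L2I W)) u :=
    HasFDerivAt.comp u (by rw [toOrigin_self]; exact hx') (hasFDerivAt_toOrigin ι hAd u u)
  refine ⟨fun v => ev (x (toOrigin ι hAd u v)), ?_, ?_, ?_, ?_⟩
  · refine ev.contDiff.contDiffAt.comp u
      (ContDiffAt.comp (g := x) u ?_ (contDiff_toOrigin ι hAd u).contDiffAt)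
    rw [toOrigin_self]
    exact hx
  · beta_reduce
    rw [toOrigin_self, hx0, map_zero]
  · refine (ev.hasFDerivAt.comp u h1).congr_fderiv ?_
    refine ContinuousLinearMap.ext fun X => ?_
    rw [adjointL_normalFrame ι hAd]
    rfl
  · have h3 : Tendsto (toOrigin ι hAd u) (𝓝 u) (𝓝 0) := by
      have := (contDiff_toOrigin ι hAd u).continuous.tendsto u
      rwa [toOrigin_self] at this
    filter_upwards [h3.eventually h] with v hv
    rw [transportEnd, logPrimitive_eq ι hAd u v, hv.2]
    rfl

theorem contMDiff_transportEnd (hAd : ∀ (g : G) (w : W), ‖adjointAction ι g w‖ = ‖w‖) :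
    ContMDiff 𝓘(ℝ, L2I W) 𝓘(ℝ, E) ∞ (transportEnd G ι : L2I W → G) := by
  intro u
  obtain ⟨y, hy, hy0, -, h⟩ := exists_local_transportEnd ι hAd u
  refine ContMDiffAt.congr_of_eventuallyEq ?_ h
  exact contMDiffAt_const.mul (contMDiffAt_unitParam_comp G ι hy hy0)

/-- The differential of the endpoint map is the adjoint of the normal frame, followed by the left
translation from the Lie algebra. -/
theorem hasMFDerivAt_transportEnd (hAd : ∀ (g : G) (w : W), ‖adjointAction ι g w‖ = ‖w‖)
    (u : L2I W) : HasMFDerivAt 𝓘(ℝ, L2I W) 𝓘(ℝ, E) (transportEnd G ι : L2I W → G) u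
      (((mfderiv 𝓘(ℝ, E) 𝓘(ℝ, E) (fun x : G => transportEnd G ι u * x) (1 : G) : E →L[ℝ] E).comp
        (ι : W →L[ℝ] E)).comp (adjointL (L2I W) W (normalFrame G ι u))) := by
  obtain ⟨y, hy, hy0, hy', h⟩ := exists_local_transportEnd ι hAd u
  have hL : HasMFDerivAt 𝓘(ℝ, E) 𝓘(ℝ, E) (fun x : G => transportEnd G ι u * x) (1 : G)
      (mfderiv 𝓘(ℝ, E) 𝓘(ℝ, E) (fun x : G => transportEnd G ι u * x) (1 : G)) :=
    ((contMDiff_mul_left (I := 𝓘(ℝ, E)) (n := ∞) (a := transportEnd G ι u)).mdifferentiable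
      (by simp) 1).hasMFDerivAt
  have h1 : HasMFDerivAt 𝓘(ℝ, W) 𝓘(ℝ, E) (fun y => transportEnd G ι u * unitParam G ι y) 0
      ((mfderiv 𝓘(ℝ, E) 𝓘(ℝ, E) (fun x : G => transportEnd G ι u * x) (1 : G) : E →L[ℝ] E).comp
        (ι : W →L[ℝ] E)) :=
    HasMFDerivAt.comp (g := fun x : G => transportEnd G ι u * x) (f := unitParam G ι) (0 : W)
      (by rw [unitParam_zero]; exact hL) (hasMFDerivAt_unitParam_zero ι)
  have h2 := HasMFDerivAt.comp (g := fun y => transportEnd G ι u * unitParam G ι y) (f := y) u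
    (by rw [hy0]; exact h1) hy'.hasMFDerivAt
  exact h2.congr_of_eventuallyEq h

/-- The range of the endpoint map is a subgroup of `G`, and it is a neighbourhood of the identity; hence
it is open and closed. -/
theorem transportEnd_surjective [ConnectedSpace G]
    (hAd : ∀ (g : G) (w : W), ‖adjointAction ι g w‖ = ‖w‖) :
    Function.Surjective (transportEnd G ι : L2I W → G) := by
  have hmul : ∀ u v : L2I W, transportEnd G ι (u + adjointIsometry ι hAd u v) =
      transportEnd G ι u * transportEnd G ι v := fun u v =>
    logPrimitive_add ι hAd u v (by simp)
  have hone : transportEnd G ι (0 : L2I W) = 1 := logPrimitive_zero_one ι hAd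
  let S : Subgroup G :=
    { carrier := range (transportEnd G ι : L2I W → G)
      mul_mem' := by
        rintro _ _ ⟨u, rfl⟩ ⟨v, rfl⟩
        exact ⟨_, hmul u v⟩
      one_mem' := ⟨0, hone⟩
      inv_mem' := by
        rintro _ ⟨u, rfl⟩
        refine ⟨toOrigin ι hAd u 0, ?_⟩
        refine eq_inv_of_mul_eq_one_right ?_
        rw [← hmul, add_toOrigin, hone] }
  have hS : IsOpen (S : Set G) := by
    refine S.isOpen_of_mem_nhds (g := 1) ?_
    obtain ⟨y, hy, hy0, hy', h⟩ := exists_local_transportEnd (G := G) ι hAd 0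
    have h1 : HasStrictFDerivAt y (adjointL (L2I W) W (normalFrame G ι 0)) 0 :=
      hy.hasStrictFDerivAt' hy' (by simp)
    have h2 : map y (𝓝 0) = 𝓝 (y 0) := h1.map_nhds_eq_of_surj (by
      refine LinearMap.range_eq_top.2 fun w => ⟨normalFrame G ι 0 w, ?_⟩
      refine ext_inner_left ℝ fun w' => ?_
      exact (adjointL_inner_right _ _ _).trans (inner_normalFrame ι hAd 0 w' w))
    rw [hy0] at h2
    have h3 : y '' {v | transportEnd G ι v = transportEnd G ι 0 * unitParam G ι (y v)} ∈
        𝓝 (0 : W) := by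
      rw [← h2]
      exact image_mem_map h
    filter_upwards [(tendsto_unitChart (G := G) ι).eventually h3, eventually_unitChart (G := G) ι]
      with g hg hg'
    obtain ⟨v, hv, hvg⟩ := hg
    refine ⟨v, ?_⟩
    rw [show transportEnd G ι v = transportEnd G ι 0 * unitParam G ι (y v) from hv, hvg, hg'.2,
      hone, one_mul]
  have h := IsClopen.eq_univ ⟨S.isClosed_of_isOpen hS, hS⟩ ⟨1, S.one_mem⟩
  exact range_eq_univ.1 h

end FibresOfTransport

/-! ### The fibres of the endpoint map -/

section FibresAreMinimal

attribute [-instance] Bundle.instNormedAddCommGroupOfRiemannianBundleOfIsTopologicalAddGroupOfContinuousConstSMulReal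
  Bundle.instInnerProductSpaceReal

variable {E : Type*} [NormedAddCommGroup E] [NormedSpace ℝ E] [FiniteDimensional ℝ E]
  {G : Type*} [TopologicalSpace G] [ChartedSpace E G] [Group G] [LieGroup 𝓘(ℝ, E) ∞ G]
  [IsTopologicalGroup G] [T2Space G] [CompactSpace G]
  {W : Type u} [NormedAddCommGroup W] [InnerProductSpace ℝ W] [FiniteDimensional ℝ W]
  [CompleteSpace W] (ι : W ≃L[ℝ] E)

/-- In the chart at the identity, the left translation by an element near the identity is a local
diffeomorphism near `0`. -/
theorem eventually_exists_fderiv_leftTranslation : ∀ᶠ h in 𝓝 (1 : G),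
    ContMDiffAt 𝓘(ℝ, E) 𝓘(ℝ, W) ∞ (unitChart ι) h ∧ unitParam G ι (unitChart ι h) = h ∧
    ∃ S : W ≃L[ℝ] W, HasFDerivAt (fun x => unitChart ι (h * unitParam G ι x)) (S : W →L[ℝ] W) 0 := by
  have h1 := (eventually_unitChart (G := G) ι)
  filter_upwards [h1.eventually_nhds,
    (tendsto_unitChart (G := G) ι).eventually (eventually_unitParam (G := G) ι)] with h hh hρ
  refine ⟨hh.self_of_nhds.1, hh.self_of_nhds.2, ?_⟩
  have hθ : ContDiffAt ℝ ∞ (fun x => unitChart ι (h * unitParam G ι x)) 0 := by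
    rw [← contMDiffAt_iff_contDiffAt]
    refine ContMDiffAt.comp (g := unitChart ι) (0 : W) ?_
      (contMDiffAt_const.mul (contMDiffAt_unitParam_zero ι))
    rw [unitParam_zero, mul_one]
    exact hh.self_of_nhds.1
  have hθ' : ContDiffAt ℝ ∞ (fun y => unitChart ι (h⁻¹ * unitParam G ι y)) (unitChart ι h) :=
    contDiffAt_unitChart_comp ι (contMDiffAt_const.mul hρ.1) (by simp [hh.self_of_nhds.2])
  have hD := (hθ.differentiableAt (by simp)).hasFDerivAt
  have hD' : HasFDerivAt (fun y => unitChart ι (h⁻¹ * unitParam G ι y))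
      (fderiv ℝ (fun y => unitChart ι (h⁻¹ * unitParam G ι y)) (unitChart ι h))
      (unitChart ι (h * unitParam G ι 0)) := by
    rw [unitParam_zero, mul_one]
    exact (hθ'.differentiableAt (by simp)).hasFDerivAt
  have hid : HasFDerivAt ((fun y => unitChart ι (h⁻¹ * unitParam G ι y)) ∘
      fun x => unitChart ι (h * unitParam G ι x)) (ContinuousLinearMap.id ℝ W) 0 := by
    refine (hasFDerivAt_id (0 : W)).congr_of_eventuallyEq ?_
    have hc : Tendsto (fun x : W => h * unitParam G ι x) (𝓝 0) (𝓝 h) := by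
      simpa using (tendsto_unitParam (G := G) ι).const_mul h
    filter_upwards [hc.eventually hh, eventually_unitParam (G := G) ι] with x hx hx'
    simp only [Function.comp_apply, id]
    rw [hx.2, inv_mul_cancel_left, hx'.2]
  have hcomp := (hD'.comp (0 : W) hD).unique hid
  have hinj : Function.Injective
      (fderiv ℝ (fun x => unitChart ι (h * unitParam G ι x)) 0 : W →ₗ[ℝ] W) := by
    intro v w hvw
    have h2 := fun v => congrArg (fun L : W →L[ℝ] W => L v) hcomp
    simp only [ContinuousLinearMap.comp_apply, ContinuousLinearMap.id_apply] at h2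
    rw [← h2 v, ← h2 w]
    exact congrArg _ hvw
  exact ⟨(LinearEquiv.ofInjectiveEndo _ hinj).toContinuousLinearEquiv, hD⟩

/-- Each fibre is framed by the normal frame: near a point it is the zero set of the chart of
`g⁻¹ φ(q)`, where `φ` is the endpoint map. -/
theorem isFramedSubmanifold_fibre (hAd : ∀ (g : G) (w : W), ‖adjointAction ι g w‖ = ‖w‖) (g : G) :
    IsFramedSubmanifold (normalFrame G ι) ((transportEnd G ι : L2I W → G) ⁻¹' {g}) := by
  refine ⟨contDiff_normalFrame ι hAd, inner_normalFrame ι hAd, fun p hp => ?_⟩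
  obtain ⟨O, hO, hOo, h1O⟩ := eventually_nhds_iff.1
    (eventually_exists_fderiv_leftTranslation (G := G) ι)
  have hc : Continuous (transportEnd G ι : L2I W → G) := (contMDiff_transportEnd ι hAd).continuous
  have hdθ : ∀ q : L2I W, g⁻¹ * transportEnd G ι q ∈ O → ContDiffAt ℝ ∞
      (fun q => unitChart ι (g⁻¹ * transportEnd G ι q)) q := fun q hq => by
    rw [← contMDiffAt_iff_contDiffAt]
    exact ContMDiffAt.comp (g := unitChart ι) q (hO _ hq).1
      (contMDiffAt_const.mul (contMDiff_transportEnd ι hAd).contMDiffAt)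
  refine ⟨{q | g⁻¹ * transportEnd G ι q ∈ O}, fun q => unitChart ι (g⁻¹ * transportEnd G ι q),
    hOo.preimage (continuous_const.mul hc), ?_, fun q hq => (hdθ q hq).contDiffWithinAt, ?_, ?_⟩
  · show g⁻¹ * transportEnd G ι p ∈ O
    rw [show transportEnd G ι p = g from hp, inv_mul_cancel]
    exact h1O
  · intro q hq
    obtain ⟨-, -, S, hS⟩ := hO _ hq
    obtain ⟨y, hy, hy0, hy', h⟩ := exists_local_transportEnd (G := G) ι hAd q
    refine ⟨S, HasFDerivAt.fderiv ?_⟩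
    have h2 : HasFDerivAt ((fun x => unitChart ι (g⁻¹ * transportEnd G ι q * unitParam G ι x)) ∘ y)
        _ q := HasFDerivAt.comp q (by rw [hy0]; exact hS) hy'
    refine h2.congr_of_eventuallyEq ?_
    filter_upwards [h] with v hv
    rw [hv, Function.comp_apply, mul_assoc]
  · ext q
    constructor
    · rintro ⟨hq, hqU⟩
      refine ⟨hqU, ?_⟩
      beta_reduce
      rw [show transportEnd G ι q = g from hq, inv_mul_cancel, unitChart_one]
    · rintro ⟨hqU, hq⟩
      beta_reduce at hq
      refine ⟨?_, hqU⟩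
      have h2 := (hO _ hqU).2.1
      rw [hq, unitParam_zero] at h2
      exact (inv_mul_eq_one.1 h2.symm).symm

/-- The fibres of the endpoint map are minimal regularizable submanifolds. -/
theorem isMinimalRegularizableSubmanifold_fibre
    (hAd : ∀ (g : G) (w : W), ‖adjointAction ι g w‖ = ‖w‖) (g : G) :
    IsMinimalRegularizableSubmanifold ((transportEnd G ι : L2I W → G) ⁻¹' {g}) := by
  obtain ⟨B, hB⟩ := exists_fderiv_normalFrame (G := G) ι hAd
  refine (isFramedSubmanifold_fibre ι hAd g).isMinimalRegularizableSubmanifold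
    (isClosed_singleton.preimage (contMDiff_transportEnd ι hAd).continuous) ?_ ?_ ?_ ?_ ?_
  · intro R r
    obtain ⟨𝒦, h𝒦, hsub⟩ := exists_isCompact_adjointField (G := G) ι hAd R
    refine ⟨(fun q : C(unitInterval, W →L[ℝ] W) × W => mulI q.1 (constI W q.2)) ''
      (𝒦 ×ˢ Metric.closedBall 0 r), ?_, ?_⟩
    · refine (h𝒦.prod (isCompact_closedBall 0 r)).image ?_
      exact ((contDiff_mulI (W := W)).continuous.comp continuous_fst).clm_apply
        ((constI W).continuous.comp continuous_snd)
    · intro p hp ζ hζ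
      exact ⟨(adjointField G ι p, ζ), ⟨hsub p hp, by simpa using hζ⟩, rfl⟩
  · intro p _ ζ
    have h1 : IsCompactOperator ((primI W).comp
        ((adjointIsometry ι hAd p).symm.toContinuousLinearEquiv : L2I W →L[ℝ] L2I W)) :=
      isCompactOperator_primI.comp_clm _
    have hc : Continuous fun f : C(unitInterval, W) => adjointIsometry ι hAd p
        (mulI ((B.compLeftContinuous ℝ unitInterval) f) (constI W ζ)) :=
      (adjointIsometry ι hAd p).continuous.comp (((contDiff_mulI (W := W)).continuous.comp
        (B.compLeftContinuous ℝ unitInterval).continuous).clm_apply continuous_const)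
    have h2 := h1.continuous_comp hc
    rw [show ⇑((fderiv ℝ (normalFrame G ι : L2I W → W →L[ℝ] L2I W) p).flip ζ) = _ from
      funext fun X => hB p X ζ]
    exact h2
  · intro p _ ζ y hy
    have h1 : adjointIsometry ι hAd p ((adjointIsometry ι hAd p).symm y +
        mulI ((B.compLeftContinuous ℝ unitInterval)
          (primI W ((adjointIsometry ι hAd p).symm y))) (constI W ζ)) = 0 := by
      rw [map_add, LinearIsometryEquiv.apply_symm_apply, ← hB]
      exact hy
    rw [← LinearIsometryEquiv.map_zero (adjointIsometry ι hAd p)] at h1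
    have h2 := eq_zero_of_add_mulI_primI_eq_zero B ζ _ ((adjointIsometry ι hAd p).injective h1)
    simpa using h2
  · intro p _ ζ
    refine ⟨(‖B‖ * ‖ζ‖) ^ 2 * Module.finrank ℝ W, fun κ _ e he => ?_⟩
    have hB0 : 0 ≤ ‖B‖ := B.opNorm_nonneg
    let e' : κ → L2I W := fun i => (adjointIsometry ι hAd p).symm (e i)
    have he' : Orthonormal ℝ e' := he.comp_linearIsometryEquiv (adjointIsometry ι hAd p).symm
    simp_rw [hB, LinearIsometryEquiv.norm_map]
    refine sum_norm_sq_L2I_le _ _ ?_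
    have h1 : ∀ i, ∀ᵐ t ∂(volume.restrict (Icc (0 : ℝ) 1)),
        ‖mulI ((B.compLeftContinuous ℝ unitInterval) (primI W (e' i))) (constI W ζ) t‖ ≤
          ‖B‖ * ‖ζ‖ * ‖primI W (e' i) (projI t)‖ := fun i => by
      filter_upwards [coeFn_mulI ((B.compLeftContinuous ℝ unitInterval) (primI W (e' i)))
        (constI W ζ), coeFn_constI ζ] with t h1 h2
      rw [h1, h2, mul_right_comm]
      exact B.le_opNorm₂ _ _
    filter_upwards [ae_all_iff.2 h1] with t ht
    refine (Finset.sum_le_sum fun i _ => pow_le_pow_left₀ (norm_nonneg _) (ht i) 2).trans ?_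
    simp_rw [mul_pow _ ‖primI W _ _‖]
    rw [← Finset.mul_sum]
    exact mul_le_mul_of_nonneg_left (sum_norm_sq_primI_le he' _) (by positivity)
  · intro p _
    refine ⟨(adjointIsometry ι hAd p).symm.trans
      ((reverseI W).trans (adjointIsometry ι hAd p)), fun ζ => ?_, fun ζ X hX => ⟨0, ?_⟩⟩
    · rw [normalFrame_apply ι hAd]
      simp [reverseI_constI]
    · rw [adjointL_normalFrame ι hAd] at hX
      simp only [LinearIsometryEquiv.trans_apply, hB, LinearIsometryEquiv.symm_apply_apply, map_zero]
      set f := (adjointIsometry ι hAd p).symm X with hf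
      have h1 : (B.compLeftContinuous ℝ unitInterval) (primI W (reverseI W f)) =
          -((B.compLeftContinuous ℝ unitInterval) (primI W f)).comp
            ⟨unitInterval.symm, unitInterval.continuous_symm⟩ := by
        refine ContinuousMap.ext fun t => ?_
        show B (primI W (reverseI W f) t) = -B (primI W f (unitInterval.symm t))
        rw [primI_reverseI f hX, map_neg]
      have h2 := mulI_comp_symm_reverseI ((B.compLeftContinuous ℝ unitInterval) (primI W f))
        (constI W ζ)
      rw [reverseI_constI] at h2
      rw [h1, map_neg, neg_apply, h2, map_neg, neg_add_cancel]

end FibresAreMinimal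

/-! ### Bi-invariant metrics -/

section BiinvariantMetric

variable {E : Type*} [NormedAddCommGroup E] [NormedSpace ℝ E]
  {G : Type*} [TopologicalSpace G] [ChartedSpace E G] [Group G] [LieGroup 𝓘(ℝ, E) ∞ G]
  [RiemannianBundle (fun x : G => TangentSpace 𝓘(ℝ, E) x)]

variable (E G) in
/-- The identification of the Lie algebra, with the norm given by the metric, with the model
space. -/
noncomputable def lieAlgebraEquiv : TangentSpace 𝓘(ℝ, E) (1 : G) ≃L[ℝ] E :=
  ContinuousLinearEquiv.refl ℝ E

/-- The inner products of tangent spaces at equal points agree. The tangent spaces are all the model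
space `E`, but their inner products depend on the base point. -/
theorem inner_tangentSpace_congr {g h : G} (hgh : g = h) (v w : E) :
    inner ℝ (show TangentSpace 𝓘(ℝ, E) g from v) (show TangentSpace 𝓘(ℝ, E) g from w) =
      inner ℝ (show TangentSpace 𝓘(ℝ, E) h from v) (show TangentSpace 𝓘(ℝ, E) h from w) := by
  subst hgh
  rfl

/-- For a bi-invariant metric, the adjoint action is isometric. -/
theorem IsBiinvariantMetric.norm_adjointAction (hbi : IsBiinvariantMetric E G) (g : G)
    (w : TangentSpace 𝓘(ℝ, E) (1 : G)) : ‖adjointAction (lieAlgebraEquiv E G) g w‖ = ‖w‖ := by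
  let A : E →L[ℝ] E := mfderiv 𝓘(ℝ, E) 𝓘(ℝ, E) (fun x : G => g * x) (1 : G)
  let B : E →L[ℝ] E := mfderiv 𝓘(ℝ, E) 𝓘(ℝ, E) (fun x : G => x * g⁻¹) (g * 1)
  have hA : HasMFDerivAt 𝓘(ℝ, E) 𝓘(ℝ, E) (fun x : G => g * x) (1 : G) A :=
    ((contMDiff_mul_left (I := 𝓘(ℝ, E)) (n := ∞) (a := g)).mdifferentiable (by simp)
      1).hasMFDerivAt
  have hB : HasMFDerivAt 𝓘(ℝ, E) 𝓘(ℝ, E) (fun x : G => x * g⁻¹) (g * 1) B :=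
    ((contMDiff_mul_right (I := 𝓘(ℝ, E)) (n := ∞) (a := g⁻¹)).mdifferentiable (by simp)
      (g * 1)).hasMFDerivAt
  have h1 : HasMFDerivAt 𝓘(ℝ, E) 𝓘(ℝ, E) (fun x : G => g * x * g⁻¹) (1 : G) (B.comp A) :=
    HasMFDerivAt.comp (g := fun x : G => x * g⁻¹) (f := fun x : G => g * x) (1 : G) hB hA
  have h2 := HasMFDerivAt.comp (g := fun x : G => g * x * g⁻¹)
    (f := unitParam G (lieAlgebraEquiv E G)) 0
    (by rw [unitParam_zero]; exact h1) (hasMFDerivAt_unitParam_zero (lieAlgebraEquiv E G))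
  have h3 := HasMFDerivAt.comp (g := unitChart (lieAlgebraEquiv E G)) 0
    (by
      rw [Function.comp_apply, unitParam_zero, mul_one, mul_inv_cancel]
      exact hasMFDerivAt_unitChart_one (lieAlgebraEquiv E G)) h2
  have h4 := congrArg (fun L : TangentSpace 𝓘(ℝ, E) (1 : G) →L[ℝ] TangentSpace 𝓘(ℝ, E) (1 : G) =>
    L w) ((hasFDerivAt_conj (lieAlgebraEquiv E G) g).unique h3.hasFDerivAt)
  have h5 : adjointAction (lieAlgebraEquiv E G) g w = B (A w) := h4
  rw [h5]
  have h6 := (hbi g 1 w w).1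
  have h7 := (hbi g⁻¹ (g * 1) (A w) (A w)).2
  have h8 := inner_tangentSpace_congr (E := E) (G := G) (g := g * 1 * g⁻¹) (h := 1) (by simp)
    (B (A w)) (B (A w))
  have h9 : inner ℝ (show TangentSpace 𝓘(ℝ, E) (1 : G) from B (A w))
      (show TangentSpace 𝓘(ℝ, E) (1 : G) from B (A w)) = inner ℝ w w :=
    h8.symm.trans (h7.trans h6)
  rw [real_inner_self_eq_norm_sq, real_inner_self_eq_norm_sq] at h9
  exact (pow_left_inj₀ (norm_nonneg _) (norm_nonneg _) two_ne_zero).1 h9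

end BiinvariantMetric

/-! ### The parallel transport map -/

section ParallelTransport

variable {E : Type*} [NormedAddCommGroup E] [NormedSpace ℝ E] [FiniteDimensional ℝ E]
  {G : Type*} [TopologicalSpace G] [ChartedSpace E G] [Group G] [LieGroup 𝓘(ℝ, E) ∞ G]
  [RiemannianBundle (fun x : G => TangentSpace 𝓘(ℝ, E) x)]

instance : FiniteDimensional ℝ (TangentSpace 𝓘(ℝ, E) (1 : G)) :=
  inferInstanceAs (FiniteDimensional ℝ E)

instance : CompleteSpace (TangentSpace 𝓘(ℝ, E) (1 : G)) :=
  FiniteDimensional.complete ℝ _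

variable [IsTopologicalGroup G] [T2Space G] [CompactSpace G]

theorem isTransportPath_iff {u : H0 E G} {γ : ℝ → G} :
    IsTransportPath u γ ↔ IsLogPrimitive (lieAlgebraEquiv E G) u γ := by
  unfold IsTransportPath IsLogPrimitive
  simp only [hasLogDerivAt_iff]
  rfl

theorem parallelTransportMap_eq (hbi : IsBiinvariantMetric E G) :
    (parallelTransportMap : H0 E G → G) = transportEnd G (lieAlgebraEquiv E G) := by
  funext u
  have h := isLogPrimitive_logPrimitive (lieAlgebraEquiv E G) hbi.norm_adjointAction u
  obtain ⟨γ, hγ, hγ1⟩ := Classical.epsilon_spec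
    (p := fun g : G => ∃ γ : ℝ → G, IsTransportPath u γ ∧ γ 1 = g)
    ⟨_, _, isTransportPath_iff.2 h, rfl⟩
  have h1 : γ 1 = parallelTransportMap u := hγ1
  rw [← h1, (isTransportPath_iff.1 hγ).eqOn _ h (by simp)]
  rfl

/-- The orthogonal complement of the kernel of the differential at `u` is the range of the normal frame,
on which the differential is the composition of two isometries. -/
theorem isRiemannianSubmersion_transportEnd [ConnectedSpace G] (hbi : IsBiinvariantMetric E G) :
    IsRiemannianSubmersion (E := E) (transportEnd G (lieAlgebraEquiv E G) : H0 E G → G) := by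
  have hAd := hbi.norm_adjointAction
  set φ := (transportEnd G (lieAlgebraEquiv E G) : H0 E G → G) with hφ
  let N : H0 E G → TangentSpace 𝓘(ℝ, E) (1 : G) →L[ℝ] H0 E G := normalFrame G (lieAlgebraEquiv E G)
  let L : G → E →L[ℝ] E := fun g => mfderiv 𝓘(ℝ, E) 𝓘(ℝ, E) (fun x : G => g * x) (1 : G)
  have hd : ∀ u X : H0 E G, mfderiv 𝓘(ℝ, H0 E G) 𝓘(ℝ, E) φ u X =
      L (φ u) (adjointL (H0 E G) (TangentSpace 𝓘(ℝ, E) (1 : G)) (N u) X) := fun u X => by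
    rw [(hasMFDerivAt_transportEnd (lieAlgebraEquiv E G) hAd u).mfderiv]
    rfl
  have hL : ∀ (u : H0 E G) (v w : TangentSpace 𝓘(ℝ, E) (1 : G)),
      inner ℝ (show TangentSpace 𝓘(ℝ, E) (φ u) from L (φ u) v)
        (show TangentSpace 𝓘(ℝ, E) (φ u) from L (φ u) w) = inner ℝ v w := fun u v w =>
    (inner_tangentSpace_congr (E := E) (G := G) (mul_one (φ u)) _ _).symm.trans
      ((hbi (φ u) 1 v w).1)
  have hLinj : ∀ (u : H0 E G) (v : TangentSpace 𝓘(ℝ, E) (1 : G)), L (φ u) v = 0 → v = 0 := by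
    intro u v hv
    have h1 := hL u v v
    rw [← inner_self_eq_zero (𝕜 := ℝ), ← h1]
    have h2 : (show TangentSpace 𝓘(ℝ, E) (φ u) from L (φ u) v) = 0 := hv
    rw [h2, inner_zero_left]
  have hNN : ∀ u w, adjointL (H0 E G) (TangentSpace 𝓘(ℝ, E) (1 : G)) (N u) (N u w) = w :=
    fun u w => ext_inner_left ℝ fun w' =>
      (adjointL_inner_right _ _ _).trans (inner_normalFrame (lieAlgebraEquiv E G) hAd u w' w)
  -- the vectors orthogonal to the kernel of the differential are those in the range of the frame
  have hrange : ∀ u X : H0 E G, (∀ Z : H0 E G, mfderiv 𝓘(ℝ, H0 E G) 𝓘(ℝ, E) φ u Z = 0 → inner ℝ X Z = 0) →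
      N u (adjointL (H0 E G) (TangentSpace 𝓘(ℝ, E) (1 : G)) (N u) X) = X := by
    intro u X hX
    set P := adjointL (H0 E G) (TangentSpace 𝓘(ℝ, E) (1 : G)) (N u) with hP
    have h1 : P (X - N u (P X)) = 0 := by rw [map_sub, hNN, sub_self]
    have h2 : inner ℝ X (X - N u (P X)) = 0 := hX _ ((hd _ _).trans (by rw [← hP, h1]; exact map_zero _))
    have h3 : inner ℝ (N u (P X)) (X - N u (P X)) = 0 := by
      rw [← adjointL_inner_right, ← hP, h1, inner_zero_right]
    have h4 : inner ℝ (X - N u (P X)) (X - N u (P X)) = 0 := by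
      rw [inner_sub_left, h2, h3, sub_zero]
    exact (sub_eq_zero.1 (inner_self_eq_zero.1 h4)).symm
  refine ⟨contMDiff_transportEnd _ hAd, transportEnd_surjective _ hAd, fun u => ?_,
    fun u X Y hX hY => ?_⟩
  · have hinj : Function.Injective (L (φ u) : E →ₗ[ℝ] E) :=
      (injective_iff_map_eq_zero _).2 fun v hv => hLinj u v hv
    intro w
    obtain ⟨v, hv⟩ := LinearMap.injective_iff_surjective.1 hinj w
    refine ⟨N u v, (hd u (N u v)).trans ?_⟩
    exact (congrArg (L (φ u)) (hNN u v)).trans hv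
  · refine (congrArg₂ (fun a b : TangentSpace 𝓘(ℝ, E) (φ u) => inner ℝ a b)
      (hd u X) (hd u Y)).trans ((hL u _ _).trans ?_)
    rw [adjointL_inner_left, hrange u Y hY]

end ParallelTransport

theorem proposition3p6 {E : Type*} [NormedAddCommGroup E] [NormedSpace ℝ E]
    [FiniteDimensional ℝ E]
    {G : Type*} [TopologicalSpace G] [ChartedSpace E G] [Group G] [LieGroup 𝓘(ℝ, E) ∞ G]
    [T2Space G] [CompactSpace G] [ConnectedSpace G]
    (hss : IsSemisimpleLieGroup E G)
    [RiemannianBundle (fun x : G => TangentSpace 𝓘(ℝ, E) x)]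
    (hbi : IsBiinvariantMetric E G) :
    -- the parallel transport map is well defined
    (∀ u : H0 E G, ∃ γ : ℝ → G, IsTransportPath u γ ∧
      ∀ γ' : ℝ → G, IsTransportPath u γ' → EqOn γ' γ (Icc 0 1)) ∧
    IsRiemannianSubmersion (E := E) (parallelTransportMap : H0 E G → G) ∧
    ∀ g : G, IsMinimalRegularizableSubmanifold
      ((parallelTransportMap : H0 E G → G) ⁻¹' {g}) := by
  have : IsTopologicalGroup G := topologicalGroup_of_lieGroup 𝓘(ℝ, E) ∞
  have hAd := hbi.norm_adjointAction
  refine ⟨fun u => ?_, ?_, fun g => ?_⟩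
  · have h := isLogPrimitive_logPrimitive (lieAlgebraEquiv E G) hAd u
    exact ⟨_, isTransportPath_iff.2 h, fun γ' hγ' => (isTransportPath_iff.1 hγ').eqOn _ h⟩
  · rw [parallelTransportMap_eq hbi]
    exact isRiemannianSubmersion_transportEnd hbi
  · rw [parallelTransportMap_eq hbi]
    exact isMinimalRegularizableSubmanifold_fibre (lieAlgebraEquiv E G) hAd g
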